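/- **Conventions.** Everything is smooth ($C^\infty$). A Poisson structure on an $n$-dimensional manifold $P$ is a smooth bivector field $\Pi$ whose bracket $\{f,g\}=\Pi(df,dg)$ satisfies the Jacobi identity; $\Pi^\sharp:T^*P\to TP$ is given by $\beta(\Pi^\sharp\alpha)=\Pi(\alpha,\beta)$, and the rank of $\Pi$ at $q$ is $\dim \Pi^\sharp(T_q^*P)$. A vector field is Poisson if it preserves $\Pi$, and it is tangent to the symplectic leaves if its value at each $q$ lies in $\Pi^\sharp(T_q^*P)$. For $v=\Pi^\sharp\alpha$ and $w$ in $\Pi^\sharp(T_q^*P)$ put $\Pi^{-1}(v,w)=-\alpha(w)$ (the symplectic form of the leaf). $\Pi$ is *tame* at $p$ if, for any two germs near $p$ of smooth Poisson vector fields $X_t,Y_t$ that are tangent to the symplectic leaves and depend smoothly on a (multi-dimensional) parameter $t$, the function $\Pi^{-1}(X_t,Y_t)$ is smooth near $p$ and depends smoothly on $t$ (jointly smooth in $t$ and the point). **Theorem 1.1.** Let $(P^n,\Pi)$ be a smooth Poisson manifold, $p\in P$, and $2k$ the rank of $\Pi$ at $p$. Let $G$ be a compact Lie group which acts smoothly on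 $P$, preserving $\Pi$ and fixing $p$. Assume that $\Pi$ is tame at $p$. Then there is a smooth local coordinate system $(x_1,\dots,x_k,y_1,\dots,y_k,z_1,\dots,z_{n-2k})$, centred at $p$ and defined on a $G$-invariant open neighbourhood of $p$, in which $$\Pi=\sum_{i=1}^k\frac{\partial}{\partial x_i}\wedge\frac{\partial}{\partial y_i}+\sum_{i,j=1}^{n-2k}f_{ij}(z)\,\frac{\partial}{\partial z_i}\wedge\frac{\partial}{\partial z_j},$$ where the $f_{ij}$ are smooth functions of $z=(z_1,\dots,z_{n-2k})$ alone which vanish at the origin, and in which the action of $G$ is linear and preserves the subspaces $\{x_1=y_1=\dots=x_k=y_k=0\}$ and $\{z_1=\dots=z_{n-2k}=0\}$. -/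

import Mathlib

open scoped Manifold ContDiff Topology

noncomputable section

namespace PoissonSplitting

/-! ### Bivector fields and Poisson structures -/

section Poisson

variable {n : ℕ} {P : Type*} [TopologicalSpace P] [ChartedSpace (EuclideanSpace ℝ (Fin n)) P]

/-- The cotangent space of the `n`-dimensional manifold `P` at `q`. -/
abbrev Cot (n : ℕ) {P : Type*} [TopologicalSpace P]
    [ChartedSpace (EuclideanSpace ℝ (Fin n)) P] (q : P) : Type :=
  TangentSpace (𝓡 n) q →L[ℝ] ℝ

/-- The differential `df_q`, as a covector at `q`. -/
def differential (n : ℕ) {P : Type*} [TopologicalSpace P]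
    [ChartedSpace (EuclideanSpace ℝ (Fin n)) P] (f : P → ℝ) (q : P) : Cot n q :=
  mfderiv (𝓡 n) 𝓘(ℝ, ℝ) f q

/-- The decomposable bivector `v ∧ w` at `q`, as a bilinear form on the cotangent space:
`(v ∧ w)(α, β) = α(v) β(w) - α(w) β(v)`. -/
def wedge {q : P} (v w : TangentSpace (𝓡 n) q) : Cot n q →ₗ[ℝ] Cot n q →ₗ[ℝ] ℝ :=
  LinearMap.mk₂ ℝ (fun α β => α v * β w - α w * β v)
    (fun α α' β => by simp only [add_apply]; ring)
    (fun c α β => by simp only [smul_apply, smul_eq_mul]; ring)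
    (fun α β β' => by simp only [add_apply]; ring)
    (fun c α β => by simp only [smul_apply, smul_eq_mul]; ring)

/-- The bracket `{f, g} = Π(df, dg)` of two functions. -/
def bracket (π : ∀ q : P, Cot n q →ₗ[ℝ] Cot n q →ₗ[ℝ] ℝ) (f g : P → ℝ) : P → ℝ :=
  fun q => π q (differential n f q) (differential n g q)

/-- A smooth Poisson structure on the manifold `P`: a smooth bivector field (an alternating
bilinear form on each cotangent space, whose value on the differentials of any two smooth functions
is smooth) whose bracket satisfies the Jacobi identity. -/
structure PoissonStructure (n : ℕ) (P : Type*) [TopologicalSpace P]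
    [ChartedSpace (EuclideanSpace ℝ (Fin n)) P] where
  /-- The Poisson bivector. -/
  bivector : ∀ q : P, Cot n q →ₗ[ℝ] Cot n q →ₗ[ℝ] ℝ
  alternating : ∀ (q : P) (α : Cot n q), bivector q α α = 0
  smooth : ∀ f g : P → ℝ, ContMDiff (𝓡 n) 𝓘(ℝ, ℝ) ∞ f → ContMDiff (𝓡 n) 𝓘(ℝ, ℝ) ∞ g →
    ContMDiff (𝓡 n) 𝓘(ℝ, ℝ) ∞ (bracket bivector f g)
  jacobi : ∀ f g h : P → ℝ, ContMDiff (𝓡 n) 𝓘(ℝ, ℝ) ∞ f → ContMDiff (𝓡 n) 𝓘(ℝ, ℝ) ∞ g →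
    ContMDiff (𝓡 n) 𝓘(ℝ, ℝ) ∞ h → ∀ q,
      bracket bivector f (bracket bivector g h) q + bracket bivector g (bracket bivector h f) q
        + bracket bivector h (bracket bivector f g) q = 0

namespace PoissonStructure

/-- The rank of `Π` at `q`. -/
def rankAt (Po : PoissonStructure n P) (q : P) : ℕ :=
  Module.finrank ℝ (LinearMap.range (Po.bivector q))

/-- `Π♯ α = v`, where `Π♯ : T*P → TP` is given by `β(Π♯ α) = Π(α, β)`. -/
def SharpEq (Po : PoissonStructure n P) (q : P) (α : Cot n q) (v : TangentSpace (𝓡 n) q) : Prop :=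
  ∀ β : Cot n q, β v = Po.bivector q α β

/-- `v` is tangent to the symplectic leaf through `q`: the tangent space of that leaf is the image
of `Π♯`. -/
def TangentToLeaf (Po : PoissonStructure n P) (q : P) (v : TangentSpace (𝓡 n) q) : Prop :=
  ∃ α : Cot n q, Po.SharpEq q α v

open Classical in
/-- `Π⁻¹(v, w)`: the symplectic form of the leaf through `q`, for `v`, `w` tangent to that leaf,
normalised so that `Π⁻¹(Π♯ α, w) = -α(w)` (the value `0` is used if `v` is not tangent). -/
def leafForm (Po : PoissonStructure n P) (q : P) (v w : TangentSpace (𝓡 n) q) : ℝ :=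
  if h : Po.TangentToLeaf q v then -(h.choose w) else 0

theorem bivector_antisymm (Po : PoissonStructure n P) (q : P) (α β : Cot n q) :
    Po.bivector q α β = - Po.bivector q β α := by
  have h := Po.alternating q (α + β)
  simp only [map_add, LinearMap.add_apply, Po.alternating] at h
  linarith

/-- `Π⁻¹(v, w)` does not depend on the covector `α` with `Π♯ α = v` that is used to compute it. -/
theorem leafForm_eq (Po : PoissonStructure n P) {q : P} {v w : TangentSpace (𝓡 n) q}
    {α : Cot n q} (hα : Po.SharpEq q α v) (hw : Po.TangentToLeaf q w) :
    Po.leafForm q v w = -(α w) := by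
  have h : Po.TangentToLeaf q v := ⟨α, hα⟩
  obtain ⟨β, hβ⟩ := hw
  rw [leafForm, dif_pos h, hβ, hβ, bivector_antisymm, Po.bivector_antisymm q β α,
    ← h.choose_spec β, ← hα β]

/-- `X` is a Poisson vector field on the open set `U`: it is a derivation of the bracket,
`X{f, g} = {X f, g} + {f, X g}` on `U`. -/
def IsPoissonVectorFieldOn (Po : PoissonStructure n P) (X : ∀ q : P, TangentSpace (𝓡 n) q)
    (U : Set P) : Prop :=
  ∀ f g : P → ℝ, ContMDiff (𝓡 n) 𝓘(ℝ, ℝ) ∞ f → ContMDiff (𝓡 n) 𝓘(ℝ, ℝ) ∞ g → ∀ q ∈ U,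
    differential n (bracket Po.bivector f g) q (X q)
      = bracket Po.bivector (fun q' => differential n f q' (X q')) g q
        + bracket Po.bivector f (fun q' => differential n g q' (X q')) q

/-- `X t`, `t ∈ T`, is a family of Poisson vector fields on `U` which are tangent to the symplectic
leaves, depending smoothly on the parameter `t`: it is jointly smooth on `T × U`. -/
structure IsTangentPoissonFamily [IsManifold (𝓡 n) ∞ P] (Po : PoissonStructure n P) {l : ℕ}
    (X : EuclideanSpace ℝ (Fin l) → ∀ q : P, TangentSpace (𝓡 n) q)
    (T : Set (EuclideanSpace ℝ (Fin l))) (U : Set P) : Prop where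
  smooth : ContMDiffOn ((𝓡 l).prod (𝓡 n)) (𝓡 n).tangent ∞
    (fun a : EuclideanSpace ℝ (Fin l) × P => (⟨a.2, X a.1 a.2⟩ : TangentBundle (𝓡 n) P)) (T ×ˢ U)
  poisson : ∀ t ∈ T, Po.IsPoissonVectorFieldOn (X t) U
  tangent : ∀ t ∈ T, ∀ q ∈ U, Po.TangentToLeaf q (X t q)

/-- `Π` is tame at `p`: for any two germs at `p` of smooth families `X t`, `Y t` of Poisson vector
fields tangent to the symplectic leaves (`t` near `t₀` in some `ℝˡ`), the function
`(t, q) ↦ Π⁻¹(X t, Y t)(q)` is smooth near `(t₀, p)`. -/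
def TameAt [IsManifold (𝓡 n) ∞ P] (Po : PoissonStructure n P) (p : P) : Prop :=
  ∀ (l : ℕ) (t₀ : EuclideanSpace ℝ (Fin l)) (T : Set (EuclideanSpace ℝ (Fin l))) (U : Set P),
    IsOpen T → t₀ ∈ T → IsOpen U → p ∈ U →
    ∀ X Y : EuclideanSpace ℝ (Fin l) → ∀ q : P, TangentSpace (𝓡 n) q,
      Po.IsTangentPoissonFamily X T U → Po.IsTangentPoissonFamily Y T U →
      ∃ O : Set (EuclideanSpace ℝ (Fin l) × P), IsOpen O ∧ (t₀, p) ∈ O ∧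
        ContMDiffOn ((𝓡 l).prod (𝓡 n)) 𝓘(ℝ, ℝ) ∞
          (fun a => Po.leafForm a.2 (X a.1 a.2) (Y a.1 a.2)) O

/-- The diffeomorphism `u` of `P` preserves `Π`, i.e. `u_* Π = Π`. -/
def PreservedBy (Po : PoissonStructure n P) (u : P → P) : Prop :=
  ∀ (q : P) (α β : Cot n (u q)),
    Po.bivector (u q) α β = Po.bivector q (α.comp (mfderiv (𝓡 n) (𝓡 n) u q))
      (β.comp (mfderiv (𝓡 n) (𝓡 n) u q))

end PoissonStructure

/-! ### Local coordinates -/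

/-- The space `ℝᵏ × ℝᵏ × ℝᵐ` of the coordinates `(x, y, z)`. -/
abbrev CoordSpace (k m : ℕ) : Type := (Fin k → ℝ) × (Fin k → ℝ) × (Fin m → ℝ)

/-- The vector `∂/∂xᵢ` of the standard basis of the coordinate space. -/
def basisX {k : ℕ} (m : ℕ) (i : Fin k) : CoordSpace k m := (Pi.single i 1, 0, 0)

/-- The vector `∂/∂yᵢ` of the standard basis of the coordinate space. -/
def basisY {k : ℕ} (m : ℕ) (i : Fin k) : CoordSpace k m := (0, Pi.single i 1, 0)

/-- The vector `∂/∂zᵢ` of the standard basis of the coordinate space. -/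
def basisZ (k : ℕ) {m : ℕ} (i : Fin m) : CoordSpace k m := (0, 0, Pi.single i 1)

/-- The subspace `{x = y = 0}`. -/
def subspaceXYZero (k m : ℕ) : Submodule ℝ (CoordSpace k m) where
  carrier := {v | v.1 = 0 ∧ v.2.1 = 0}
  add_mem' := by rintro a b ⟨h1, h2⟩ ⟨h3, h4⟩; simp [h1, h2, h3, h4]
  zero_mem' := by simp
  smul_mem' := by rintro c a ⟨h1, h2⟩; simp [h1, h2]

/-- The subspace `{z = 0}`. -/
def subspaceZZero (k m : ℕ) : Submodule ℝ (CoordSpace k m) where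
  carrier := {v | v.2.2 = 0}
  add_mem' := by intro a b (h1 : a.2.2 = 0) (h2 : b.2.2 = 0); simp [h1, h2]
  zero_mem' := by simp
  smul_mem' := by intro c a (h : a.2.2 = 0); simp [h]

/-- `φ` is a smooth local coordinate system with values in `(x, y, z)`-space. -/
def IsSmoothChart {k m : ℕ} (φ : OpenPartialHomeomorph P (CoordSpace k m)) : Prop :=
  ContMDiffOn (𝓡 n) 𝓘(ℝ, CoordSpace k m) ∞ φ φ.source ∧
    ContMDiffOn 𝓘(ℝ, CoordSpace k m) (𝓡 n) ∞ φ.symm φ.target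

/-- The coordinate vector field of `φ` in the constant direction `e`, at the point `q` of the chart
domain: the image of `e` under the derivative of `φ⁻¹` at `φ(q)`. -/
def coordVec {k m : ℕ} (φ : OpenPartialHomeomorph P (CoordSpace k m)) (e : CoordSpace k m) (q : P) :
    TangentSpace (𝓡 n) q :=
  mfderiv 𝓘(ℝ, CoordSpace k m) (𝓡 n) φ.symm (φ q) e

end Poisson

end PoissonSplitting

end

set_option linter.unusedSectionVars false

/-! Averaging over Haar measure gives coordinates around the fixed point in which the group acts by
linear isometries (`exists_linearizing_chart`). There the Poisson structure is a field `B` of skew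
operators on a Euclidean space, equivariant under these isometries (`isPoissonTensor_chartTensor`,
`chartTensor_map`). Let `P` be the orthogonal projection onto the range of `B 0`, and `W` the
inverse of `B 0` on that range, extended by zero (`exists_isGaugePair`). An isometry commuting with
`B 0` commutes with `P` and `W`, so whatever is built from `B`, `P` and `W` alone is equivariant.

The splitting comes from a deformation of `B` to a split model. The gauge transformation `B ↦ B (1 +
a W B)⁻¹` by a constant, hence closed, two-form adds `a W` to `B⁻¹` wherever `B` is invertible. For
`a = (1 - t²)/t²` one has `1 + a = t⁻²`, so it turns `B 0` into `t² B 0`; pulling back along the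
scaling that is `t` on the image of `P` and `1` on its kernel restores `B 0`. This defines tensors
`b_t` (`moserTensor`) with `b_1 = B`. The poles at `t = 0` cancel (`gaugeBlock_eq`), and `b_0` is `B
0` plus a block on the kernel of `P` that depends only on `x - P x` (`gaugeBlock_zero`).

Moser's method applies with an explicit vector field: a constant two-form has a linear primitive,
which leads to `Y_t(v) = t⁻¹ (b_t W v - P v)`, again regular at `t = 0` (`moserCoeff_eq`). The
Jacobi identity says exactly that the flow of `Y` transports `b_t` (`hasDerivAt_moserTensor`,
`moserTensor_transport`). The field vanishes to second order at the origin, so the flow reaches time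
one on a small ball (`exists_smooth_flow`), and its time-one map carries the split tensor to `B`
equivariantly (`IsPoissonTensor.exists_splitting`). A linear Darboux basis of the image of `P` and
an orthonormal basis of its kernel give the coordinates (`exists_darboux_coordinates`); both
subspaces are invariant because the action commutes with `P`.

Averages and flows are smooth because superposition operators on spaces of continuous maps over a
compact space are smooth (`contDiffOn_superpose`). -/

noncomputable section

namespace PoissonSplitting

open scoped InnerProductSpace

/-! ### Superposition operators on spaces of continuous maps -/

section Superposition

universe u

variable {EM : Type*} [NormedAddCommGroup EM] [NormedSpace ℝ EM]
  {HM : Type*} [TopologicalSpace HM] {I : ModelWithCorners ℝ EM HM}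
  {M : Type*} [TopologicalSpace M] [ChartedSpace HM M]
  {K : Type*} [TopologicalSpace K] [CompactSpace K]
  {E F : Type u} [NormedAddCommGroup E] [NormedSpace ℝ E] [NormedAddCommGroup F] [NormedSpace ℝ F]

/-- The derivative of `f` in its second variable. -/
def partialFDeriv (f : M × E → F) (a : M × E) : E →L[ℝ] F :=
  fderiv ℝ (fun x => f (a.1, x)) a.2

theorem ContMDiffAt.differentiableAt_right {f : M × E → F} {a : M × E}
    (hf : ContMDiffAt (I.prod 𝓘(ℝ, E)) 𝓘(ℝ, F) ∞ f a) :
    DifferentiableAt ℝ (fun x => f (a.1, x)) a.2 := by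
  have h : ContMDiffAt 𝓘(ℝ, E) 𝓘(ℝ, F) ∞ (fun x => f (a.1, x)) a.2 := by
    refine ContMDiffAt.comp (I' := I.prod 𝓘(ℝ, E)) a.2 (g := f) (f := fun x => (a.1, x)) hf ?_
    exact contMDiffAt_const.prodMk contMDiffAt_id
  exact h.contDiffAt.differentiableAt (by simp)

theorem ContMDiffAt.partialFDeriv [IsManifold I ∞ M] {f : M × E → F} {a : M × E}
    (hf : ContMDiffAt (I.prod 𝓘(ℝ, E)) 𝓘(ℝ, F) ∞ f a) :
    ContMDiffAt (I.prod 𝓘(ℝ, E)) 𝓘(ℝ, E →L[ℝ] F) ∞ (partialFDeriv f) a := by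
  have h := ContMDiffAt.mfderiv (I := 𝓘(ℝ, E)) (I' := 𝓘(ℝ, F)) (J := I.prod 𝓘(ℝ, E))
    (m := ∞) (n := ∞) (x₀ := a)
    (fun (p : M × E) (x : E) => f (p.1, x)) (fun p => p.2) ?_ contMDiffAt_snd (by simp)
  · simp only [inTangentCoordinates_model_space, mfderiv_eq_fderiv] at h
    exact h
  · refine ContMDiffAt.comp (I' := I.prod 𝓘(ℝ, E)) (a, a.2) (g := f)
      (f := fun q : (M × E) × E => (q.1.1, q.2)) hf ?_
    exact (contMDiffAt_fst.comp _ contMDiffAt_fst).prodMk contMDiffAt_snd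

theorem ContMDiffOn.partialFDeriv [IsManifold I ∞ M] {f : M × E → F} {O : Set (M × E)}
    (hO : IsOpen O) (hf : ContMDiffOn (I.prod 𝓘(ℝ, E)) 𝓘(ℝ, F) ∞ f O) :
    ContMDiffOn (I.prod 𝓘(ℝ, E)) 𝓘(ℝ, E →L[ℝ] F) ∞ (partialFDeriv f) O := fun _ ha =>
  (ContMDiffAt.partialFDeriv (hf.contMDiffAt (hO.mem_nhds ha))).contMDiffWithinAt

open Classical in
/-- The superposition operator `γ ↦ (k ↦ f (ι k, γ k))`, with value `0` where this map is not
continuous. -/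
def superpose (ι : C(K, M)) (f : M × E → F) (γ : C(K, E)) : C(K, F) :=
  if h : Continuous fun k => f (ι k, γ k) then ⟨_, h⟩ else 0

/-- The domain of the superposition operator of a function on `O`. -/
def superposeDomain (ι : C(K, M)) (O : Set (M × E)) : Set C(K, E) :=
  {γ | ∀ k, (ι k, γ k) ∈ O}

theorem superpose_apply {ι : C(K, M)} {f : M × E → F} {O : Set (M × E)} (hf : ContinuousOn f O)
    {γ : C(K, E)} (hγ : γ ∈ superposeDomain ι O) (k : K) :
    superpose ι f γ k = f (ι k, γ k) := by
  have h : Continuous fun k => f (ι k, γ k) :=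
    hf.comp_continuous (by fun_prop) hγ
  simp [superpose, h]

theorem isOpen_superposeDomain (ι : C(K, M)) {O : Set (M × E)} (hO : IsOpen O) :
    IsOpen (superposeDomain (K := K) ι O) := by
  rw [isOpen_iff_mem_nhds]
  intro γ hγ
  have h := isCompact_univ.eventually_forall_of_forall_eventually (x₀ := γ) (K := Set.univ (α := K))
    (P := fun (η : C(K, E)) k => (ι k, η k) ∈ O) (fun k _ => by
      have hc : ContinuousAt (fun z : C(K, E) × K => (ι z.2, z.1 z.2)) (γ, k) := by fun_prop
      exact hc (hO.mem_nhds (hγ k)))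
  filter_upwards [h] with η hη k using hη k (Set.mem_univ k)

/-- Pointwise application of a continuous family of linear maps to a continuous family of
vectors. -/
def applyFamily : C(K, E →L[ℝ] F) →L[ℝ] C(K, E) →L[ℝ] C(K, F) :=
  LinearMap.mkContinuous₂
    (LinearMap.mk₂ ℝ (fun (ψ : C(K, E →L[ℝ] F)) (γ : C(K, E)) =>
        (⟨fun k => ψ k (γ k), by fun_prop⟩ : C(K, F)))
      (fun _ _ _ => by ext; simp) (fun _ _ _ => by ext; simp)
      (fun _ _ _ => by ext; simp) (fun _ _ _ => by ext; simp)) 1 (fun ψ γ => by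
        rw [one_mul, ContinuousMap.norm_le _ (by positivity)]
        intro k
        exact ((ψ k).le_opNorm _).trans (mul_le_mul (ψ.norm_coe_le_norm k) (γ.norm_coe_le_norm k)
          (norm_nonneg _) (norm_nonneg ψ)))

@[simp]
theorem applyFamily_apply (ψ : C(K, E →L[ℝ] F)) (γ : C(K, E)) (k : K) :
    applyFamily ψ γ k = ψ k (γ k) := rfl

/-- Compactness of `K` makes the continuity of the partial derivative along the graph of `γ` uniform
in `k`; the mean value inequality then bounds the remainder in the sup norm. -/
theorem hasFDerivAt_superpose [IsManifold I ∞ M] {ι : C(K, M)} {f : M × E → F} {O : Set (M × E)}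
    (hO : IsOpen O) (hf : ContMDiffOn (I.prod 𝓘(ℝ, E)) 𝓘(ℝ, F) ∞ f O)
    {γ : C(K, E)} (hγ : γ ∈ superposeDomain ι O) :
    HasFDerivAt (superpose ι f) (applyFamily (superpose ι (partialFDeriv f) γ)) γ := by
  have hf' := (ContMDiffOn.partialFDeriv hO hf).continuousOn
  rw [hasFDerivAt_iff_isLittleO_nhds_zero, Asymptotics.isLittleO_iff]
  intro c hc
  have h := isCompact_univ.eventually_forall_of_forall_eventually (x₀ := (0 : E))
    (K := Set.univ (α := K))
    (P := fun (u : E) k => (ι k, γ k + u) ∈ O ∧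
      ‖partialFDeriv f (ι k, γ k + u) - partialFDeriv f (ι k, γ k)‖ < c) (fun k _ => by
      have hc1 : ContinuousAt (fun z : E × K => (ι z.2, γ z.2 + z.1)) (0, k) := by fun_prop
      have hc2 : ContinuousAt (fun z : E × K => (ι z.2, γ z.2)) (0, k) := by fun_prop
      have hk : (ι k, γ k + 0) ∈ O := by simpa using hγ k
      have e1 : ContinuousAt (fun z : E × K => partialFDeriv f (ι z.2, γ z.2 + z.1)) (0, k) :=
        ContinuousAt.comp (f := fun z : E × K => (ι z.2, γ z.2 + z.1))
          (hf'.continuousAt (hO.mem_nhds hk)) hc1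
      have e2 : ContinuousAt (fun z : E × K => partialFDeriv f (ι z.2, γ z.2)) (0, k) :=
        ContinuousAt.comp (f := fun z : E × K => (ι z.2, γ z.2))
          (hf'.continuousAt (hO.mem_nhds (hγ k))) hc2
      have e0 : ∀ᶠ z in 𝓝 ((0 : E), k), (ι z.2, γ z.2 + z.1) ∈ O := hc1 (hO.mem_nhds hk)
      refine e0.and ?_
      have e3 := (e1.sub e2).norm
      refine e3.eventually (gt_mem_nhds ?_)
      simpa using hc)
  obtain ⟨r, hr, hball⟩ := Metric.eventually_nhds_iff_ball.1 h
  filter_upwards [Metric.ball_mem_nhds (0 : C(K, E)) hr,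
    (continuous_const.add continuous_id).continuousAt (x := (0 : C(K, E)))
      |>.preimage_mem_nhds ((isOpen_superposeDomain ι hO).mem_nhds (by simpa using hγ))]
    with η hη hη'
  replace hη' : γ + η ∈ superposeDomain ι O := hη'
  rw [ContinuousMap.norm_le _ (by positivity)]
  intro k
  rw [ContinuousMap.sub_apply, ContinuousMap.sub_apply, applyFamily_apply,
    superpose_apply hf.continuousOn hη', superpose_apply hf.continuousOn hγ,
    superpose_apply hf' hγ, ContinuousMap.add_apply]
  have hηk : ‖η k‖ ≤ ‖η‖ := η.norm_coe_le_norm k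
  have hηr : ‖η‖ < r := by simpa using hη
  have key := (convex_ball (0 : E) r).norm_image_sub_le_of_norm_hasFDerivWithin_le
    (f := fun u => f (ι k, γ k + u) - partialFDeriv f (ι k, γ k) u)
    (f' := fun u => partialFDeriv f (ι k, γ k + u) - partialFDeriv f (ι k, γ k)) (C := c)
    (x := 0) (y := η k) (fun u hu => by
      have hd : HasFDerivAt (fun x => f (ι k, x)) (partialFDeriv f (ι k, γ k + u)) (γ k + u) :=
        (ContMDiffAt.differentiableAt_right (a := (ι k, γ k + u))
          (hf.contMDiffAt (hO.mem_nhds (hball u hu k trivial).1))).hasFDerivAt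
      exact ((hd.comp u ((hasFDerivAt_id u).const_add (γ k))).sub
        (ContinuousLinearMap.hasFDerivAt _)).hasFDerivWithinAt)
    (fun u hu => (hball u hu k trivial).2.le) (by simpa using hr) (by simpa using hηk.trans_lt hηr)
  simp only [add_zero, map_zero, sub_zero] at key
  calc _ = _ := by congr 1; abel
    _ ≤ _ := key
    _ ≤ _ := by gcongr

/-- The derivative is again a superposition operator, followed by the bounded linear map
`applyFamily`, so induction on the order works. `E` and `F` share a universe so that `E →L[ℝ] F` can
take the place of `F`. -/
theorem contDiffOn_superpose [IsManifold I ∞ M] {ι : C(K, M)} {f : M × E → F} {O : Set (M × E)}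
    (hO : IsOpen O) (hf : ContMDiffOn (I.prod 𝓘(ℝ, E)) 𝓘(ℝ, F) ∞ f O) :
    ContDiffOn ℝ ∞ (superpose ι f) (superposeDomain ι O) := by
  rw [contDiffOn_infty]
  intro n
  have hD := isOpen_superposeDomain (K := K) (E := E) ι hO
  induction n generalizing F with
  | zero =>
    exact contDiffOn_zero.2 fun γ hγ =>
      (hasFDerivAt_superpose hO hf hγ).continuousAt.continuousWithinAt
  | succ n ih =>
    push_cast
    rw [contDiffOn_succ_iff_hasFDerivWithinAt_of_uniqueDiffOn hD.uniqueDiffOn]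
    refine ⟨by simp, fun γ => applyFamily (superpose ι (partialFDeriv f) γ), ?_, fun γ hγ =>
      (hasFDerivAt_superpose hO hf hγ).hasFDerivWithinAt⟩
    exact applyFamily.contDiff.comp_contDiffOn (ih (ContMDiffOn.partialFDeriv hO hf))

end Superposition

/-! ### Flows of time-dependent vector fields near a rest point -/

section Flow

universe u

/-- The smooth inverse function theorem, with an inverse that is smooth on a neighbourhood. -/
theorem exists_openPartialHomeomorph_of_contDiffOn {E F : Type*}
    [NormedAddCommGroup E] [NormedSpace ℝ E] [CompleteSpace E]
    [NormedAddCommGroup F] [NormedSpace ℝ F] [CompleteSpace F]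
    {f : E → F} {U : Set E} (hU : IsOpen U) (hf : ContDiffOn ℝ ∞ f U) {a : E} (ha : a ∈ U)
    (f' : E ≃L[ℝ] F) (hf' : HasFDerivAt f (f' : E →L[ℝ] F) a) :
    ∃ φ : OpenPartialHomeomorph E F, a ∈ φ.source ∧ φ.source ⊆ U ∧ (∀ x, φ x = f x) ∧
      ContDiffOn ℝ ∞ φ.symm φ.target := by
  have hfa : ContDiffAt ℝ ∞ f a := hf.contDiffAt (hU.mem_nhds ha)
  set φ₀ := hfa.toOpenPartialHomeomorph f hf' (by simp) with hφ₀
  -- Restricting to points with invertible derivative makes the inverse smooth on the whole target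
  -- and not only at `f a`.
  have hV : IsOpen (U ∩ fderiv ℝ f ⁻¹' Set.range ((↑) : (E ≃L[ℝ] F) → E →L[ℝ] F)) :=
    (hf.continuousOn_fderiv_of_isOpen hU (by simp)).isOpen_inter_preimage hU
      ContinuousLinearEquiv.isOpen
  have haV : a ∈ U ∩ fderiv ℝ f ⁻¹' Set.range ((↑) : (E ≃L[ℝ] F) → E →L[ℝ] F) :=
    ⟨ha, f', hf'.fderiv.symm⟩
  refine ⟨φ₀.restrOpen _ hV, ?_, ?_, ?_, ?_⟩
  · exact ⟨hfa.mem_toOpenPartialHomeomorph_source hf' (by simp), haV⟩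
  · exact fun x hx => hx.2.1
  · intro x; rfl
  · intro y hy
    set φ := φ₀.restrOpen _ hV
    have hx : φ.symm y ∈ φ.source := φ.map_target hy
    obtain ⟨hxU, e, he⟩ := hx.2
    have hfx : ContDiffAt ℝ ∞ f (φ.symm y) := hf.contDiffAt (hU.mem_nhds hxU)
    refine (φ.contDiffAt_symm hy (f₀' := e) ?_ hfx).contDiffWithinAt
    rw [he]
    exact (hfx.differentiableAt (by simp)).hasFDerivAt

theorem contMDiffOn_prod_self_iff {E₁ E₂ F : Type*} [NormedAddCommGroup E₁] [NormedSpace ℝ E₁]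
    [NormedAddCommGroup E₂] [NormedSpace ℝ E₂] [NormedAddCommGroup F] [NormedSpace ℝ F]
    {f : E₁ × E₂ → F} {O : Set (E₁ × E₂)} :
    ContMDiffOn (𝓘(ℝ, E₁).prod 𝓘(ℝ, E₂)) 𝓘(ℝ, F) ∞ f O ↔ ContDiffOn ℝ ∞ f O := by
  rw [← modelWithCornersSelf_prod, chartedSpaceSelf_prod, contMDiffOn_iff_contDiffOn]

variable {E : Type u} [NormedAddCommGroup E] [NormedSpace ℝ E] [CompleteSpace E]

/-- The inclusion of the unit interval. -/
def unitIncl : C(unitInterval, ℝ) := ⟨Subtype.val, continuous_subtype_val⟩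

@[simp]
theorem unitIncl_apply (t : unitInterval) : unitIncl t = t := rfl

/-- The primitive vanishing at `0`, as an operator on continuous paths. -/
def pathPrimitive : C(unitInterval, E) →L[ℝ] C(unitInterval, E) :=
  LinearMap.mkContinuous
    { toFun := fun γ => ⟨fun t => ∫ s in (0 : ℝ)..t, γ (Set.projIcc 0 1 zero_le_one s), by
        have h : Continuous fun s : ℝ => γ (Set.projIcc 0 1 zero_le_one s) := by fun_prop
        exact (intervalIntegral.continuous_primitive (fun a b => h.intervalIntegrable a b) 0).comp
          continuous_subtype_val⟩
      map_add' := fun γ η => by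
        ext t
        have h : ∀ γ : C(unitInterval, E),
            Continuous fun s : ℝ => γ (Set.projIcc 0 1 zero_le_one s) := by intro; fun_prop
        simpa using intervalIntegral.integral_add ((h γ).intervalIntegrable _ _)
          ((h η).intervalIntegrable _ _)
      map_smul' := fun c γ => by
        ext t
        simp } 1 (fun γ => by
    rw [one_mul, ContinuousMap.norm_le _ (norm_nonneg γ)]
    intro t
    have h := intervalIntegral.norm_integral_le_of_norm_le_const (a := 0) (b := (t : ℝ))
      (f := fun s => γ (Set.projIcc 0 1 zero_le_one s)) (C := ‖γ‖)
      (fun s _ => γ.norm_coe_le_norm _)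
    refine h.trans ?_
    rw [sub_zero, abs_of_nonneg t.2.1]
    exact mul_le_of_le_one_right (norm_nonneg γ) t.2.2)

theorem pathPrimitive_apply (γ : C(unitInterval, E)) (t : unitInterval) :
    pathPrimitive γ t = ∫ s in (0 : ℝ)..t, γ (Set.projIcc 0 1 zero_le_one s) := rfl

/-- The inclusion of the constant families. -/
def constFamily (K : Type*) [TopologicalSpace K] [CompactSpace K] : E →L[ℝ] C(K, E) :=
  LinearMap.mkContinuous
    { toFun := fun x => ContinuousMap.const _ x
      map_add' := fun _ _ => rfl
      map_smul' := fun _ _ => rfl } 1 (fun x => by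
    rw [one_mul, ContinuousMap.norm_le _ (norm_nonneg x)]
    intro t
    exact le_rfl)

@[simp]
theorem constFamily_apply {K : Type*} [TopologicalSpace K] [CompactSpace K] (x : E) (t : K) :
    constFamily K x t = x := rfl

/-- The inclusion of the constant paths. -/
def constPath : E →L[ℝ] C(unitInterval, E) := constFamily unitInterval

@[simp]
theorem constPath_apply (x : E) (t : unitInterval) : constPath x t = x := rfl

/-- A time-dependent vector field that vanishes to second order at `0` has a smooth flow up to time
one near `0`, whose derivative satisfies the linearised equation; it commutes with every linear
isometry that preserves the vector field. -/
theorem exists_smooth_flow {Y : ℝ × E → E} {O : Set (ℝ × E)} (hO : IsOpen O)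
    (hY : ContDiffOn ℝ ∞ Y O) (hO0 : ∀ t : unitInterval, ((t : ℝ), (0 : E)) ∈ O)
    (hY0 : ∀ t : unitInterval, Y (t, 0) = 0)
    (hY1 : ∀ t : unitInterval, partialFDeriv Y ((t : ℝ), 0) = 0) :
    ∃ (Γ : E → C(unitInterval, E)) (r : ℝ), 0 < r ∧ ContDiffOn ℝ ∞ Γ (Metric.ball 0 r) ∧
      Γ 0 = 0 ∧
      (∀ x ∈ Metric.ball (0 : E) r, ∀ t : unitInterval, ((t : ℝ), Γ x t) ∈ O) ∧
      (∀ x ∈ Metric.ball (0 : E) r, Γ x = constPath x + pathPrimitive (superpose unitIncl Y (Γ x))) ∧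
      (∀ x ∈ Metric.ball (0 : E) r, ∀ h, fderiv ℝ Γ x h = constPath h + pathPrimitive
        (applyFamily (superpose unitIncl (partialFDeriv Y) (Γ x)) (fderiv ℝ Γ x h))) ∧
      (∀ g : E ≃ₗᵢ[ℝ] E, (∀ a ∈ O, (a.1, g a.2) ∈ O ∧ Y (a.1, g a.2) = g (Y a)) →
        ∀ x ∈ Metric.ball (0 : E) r, ∀ t, Γ (g x) t = g (Γ x t)) := by
  have hYm := contMDiffOn_prod_self_iff.2 hY
  set D := superposeDomain (E := E) unitIncl O with hD
  have hDo : IsOpen D := isOpen_superposeDomain _ hO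
  have h0D : (0 : C(unitInterval, E)) ∈ D := hO0
  set N := superpose (K := unitInterval) unitIncl Y with hN
  -- The equation `H γ = constPath x` is the integral form of the flow equation starting at `x`, so
  -- the flow is a local inverse of `H`.
  let H : C(unitInterval, E) → C(unitInterval, E) := fun γ => γ - pathPrimitive (N γ)
  have hNs : ContDiffOn ℝ ∞ N D := contDiffOn_superpose hO hYm
  have hHs : ContDiffOn ℝ ∞ H D := contDiffOn_id.sub ((pathPrimitive (E := E)).contDiff.comp_contDiffOn hNs)
  have hHd : ∀ γ ∈ D, HasFDerivAt H (ContinuousLinearMap.id ℝ _ - pathPrimitive.comp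
      (applyFamily (superpose unitIncl (partialFDeriv Y) γ))) γ := fun γ hγ =>
    (hasFDerivAt_id γ).sub ((pathPrimitive (E := E)).hasFDerivAt.comp γ (hasFDerivAt_superpose hO hYm hγ))
  have hN0 : N 0 = 0 := by
    ext t
    rw [hN, superpose_apply hY.continuousOn h0D]
    exact hY0 t
  have hH0 : H 0 = 0 := by simp [H, hN0]
  have hY'0 : superpose (K := unitInterval) unitIncl (partialFDeriv Y) 0 = 0 := by
    ext1 t
    rw [superpose_apply (ContMDiffOn.partialFDeriv hO hYm).continuousOn h0D]
    exact hY1 t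
  -- The linearised field vanishes along the rest point, so the derivative of `H` at `0` is the
  -- identity. The inverse function theorem thus reaches time one without any smallness of the time
  -- interval.
  have hH1 : HasFDerivAt H ((ContinuousLinearEquiv.refl ℝ C(unitInterval, E)) :
      C(unitInterval, E) →L[ℝ] C(unitInterval, E)) 0 := by
    have := hHd 0 h0D
    rw [hY'0] at this
    simpa using this
  obtain ⟨φ, h0φ, hφD, hφH, hφs⟩ := exists_openPartialHomeomorph_of_contDiffOn hDo hHs h0D _ hH1
  obtain ⟨R, hR, hRφ⟩ := Metric.isOpen_iff.1 φ.open_source 0 h0φ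
  have h0t : (0 : C(unitInterval, E)) ∈ φ.target := by
    have := φ.map_source h0φ
    rwa [hφH, hH0] at this
  have hs0 : φ.symm 0 = 0 := by
    have := φ.left_inv h0φ
    rwa [hφH, hH0] at this
  have hW : φ.target ∩ φ.symm ⁻¹' Metric.ball 0 R ∈ 𝓝 (constPath (0 : E)) := by
    rw [map_zero]
    refine (φ.isOpen_inter_preimage_symm Metric.isOpen_ball).mem_nhds ⟨h0t, ?_⟩
    simpa [hs0] using hR
  obtain ⟨r, hr, hrW⟩ := Metric.mem_nhds_iff.1
    ((constPath (E := E)).continuous.continuousAt.preimage_mem_nhds hW)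
  have hmem : ∀ x ∈ Metric.ball (0 : E) r, φ.symm (constPath x) ∈ D := fun x hx =>
    hφD (φ.map_target (hrW hx).1)
  have hHΓ : ∀ x ∈ Metric.ball (0 : E) r, H (φ.symm (constPath x)) = constPath x := fun x hx => by
    rw [← hφH, φ.right_inv (hrW hx).1]
  have hΓs : ContDiffOn ℝ ∞ (fun x : E => φ.symm (constPath x)) (Metric.ball 0 r) :=
    hφs.comp (constPath (E := E)).contDiff.contDiffOn fun x hx => (hrW hx).1
  refine ⟨fun x => φ.symm (constPath x), r, hr, hΓs, by simpa using hs0, hmem, ?_, ?_, ?_⟩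
  · intro x hx
    exact sub_eq_iff_eq_add.1 (hHΓ x hx)
  · intro x hx h
    have hd := ((hΓs.contDiffAt (Metric.isOpen_ball.mem_nhds hx)).differentiableAt
      (by simp)).hasFDerivAt
    have h1 := (hHd _ (hmem x hx)).comp x hd
    have h2 : HasFDerivAt (H ∘ fun x : E => φ.symm (constPath x)) constPath x :=
      constPath.hasFDerivAt.congr_of_eventuallyEq
        (Filter.eventually_of_mem (Metric.isOpen_ball.mem_nhds hx) hHΓ)
    have h3 := congrArg (fun T => T h) (h1.unique h2)
    simp only [ContinuousLinearMap.comp_apply, sub_apply,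
      ContinuousLinearMap.id_apply] at h3
    exact sub_eq_iff_eq_add.1 h3
  · intro g hg x hx t
    have hgx : g x ∈ Metric.ball (0 : E) r := by simpa using hx
    set γ := φ.symm (constPath x) with hγ
    -- The rotated path solves the equation with initial value `g x`. It stays in the ball of radius
    -- `R`, since `g` is isometric, and `H` is injective there.
    let gγ : C(unitInterval, E) := ⟨fun t => g (γ t), by fun_prop⟩
    have hgγ : gγ ∈ Metric.ball (0 : C(unitInterval, E)) R := by
      have h1 : ‖γ‖ < R := by simpa using (hrW hx).2
      have h2 : ‖gγ‖ ≤ ‖γ‖ := by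
        rw [ContinuousMap.norm_le _ (norm_nonneg γ)]
        intro t
        simpa [gγ] using γ.norm_coe_le_norm t
      simpa using h2.trans_lt h1
    have hgD : gγ ∈ D := fun t => (hg _ (hmem x hx t)).1
    have hHg : H gγ = constPath (g x) := by
      have h4 := hHΓ x hx
      ext t
      have h5 := congrArg (fun η : C(unitInterval, E) => g (η t)) h4
      simp only [H, ContinuousMap.sub_apply, map_sub, pathPrimitive_apply, constPath_apply] at h5 ⊢
      rw [← h5]
      congr 1
      have h6 : ∀ s, N gγ s = g (N γ s) := fun s => by
        rw [hN, superpose_apply hY.continuousOn hgD, superpose_apply hY.continuousOn (hmem x hx)]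
        exact (hg _ (hmem x hx s)).2
      simp only [h6]
      exact (g.toContinuousLinearEquiv : E →L[ℝ] E).intervalIntegral_comp_comm
        (Continuous.intervalIntegrable (by fun_prop) _ _)
    have h7 : φ.symm (constPath (g x)) = gγ := by
      refine φ.injOn (φ.map_target (hrW hgx).1) (hRφ hgγ) ?_
      rw [φ.right_inv (hrW hgx).1, hφH, hHg]
    simp only [h7]
    rfl

end Flow

/-! ### Algebra of the rescaled gauge transformation -/

section GaugeAlgebra

variable {A : Type*} [Ring A] [StarRing A] [Algebra ℝ A] [StarModule ℝ A]

/-- The operator which is multiplication by `t` on the image of the projection `P` and the identity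
on its kernel. -/
def scaleOp (P : A) (t : ℝ) : A := t • P + (1 - P)

/-- The denominator `K² + (1 - t²) W B`, with `K = scaleOp P t`, of the rescaled gauge transform of
`B` by `(1 - t²) W`. -/
def gaugeDen (P W B : A) (t : ℝ) : A := t ^ 2 • P + (1 - P) + (1 - t ^ 2) • (W * B)

/-- The denominator `K² + (1 - t²) B W`. -/
def gaugeDen' (P W B : A) (t : ℝ) : A := t ^ 2 • P + (1 - P) + (1 - t ^ 2) • (B * W)

/-- The rescaled gauge transform of `B`, in a form that makes sense for `t = 0`. -/
def gaugeBlock (P W B : A) (t : ℝ) : A :=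
  P * (B * Ring.inverse (gaugeDen P W B t)) * P
    + (1 - P) * (B * Ring.inverse (gaugeDen P W B t)) * (1 - P)
    + t • ((1 - P) * (B * Ring.inverse (gaugeDen P W B t)) * P
      - star ((1 - P) * (B * Ring.inverse (gaugeDen P W B t)) * P))

/-- The coefficient of the Moser vector field. -/
def moserCoeff (P W B : A) (t : ℝ) : A :=
  (t • (P * (B * W - P)) + (1 - P) * (B * W)) * Ring.inverse (gaugeDen' P W B t) * P

variable {P W B : A} {t : ℝ}

theorem star_gaugeDen (hP : star P = P) (hW : star W = -W) (hB : star B = -B) :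
    star (gaugeDen P W B t) = gaugeDen' P W B t := by
  simp [gaugeDen, gaugeDen', hP, hW, hB]

theorem scaleOp_mul_inv (hPP : P * P = P) (ht : t ≠ 0) : scaleOp P t * scaleOp P t⁻¹ = 1 := by
  simp only [scaleOp, mul_add, add_mul, mul_sub, sub_mul, smul_mul_assoc, mul_smul_comm, hPP,
    mul_one, one_mul]
  match_scalars <;> field_simp
  ring

theorem scaleOp_inv_mul (hPP : P * P = P) (ht : t ≠ 0) : scaleOp P t⁻¹ * scaleOp P t = 1 := by
  simpa using scaleOp_mul_inv hPP (inv_ne_zero ht)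

/-- The gauge transform, for `t ≠ 0`, conjugated back to the original coordinates. -/
def gaugeForm (W B : A) (t : ℝ) : A :=
  B * Ring.inverse (1 + ((1 - t ^ 2) / t ^ 2) • (W * B))

/-- The image of `W` lies in that of `P`, where the inverse scaling applied twice is `t⁻²`; it
carries the whole pole of the coefficient `(1 - t²)/t²`. -/
theorem mul_gaugeFactor (hPP : P * P = P) (hPW : P * W = W) (ht : t ≠ 0) :
    (1 + ((1 - t ^ 2) / t ^ 2) • (W * B)) =
      scaleOp P t⁻¹ * (scaleOp P t⁻¹ * gaugeDen P W B t) := by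
  have h' : ∀ x, P * (W * x) = W * x := fun x => by rw [← mul_assoc, hPW]
  simp only [scaleOp, gaugeDen, mul_add, add_mul, mul_sub, sub_mul, smul_mul_assoc, mul_smul_comm,
    smul_smul, hPP, mul_one, one_mul, smul_add, smul_sub, h']
  match_scalars <;> field_simp <;> ring

theorem isUnit_scaleOp (hPP : P * P = P) (ht : t ≠ 0) : IsUnit (scaleOp P t) :=
  ⟨⟨_, _, scaleOp_mul_inv hPP ht, scaleOp_inv_mul hPP ht⟩, rfl⟩

theorem isUnit_gaugeFactor (hPP : P * P = P) (hPW : P * W = W) (ht : t ≠ 0)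
    (hQ : IsUnit (gaugeDen P W B t)) : IsUnit (1 + ((1 - t ^ 2) / t ^ 2) • (W * B)) := by
  rw [mul_gaugeFactor hPP hPW ht]
  have := isUnit_scaleOp (P := P) hPP (inv_ne_zero ht)
  exact this.mul (this.mul hQ)

theorem inverse_gaugeFactor (hPP : P * P = P) (hPW : P * W = W) (ht : t ≠ 0)
    (hQ : IsUnit (gaugeDen P W B t)) : Ring.inverse (1 + ((1 - t ^ 2) / t ^ 2) • (W * B)) =
      Ring.inverse (gaugeDen P W B t) * (scaleOp P t * scaleOp P t) := by
  have hU := isUnit_gaugeFactor hPP hPW ht hQ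
  refine hU.mul_left_cancel ?_
  rw [Ring.mul_inverse_cancel _ hU, mul_gaugeFactor hPP hPW ht]
  simp only [mul_assoc]
  rw [Ring.mul_inverse_cancel_left _ _ hQ, ← mul_assoc (scaleOp P t⁻¹) (scaleOp P t),
    scaleOp_inv_mul hPP ht, one_mul, scaleOp_inv_mul hPP ht]

theorem star_inverse_eq (a : A) : star (Ring.inverse a) = Ring.inverse (star a) :=
  (Ring.inverse_star a).symm

/-- Taking adjoints gives `(1 + a B W)⁻¹ B` up to sign, which equals `B (1 + a W B)⁻¹` by the
push-through identity. -/
theorem star_gaugeForm (hW : star W = -W) (hB : star B = -B)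
    (hU : IsUnit (1 + ((1 - t ^ 2) / t ^ 2) • (W * B))) :
    star (gaugeForm W B t) = -gaugeForm W B t := by
  set a := (1 - t ^ 2) / t ^ 2
  have h1 : star (1 + a • (W * B)) = 1 + a • (B * W) := by simp [hW, hB]
  have hU' : IsUnit (1 + a • (B * W)) := h1 ▸ hU.star
  rw [gaugeForm, star_mul, star_inverse_eq, h1, hB, mul_neg, neg_inj]
  refine hU'.mul_left_cancel ?_
  rw [Ring.mul_inverse_cancel_left _ _ hU']
  have h2 : (1 + a • (B * W)) * B = B * (1 + a • (W * B)) := by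
    simp [add_mul, mul_add, mul_assoc]
  rw [← mul_assoc, h2, mul_assoc, Ring.mul_inverse_cancel _ hU, mul_one]

theorem gaugeForm_conj (hPP : P * P = P) (hPW : P * W = W) (ht : t ≠ 0)
    (hQ : IsUnit (gaugeDen P W B t)) :
    scaleOp P t⁻¹ * gaugeForm W B t * scaleOp P t⁻¹ =
      scaleOp P t⁻¹ * (B * Ring.inverse (gaugeDen P W B t)) * scaleOp P t := by
  rw [gaugeForm, inverse_gaugeFactor hPP hPW ht hQ]
  simp only [mul_assoc]
  rw [scaleOp_mul_inv hPP ht, mul_one]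

/-- Put `X = B (gaugeDen P W B t)⁻¹`. The right-hand side is `scaleOp P t⁻¹ * X * scaleOp P t`,
whose only block with a factor `t⁻¹` is `P (·) (1 - P)`. By skewness this block is minus the adjoint
of the opposite one, which carries a factor `t`; so nothing is singular at `t = 0`. -/
theorem gaugeBlock_eq (hP : star P = P) (hW : star W = -W) (hB : star B = -B)
    (hPP : P * P = P) (hPW : P * W = W) (ht : t ≠ 0)
    (hQ : IsUnit (gaugeDen P W B t)) :
    gaugeBlock P W B t = scaleOp P t⁻¹ * gaugeForm W B t * scaleOp P t⁻¹ := by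
  have hs := star_gaugeForm hW hB (isUnit_gaugeFactor hPP hPW ht hQ)
  have hk : star (scaleOp P t⁻¹) = scaleOp P t⁻¹ := by simp [scaleOp, hP]
  have hb : star (scaleOp P t⁻¹ * gaugeForm W B t * scaleOp P t⁻¹) =
      -(scaleOp P t⁻¹ * gaugeForm W B t * scaleOp P t⁻¹) := by
    simp only [star_mul, hk, hs, mul_assoc, neg_mul, mul_neg]
  have hc := gaugeForm_conj hPP hPW ht hQ
  set b := scaleOp P t⁻¹ * gaugeForm W B t * scaleOp P t⁻¹
  set X := B * Ring.inverse (gaugeDen P W B t)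
  have e1 : P * scaleOp P t⁻¹ = t⁻¹ • P := by simp [scaleOp, mul_add, mul_sub, hPP]
  have e2 : (1 - P) * scaleOp P t⁻¹ = 1 - P := by
    simp [scaleOp, mul_add, mul_sub, sub_mul, hPP]
  have e3 : scaleOp P t * P = t • P := by simp [scaleOp, add_mul, sub_mul, hPP]
  have e4 : scaleOp P t * (1 - P) = 1 - P := by
    simp [scaleOp, add_mul, mul_sub, sub_mul, hPP]
  have b1 : P * b * P = P * X * P := by
    rw [hc, ← mul_assoc, ← mul_assoc, e1, mul_assoc _ _ P, e3]
    simp [smul_smul, ht, mul_assoc]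
  have b2 : (1 - P) * b * P = t • ((1 - P) * X * P) := by
    rw [hc, ← mul_assoc, ← mul_assoc, e2, mul_assoc _ _ P, e3]
    simp [mul_assoc]
  have b3 : (1 - P) * b * (1 - P) = (1 - P) * X * (1 - P) := by
    rw [hc, ← mul_assoc, ← mul_assoc, e2, mul_assoc _ _ (1 - P), e4]
  have b4 : P * b * (1 - P) = - star ((1 - P) * b * P) := by
    simp only [star_mul, star_sub, star_one, hP, hb, mul_assoc, neg_mul, mul_neg, neg_neg]
  have b5 : t • star ((1 - P) * X * P) = star ((1 - P) * b * P) := by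
    rw [b2, star_smul, star_trivial t]
  have b6 : b = P * b * P + (1 - P) * b * (1 - P) + ((1 - P) * b * P + P * b * (1 - P)) := by
    noncomm_ring
  rw [gaugeBlock, smul_sub, ← b1, ← b3, ← b2, b5, sub_eq_add_neg ((1 - P) * b * P), ← b4]
  exact b6.symm

/-- The relation `gaugeDen * W = W * gaugeDen'` moves the inverse to the right of `W`. Over this
common denominator the numerator is `t (1 - P) B W + t² P (B W - P)`, which absorbs the factor
`t⁻¹`. -/
theorem moserCoeff_eq (hP : star P = P) (hW : star W = -W) (hB : star B = -B)
    (hPP : P * P = P) (hWP : W * P = W) (hPW : P * W = W) (ht : t ≠ 0)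
    (hQ : IsUnit (gaugeDen P W B t)) :
    moserCoeff P W B t = t⁻¹ • (scaleOp P t⁻¹ * gaugeForm W B t * scaleOp P t⁻¹ * W - P) := by
  have hQ' : IsUnit (gaugeDen' P W B t) := star_gaugeDen (t := t) hP hW hB ▸ hQ.star
  rw [gaugeForm_conj hPP hPW ht hQ, moserCoeff]
  have hh : ∀ x, P * (P * x) = P * x := fun x => by rw [← mul_assoc, hPP]
  have h' : ∀ x, P * (W * x) = W * x := fun x => by rw [← mul_assoc, hPW]
  have hQW : gaugeDen P W B t * W = W * gaugeDen' P W B t := by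
    simp [gaugeDen, gaugeDen', add_mul, sub_mul, mul_add, mul_sub, hPW, hWP, mul_assoc]
  have hqW : Ring.inverse (gaugeDen P W B t) * W = W * Ring.inverse (gaugeDen' P W B t) := by
    refine hQ.mul_left_cancel ?_
    rw [Ring.mul_inverse_cancel_left _ _ hQ, ← mul_assoc, hQW, mul_assoc,
      Ring.mul_inverse_cancel _ hQ', mul_one]
  have hkW : scaleOp P t * W = t • W := by simp [scaleOp, add_mul, sub_mul, hPW]
  have hqP : W * Ring.inverse (gaugeDen' P W B t) * P = W * Ring.inverse (gaugeDen' P W B t) := by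
    rw [← hqW, mul_assoc, hWP]
  set q := Ring.inverse (gaugeDen' P W B t) with hq
  have hP' : P = P * gaugeDen' P W B t * q * P := by
    rw [mul_assoc P, hq, Ring.mul_inverse_cancel _ hQ', mul_one, hPP]
  have h1 : scaleOp P t⁻¹ * (B * Ring.inverse (gaugeDen P W B t)) * scaleOp P t * W =
      t • (scaleOp P t⁻¹ * B * W) * q * P := by
    rw [mul_assoc _ _ W, hkW]
    simp only [mul_smul_comm, smul_mul_assoc]
    congr 1
    simp only [mul_assoc]
    rw [hqW, ← mul_assoc W q P, hqP]
  have h2 : t • (scaleOp P t⁻¹ * B * W) * q * P - P =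
      (t • (scaleOp P t⁻¹ * B * W) - P * gaugeDen' P W B t) * q * P := by
    rw [sub_mul, sub_mul, ← hP']
  rw [h1, h2, ← smul_mul_assoc, ← smul_mul_assoc]
  congr 2
  simp only [scaleOp, gaugeDen', mul_add, add_mul, mul_sub, sub_mul, smul_mul_assoc, mul_smul_comm,
    smul_smul, hPP, mul_one, one_mul, smul_add, smul_sub, mul_assoc]
  match_scalars <;> field_simp <;> ring

theorem gaugeDen_eq_one (hWB : W * B = P) : gaugeDen P W B t = 1 := by
  rw [gaugeDen, hWB]; module

theorem moserCoeff_eq_zero (hPP : P * P = P) (hBW : B * W = P) : moserCoeff P W B t = 0 := by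
  simp [moserCoeff, hBW, sub_mul, hPP]

theorem gaugeBlock_one (hP : star P = P) (hB : star B = -B) : gaugeBlock P W B 1 = B := by
  have h : gaugeDen P W B 1 = 1 := by simp [gaugeDen]
  simp only [gaugeBlock, h, Ring.inverse_one, mul_one, star_mul, star_sub, star_one, hP, hB,
    one_smul]
  noncomm_ring

/-- At `t = 0` one has `W B = gaugeDen - (1 - P)`. Multiplying by `B₀`, which kills `1 - P`, makes
the block on the image of `P` equal to `B₀` whatever `B` is. -/
theorem gaugeBlock_zero {B₀ : A}
    (hP₀' : B₀ * P = B₀) (hW₀ : B₀ * W = P) (hQ : IsUnit (gaugeDen P W B 0)) :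
    gaugeBlock P W B 0 =
      B₀ + (1 - P) * (B * Ring.inverse (gaugeDen P W B 0)) * (1 - P) := by
  have h1 : W * (B * Ring.inverse (gaugeDen P W B 0)) =
      1 - (1 - P) * Ring.inverse (gaugeDen P W B 0) := by
    have : W * B = gaugeDen P W B 0 - (1 - P) := by simp [gaugeDen]
    rw [← mul_assoc, this, sub_mul, Ring.mul_inverse_cancel _ hQ]
  have h2 : P * (B * Ring.inverse (gaugeDen P W B 0)) * P = B₀ := by
    have h3 : P * (B * Ring.inverse (gaugeDen P W B 0)) =
        B₀ * (W * (B * Ring.inverse (gaugeDen P W B 0))) := by rw [← mul_assoc B₀, hW₀]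
    rw [h3, h1, mul_sub, ← mul_assoc, mul_sub B₀, hP₀']
    simp [hP₀']
  rw [gaugeBlock, h2, zero_smul, add_zero]

end GaugeAlgebra

/-! ### Calculus of the gauge transformation in a Banach algebra -/

section GaugeDeriv

variable {A : Type*} [NormedRing A] [NormedAlgebra ℝ A] [CompleteSpace A]

/-- With `m` and `n` the inverses of `1 + a W B` and `1 + a B W`, this turns the derivative `u m - a
B m W u m` of `B ↦ B m` into `n u m`, whose outer factors are mutually adjoint when `B` and `W` are
skew. -/
theorem inverse_one_add_eq {W B : A} {a : ℝ} (hU : IsUnit (1 + a • (W * B)))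
    (hU' : IsUnit (1 + a • (B * W))) : Ring.inverse (1 + a • (B * W)) =
      1 - a • (B * Ring.inverse (1 + a • (W * B)) * W) := by
  set m := Ring.inverse (1 + a • (W * B)) with hm
  refine hU'.mul_left_cancel ?_
  rw [Ring.mul_inverse_cancel _ hU']
  have h1 : m + a • (W * B * m) = 1 := by
    have := Ring.mul_inverse_cancel _ hU
    rwa [← hm, add_mul, one_mul, smul_mul_assoc] at this
  have h2 : (1 + a • (B * W)) * (1 - a • (B * m * W)) =
      1 + a • (B * W) - a • (B * (m + a • (W * B * m)) * W) := by
    simp only [mul_add, add_mul, mul_sub, smul_mul_assoc, mul_smul_comm, mul_one, one_mul,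
      mul_assoc, smul_add]
  rw [h2, h1]
  simp

/-- The derivative of `(a, B) ↦ B (1 + a W B)⁻¹`. -/
theorem hasFDerivAt_gauge {W B : A} {a : ℝ} (hU : IsUnit (1 + a • (W * B)))
    (hU' : IsUnit (1 + a • (B * W))) :
    ∃ L : ℝ × A →L[ℝ] A, HasFDerivAt (fun p : ℝ × A => p.2 * Ring.inverse (1 + p.1 • (W * p.2)))
        L (a, B) ∧
      ∀ c u, L (c, u) = Ring.inverse (1 + a • (B * W)) * u * Ring.inverse (1 + a • (W * B))
        - c • (B * Ring.inverse (1 + a • (W * B)) * W *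
          (B * Ring.inverse (1 + a • (W * B)))) := by
  obtain ⟨x, hx⟩ := hU
  have h2 : HasFDerivAt (fun p : ℝ × A => p.2) (ContinuousLinearMap.snd ℝ ℝ A) (a, B) :=
    hasFDerivAt_snd
  have h1 : HasFDerivAt (fun p : ℝ × A => p.1) (ContinuousLinearMap.fst ℝ ℝ A) (a, B) :=
    hasFDerivAt_fst
  have h3 := (h1.smul (h2.const_mul W)).const_add 1
  have h4 : HasFDerivAt Ring.inverse (-ContinuousLinearMap.mulLeftRight ℝ A ↑x⁻¹ ↑x⁻¹)
      (1 + a • (W * B)) := hx ▸ hasFDerivAt_ringInverse (𝕜 := ℝ) x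
  have h5 := h2.mul' (HasFDerivAt.comp (a, B) h4 h3)
  refine ⟨_, h5, fun c u => ?_⟩
  rw [inverse_one_add_eq (hx ▸ x.isUnit) hU', ← hx, Ring.inverse_unit]
  simp [sub_mul, mul_assoc, ← hx]
  abel

theorem contDiff_gaugeDen' (P W : A) : ContDiff ℝ ∞ fun p : ℝ × A => gaugeDen' P W p.2 p.1 := by
  unfold gaugeDen'
  exact (((contDiff_fst.pow 2).smul contDiff_const).add contDiff_const).add
    ((contDiff_const.sub (contDiff_fst.pow 2)).smul (contDiff_snd.mul contDiff_const))

theorem continuous_gaugeDen (P W : A) : Continuous fun p : ℝ × A => gaugeDen P W p.2 p.1 := by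
  unfold gaugeDen
  fun_prop

theorem contDiffAt_moserCoeff {P W : A} {p : ℝ × A} (hp : IsUnit (gaugeDen' P W p.2 p.1)) :
    ContDiffAt ℝ ∞ (fun p : ℝ × A => moserCoeff P W p.2 p.1) p := by
  obtain ⟨x, hx⟩ := hp
  have h1 : ContDiffAt ℝ ∞ Ring.inverse (gaugeDen' P W p.2 p.1) := hx ▸ contDiffAt_ringInverse ℝ x
  have h3 := ContDiffAt.comp p h1 (contDiff_gaugeDen' P W).contDiffAt
  unfold moserCoeff
  exact (((contDiffAt_fst.smul (contDiffAt_const.mul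
    ((contDiffAt_snd.mul contDiffAt_const).sub contDiffAt_const))).add
    (contDiffAt_const.mul (contDiffAt_snd.mul contDiffAt_const))).mul h3).mul contDiffAt_const

theorem continuousAt_gaugeBlock [StarRing A] [ContinuousStar A] {P W : A} {p : ℝ × A}
    (hp : IsUnit (gaugeDen P W p.2 p.1)) :
    ContinuousAt (fun p : ℝ × A => gaugeBlock P W p.2 p.1) p := by
  have h1 : ContinuousAt Ring.inverse (gaugeDen P W p.2 p.1) :=
    NormedRing.inverse_continuousAt hp.unit
  have h3 : ContinuousAt (fun p : ℝ × A => Ring.inverse (gaugeDen P W p.2 p.1)) p :=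
    ContinuousAt.comp (f := fun p : ℝ × A => gaugeDen P W p.2 p.1) h1
      (continuous_gaugeDen P W).continuousAt
  unfold gaugeBlock
  fun_prop

theorem contDiffAt_transverse {P W S : A} (hS : IsUnit (gaugeDen P W S 0)) :
    ContDiffAt ℝ ∞
      (fun S => (1 - P) * (S * Ring.inverse (gaugeDen P W S 0)) * (1 - P)) S := by
  have h2 : ContDiffAt ℝ ∞ (fun S => gaugeDen P W S 0) S := by
    unfold gaugeDen
    exact contDiffAt_const.add ((contDiffAt_const (c := (1 - (0 : ℝ) ^ 2))).smul
      (contDiffAt_const.mul contDiffAt_id))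
  have h3 : ContDiffAt ℝ ∞ Ring.inverse (gaugeDen P W S 0) := by
    obtain ⟨x, hx⟩ := hS
    rw [← hx]
    exact contDiffAt_ringInverse ℝ x
  exact (contDiffAt_const.mul (contDiffAt_id.mul (ContDiffAt.comp S h3 h2))).mul contDiffAt_const

end GaugeDeriv

/-! ### The Moser deformation of a Poisson tensor -/

section Moser

universe u

variable {E : Type u} [NormedAddCommGroup E] [InnerProductSpace ℝ E] [FiniteDimensional ℝ E]

theorem inner_star_left (T : E →L[ℝ] E) (x y : E) : ⟪star T x, y⟫_ℝ = ⟪x, T y⟫_ℝ := by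
  rw [ContinuousLinearMap.star_eq_adjoint, ContinuousLinearMap.adjoint_inner_left]

theorem inner_star_right (T : E →L[ℝ] E) (x y : E) : ⟪x, star T y⟫_ℝ = ⟪T x, y⟫_ℝ := by
  rw [ContinuousLinearMap.star_eq_adjoint, ContinuousLinearMap.adjoint_inner_right]

/-- A Poisson bivector field on an open subset `D` of a Euclidean space, given by its anchor map
under the identification of the space with its dual. -/
structure IsPoissonTensor (B : E → E →L[ℝ] E) (D : Set E) : Prop where
  isOpen : IsOpen D
  smooth : ContDiffOn ℝ ∞ B D
  skew : ∀ v ∈ D, star (B v) = -B v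
  jacobi : ∀ v ∈ D, ∀ ξ η ζ : E, ⟪ζ, fderiv ℝ B v (B v ξ) η⟫_ℝ + ⟪ξ, fderiv ℝ B v (B v η) ζ⟫_ℝ
    + ⟪η, fderiv ℝ B v (B v ζ) ξ⟫_ℝ = 0

theorem IsPoissonTensor.hasFDerivAt {B : E → E →L[ℝ] E} {D : Set E} (hB : IsPoissonTensor B D)
    {v : E} (hv : v ∈ D) : HasFDerivAt B (fderiv ℝ B v) v :=
  ((hB.smooth.contDiffAt (hB.isOpen.mem_nhds hv)).differentiableAt (by simp)).hasFDerivAt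

theorem IsPoissonTensor.star_fderiv {B : E → E →L[ℝ] E} {D : Set E} (hB : IsPoissonTensor B D)
    {v : E} (hv : v ∈ D) (u : E) : star (fderiv ℝ B v u) = -fderiv ℝ B v u := by
  have h1 := hB.hasFDerivAt hv
  have h2 := (starL' ℝ (A := E →L[ℝ] E)).toContinuousLinearMap.hasFDerivAt.comp v h1
  have h3 : HasFDerivAt ((starL' ℝ (A := E →L[ℝ] E)).toContinuousLinearMap ∘ B)
      (-fderiv ℝ B v) v :=
    h1.neg.congr_of_eventuallyEq
      (Filter.eventually_of_mem (hB.isOpen.mem_nhds hv) fun w hw => hB.skew w hw)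
  exact congrArg (fun T => T u) (h2.unique h3)

/-- A constant leafwise symplectic form that complements a skew operator: `P` is an orthogonal
projection and `W` is a skew operator on its image. -/
structure IsGaugePair (P W : E →L[ℝ] E) : Prop where
  star_P : star P = P
  star_W : star W = -W
  PP : P * P = P
  WP : W * P = W
  PW : P * W = W

theorem scaleOp_star {P : E →L[ℝ] E} (hP : star P = P) (t : ℝ) :
    star (scaleOp P t) = scaleOp P t := by
  simp [scaleOp, hP]

/-- The time-dependent Moser vector field. -/
def moserField (P W : E →L[ℝ] E) (B : E → E →L[ℝ] E) (a : ℝ × E) : E :=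
  moserCoeff P W (B (scaleOp P a.1 a.2)) a.1 a.2

/-- The domain of the Moser vector field. -/
def moserDomain (P W : E →L[ℝ] E) (B : E → E →L[ℝ] E) (D : Set E) : Set (ℝ × E) :=
  {a | scaleOp P a.1 a.2 ∈ D ∧ IsUnit (gaugeDen P W (B (scaleOp P a.1 a.2)) a.1)}

/-- The rescaled gauge transforms of the Poisson tensor. -/
def moserTensor (P W : E →L[ℝ] E) (B : E → E →L[ℝ] E) (a : ℝ × E) : E →L[ℝ] E :=
  gaugeBlock P W (B (scaleOp P a.1 a.2)) a.1

variable {P W : E →L[ℝ] E} {B : E → E →L[ℝ] E} {D : Set E}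

theorem continuous_scaleOp : Continuous fun a : ℝ × E => scaleOp P a.1 a.2 := by
  simp only [scaleOp, add_apply, smul_apply, sub_apply]
  fun_prop

theorem contDiff_scaleOp : ContDiff ℝ ∞ fun a : ℝ × E => scaleOp P a.1 a.2 := by
  simp only [scaleOp, add_apply, smul_apply, sub_apply]
  fun_prop

theorem isOpen_moserDomain (hB : IsPoissonTensor B D) : IsOpen (moserDomain P W B D) := by
  rw [isOpen_iff_mem_nhds]
  intro a ha
  have h1 : ContinuousAt (fun a : ℝ × E => (a.1, B (scaleOp P a.1 a.2))) a :=
    continuousAt_fst.prodMk (ContinuousAt.comp (f := fun a : ℝ × E => scaleOp P a.1 a.2)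
      (hB.smooth.continuousOn.continuousAt (hB.isOpen.mem_nhds ha.1))
      continuous_scaleOp.continuousAt)
  have h2 := ContinuousAt.comp (f := fun a : ℝ × E => (a.1, B (scaleOp P a.1 a.2)))
    (continuous_gaugeDen P W).continuousAt h1
  filter_upwards [continuous_scaleOp.continuousAt.preimage_mem_nhds (hB.isOpen.mem_nhds ha.1),
    h2.preimage_mem_nhds (Units.isOpen.mem_nhds ha.2)] with b hb1 hb2
  exact ⟨hb1, hb2⟩

theorem isUnit_gaugeDen' (hPW : IsGaugePair P W) {T : E →L[ℝ] E} (hT : star T = -T) {t : ℝ}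
    (hQ : IsUnit (gaugeDen P W T t)) : IsUnit (gaugeDen' P W T t) := by
  rw [← star_gaugeDen hPW.star_P hPW.star_W hT]
  exact hQ.star

theorem contDiffOn_moserCoeff (hPW : IsGaugePair P W) (hB : IsPoissonTensor B D) :
    ContDiffOn ℝ ∞ (fun a : ℝ × E => moserCoeff P W (B (scaleOp P a.1 a.2)) a.1)
      (moserDomain P W B D) := by
  intro a ha
  have h1 : ContDiffAt ℝ ∞ (fun a : ℝ × E => (a.1, B (scaleOp P a.1 a.2))) a :=
    contDiffAt_fst.prodMk (ContDiffAt.comp a (hB.smooth.contDiffAt (hB.isOpen.mem_nhds ha.1))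
      contDiff_scaleOp.contDiffAt)
  exact (ContDiffAt.comp (f := fun a : ℝ × E => (a.1, B (scaleOp P a.1 a.2))) a
    (contDiffAt_moserCoeff (isUnit_gaugeDen' hPW (hB.skew _ ha.1) ha.2)) h1).contDiffWithinAt

theorem contDiffOn_moserField (hPW : IsGaugePair P W) (hB : IsPoissonTensor B D) :
    ContDiffOn ℝ ∞ (moserField P W B) (moserDomain P W B D) :=
  (contDiffOn_moserCoeff hPW hB).clm_apply contDiffOn_snd

theorem continuousOn_moserTensor (hB : IsPoissonTensor B D) :
    ContinuousOn (moserTensor P W B) (moserDomain P W B D) := by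
  intro a ha
  have h1 : ContinuousAt (fun a : ℝ × E => (a.1, B (scaleOp P a.1 a.2))) a :=
    continuousAt_fst.prodMk (ContinuousAt.comp (f := fun a : ℝ × E => scaleOp P a.1 a.2)
      (hB.smooth.continuousOn.continuousAt (hB.isOpen.mem_nhds ha.1))
      continuous_scaleOp.continuousAt)
  exact (ContinuousAt.comp (f := fun a : ℝ × E => (a.1, B (scaleOp P a.1 a.2)))
    (continuousAt_gaugeBlock ha.2) h1).continuousWithinAt

set_option maxHeartbeats 1000000 in
/-- The evolution equation of the rescaled gauge transforms along the Moser flow. -/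
theorem hasDerivAt_moserTensor (hPW : IsGaugePair P W) (hB : IsPoissonTensor B D) {t : ℝ}
    (ht : 0 < t) {γ : ℝ → E} (hγ : HasDerivAt γ (moserField P W B (t, γ t)) t)
    (hD : (t, γ t) ∈ moserDomain P W B D) :
    HasDerivAt (fun s => moserTensor P W B (s, γ s))
      (partialFDeriv (moserField P W B) (t, γ t) * moserTensor P W B (t, γ t) +
        moserTensor P W B (t, γ t) * star (partialFDeriv (moserField P W B) (t, γ t))) t := by
  obtain ⟨hPs, hWs, hPP, hWP, hPW'⟩ := hPW
  have ht0 : t ≠ 0 := ht.ne'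
  obtain ⟨hc, hQ⟩ := hD
  simp only at hc hQ
  set c := scaleOp P t (γ t) with hcdef
  set T := B c with hT
  have hTs : star T = -T := hB.skew c hc
  set a := (1 - t ^ 2) / t ^ 2 with ha
  have hU : IsUnit (1 + a • (W * T)) := isUnit_gaugeFactor hPP hPW' ht0 hQ
  have hUs : star (1 + a • (W * T)) = 1 + a • (T * W) := by simp [hWs, hTs]
  have hU' : IsUnit (1 + a • (T * W)) := by rw [← hUs]; exact hU.star
  set m := Ring.inverse (1 + a • (W * T)) with hm
  set n := Ring.inverse (1 + a • (T * W)) with hn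
  have hmn : star m = n := by rw [hm, star_inverse_eq, hUs]
  set g := T * m with hg
  have hgs : star g = -g := star_gaugeForm (t := t) hWs hTs hU
  set k := scaleOp P t⁻¹ with hk
  have hks : star k = k := scaleOp_star hPs _
  have hkK : ∀ x, scaleOp P t (k x) = x := fun x =>
    congrArg (fun S : E →L[ℝ] E => S x) (scaleOp_mul_inv hPP ht0)
  have hkW : k * W = t⁻¹ • W := by simp [hk, scaleOp, add_mul, sub_mul, hPW']
  have hWk : W * k = t⁻¹ • W := by simp [hk, scaleOp, mul_add, mul_sub, hWP]
  have hPk : P * k = t⁻¹ • P := by simp [hk, scaleOp, mul_add, mul_sub, hPP]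
  have hkP : k * P = t⁻¹ • P := by simp [hk, scaleOp, add_mul, sub_mul, hPP]
  have hKP : scaleOp P t * P = t • P := by simp [scaleOp, add_mul, sub_mul, hPP]
  have hgf : ∀ (s : ℝ) (S : E →L[ℝ] E), gaugeForm W S s =
      (fun p : ℝ × (E →L[ℝ] E) => p.2 * Ring.inverse (1 + p.1 • (W * p.2)))
        ((1 - s ^ 2) / s ^ 2, S) := fun s S => rfl
  set b := k * g * k with hb
  have hbt : moserTensor P W B (t, γ t) = b :=
    gaugeBlock_eq hPs hWs hTs hPP hPW' ht0 hQ
  obtain ⟨L, hL, hLv⟩ := hasFDerivAt_gauge hU hU'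
  -- the derivative of the vector field in the space variable
  have hDc := hB.hasFDerivAt hc
  have hcv : HasFDerivAt (fun v => scaleOp P t v) (scaleOp P t) (γ t) :=
    (scaleOp P t).hasFDerivAt
  have hBv : HasFDerivAt (fun v => B (scaleOp P t v)) ((fderiv ℝ B c).comp (scaleOp P t)) (γ t) :=
    HasFDerivAt.comp (γ t) hDc hcv
  have hGv : HasFDerivAt (fun v => gaugeForm W (B (scaleOp P t v)) t)
      (L.comp ((0 : E →L[ℝ] ℝ).prod ((fderiv ℝ B c).comp (scaleOp P t)))) (γ t) := by
    simp only [hgf]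
    exact HasFDerivAt.comp (γ t) hL ((hasFDerivAt_const a (γ t)).prodMk hBv)
  have hYeq : ∀ᶠ v in 𝓝 (γ t), moserField P W B (t, v) =
      t⁻¹ • ((k * gaugeForm W (B (scaleOp P t v)) t * k * W - P) v) := by
    have hev : ∀ᶠ v in 𝓝 (γ t), (t, v) ∈ moserDomain P W B D :=
      (Continuous.prodMk_right t).continuousAt.preimage_mem_nhds
        ((isOpen_moserDomain hB).mem_nhds ⟨hc, hQ⟩)
    filter_upwards [hev] with v hv
    rw [moserField, moserCoeff_eq hPs hWs (hB.skew _ hv.1) hPP hWP hPW' ht0 hv.2]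
    rfl
  have hA : ∀ u, partialFDeriv (moserField P W B) (t, γ t) u =
      t⁻¹ • (k (n (fderiv ℝ B c (scaleOp P t u) (m (k (W (γ t)))))) + b (W u) - P u) := by
    have h1 := ((((hGv.const_mul k).mul_const' k).mul_const' W).sub_const P).clm_apply
      (hasFDerivAt_id (γ t))
    have h2 := (h1.const_smul t⁻¹).congr_of_eventuallyEq hYeq
    intro u
    rw [partialFDeriv, h2.fderiv]
    have : gaugeForm W (B (scaleOp P t (γ t))) t = g := rfl
    simp [hLv, this, ← hn, ← hm, hb]
    module
  have hYt : moserField P W B (t, γ t) = t⁻¹ • (k (g (k (W (γ t)))) - P (γ t)) :=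
    hYeq.self_of_nhds
  -- the derivatives along the curve
  set ζ := m (k (W (γ t))) with hζ
  have hK' : HasDerivAt (fun s => scaleOp P s) P t := by
    simpa [scaleOp] using ((hasDerivAt_id t).smul_const P).add_const (1 - P)
  have hk' : HasDerivAt (fun s => scaleOp P s⁻¹) (-(t ^ 2)⁻¹ • P) t := by
    simpa [scaleOp] using ((hasDerivAt_inv ht0).smul_const P).add_const (1 - P)
  -- The term `-P v` of the vector field offsets the change of the scaling, so the rescaled curve
  -- moves in the direction `T ζ`, a value of the original anchor map. The Jacobi identity needs
  -- this form.
  have hc' : HasDerivAt (fun s => scaleOp P s (γ s)) (t⁻¹ • T ζ) t := by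
    have h1 := hK'.clm_apply hγ
    have h2 : P (γ t) + scaleOp P t (moserField P W B (t, γ t)) = t⁻¹ • T ζ := by
      have h3 : scaleOp P t (P (γ t)) = t • P (γ t) :=
        congrArg (fun S : E →L[ℝ] E => S (γ t)) hKP
      rw [hYt, map_smul, map_sub, hkK, h3, smul_sub, smul_smul, inv_mul_cancel₀ ht0, one_smul]
      simp [hg, hζ]
    rwa [h2] at h1
  have hB' : HasDerivAt (fun s => B (scaleOp P s (γ s))) (fderiv ℝ B c (t⁻¹ • T ζ)) t :=
    HasFDerivAt.comp_hasDerivAt t hDc hc'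
  have ha' : HasDerivAt (fun s : ℝ => (1 - s ^ 2) / s ^ 2) (-2 / t ^ 3) t := by
    have h1 := ((hasDerivAt_pow 2 t).const_sub 1).div (hasDerivAt_pow 2 t) (pow_ne_zero 2 ht0)
    refine h1.congr_deriv ?_
    push_cast
    field_simp
    ring
  have hG' : HasDerivAt (fun s => gaugeForm W (B (scaleOp P s (γ s))) s)
      (L (-2 / t ^ 3, fderiv ℝ B c (t⁻¹ • T ζ))) t := by
    simp only [hgf]
    exact HasFDerivAt.comp_hasDerivAt t hL (ha'.prodMk hB')
  have hb' := ((hk'.mul hG').mul hk').congr_of_eventuallyEq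
    (f₁ := fun s => moserTensor P W B (s, γ s)) (by
      have h1 : ∀ᶠ s in 𝓝 t, (s, γ s) ∈ moserDomain P W B D :=
        (continuousAt_id.prodMk hγ.continuousAt).preimage_mem_nhds
          ((isOpen_moserDomain hB).mem_nhds ⟨hc, hQ⟩)
      filter_upwards [h1, lt_mem_nhds ht] with s hs hs0
      exact gaugeBlock_eq hPs hWs (hB.skew _ hs.1) hPP hPW' hs0.ne' hs.2)
  rw [hbt]
  refine hb'.congr_deriv ?_
  have hgt : gaugeForm W (B (scaleOp P t (γ t))) t = g := rfl
  have hbs : ∀ x y, ⟪x, b y⟫_ℝ = -⟪b x, y⟫_ℝ := by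
    intro x y
    have : star b = -b := by simp [hb, hks, hgs, mul_assoc]
    rw [← inner_star_left, this, neg_apply, inner_neg_left]
  have hbv : ∀ x, b x = k (g (k x)) := fun x => rfl
  have hkWv : ∀ x, k (W x) = t⁻¹ • W x := fun x => congrArg (fun S : E →L[ℝ] E => S x) hkW
  have hWkv : ∀ x, W (k x) = t⁻¹ • W x := fun x => congrArg (fun S : E →L[ℝ] E => S x) hWk
  have hPkv : ∀ x, P (k x) = t⁻¹ • P x := fun x => congrArg (fun S : E →L[ℝ] E => S x) hPk
  have hkPv : ∀ x, k (P x) = t⁻¹ • P x := fun x => congrArg (fun S : E →L[ℝ] E => S x) hkP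
  ext1 ξ
  refine ext_inner_left ℝ fun η => ?_
  have f1 : P (g (k ξ)) = t • P (b ξ) := by
    rw [hbv, hPkv, smul_smul, mul_inv_cancel₀ ht0, one_smul]
  have f2 : k (g (P ξ)) = t • b (P ξ) := by
    rw [hbv, hkPv, map_smul, map_smul, smul_smul, mul_inv_cancel₀ ht0, one_smul]
  -- With the factor `2 / t ^ 3` from the derivative of `(1 - t²)/t²`, this becomes `2 t⁻¹ b W b`;
  -- each of the two summands of the evolution equation supplies one half.
  have f3 : k (g (W (g (k ξ)))) = t ^ 2 • b (W (b ξ)) := by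
    rw [hbv, hbv, hWkv, map_smul, map_smul, map_smul, hkWv, map_smul, map_smul, smul_smul,
      smul_smul, show t ^ 2 * t⁻¹ * t⁻¹ = 1 by field_simp, one_smul]
  have f4 : ∀ (x y : E) (X : E →L[ℝ] E), ⟪x, k (n (X (m (k y))))⟫_ℝ = ⟪m (k x), X (m (k y))⟫_ℝ := by
    intro x y X
    rw [← inner_star_left, hks, ← hmn, inner_star_right]
  have f5 : ∀ (x : E) (X : E →L[ℝ] E), ⟪x, k (n (X ζ))⟫_ℝ = ⟪m (k x), X ζ⟫_ℝ := by
    intro x X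
    rw [← inner_star_left, hks, ← hmn, inner_star_right]
  have f6 : ∀ x, scaleOp P t (b x) = T (m (k x)) := fun x => by rw [hbv, hkK]; rfl
  -- The Jacobi identity for these three covectors rewrites the derivative of `B` along `T ζ` as the
  -- two terms coming from the space derivative of the vector field and from its adjoint.
  have hJ := hB.jacobi c hc (m (k ξ)) (m (k η)) ζ
  have hJ1 : ⟪ζ, fderiv ℝ B c (B c (m (k ξ))) (m (k η))⟫_ℝ =
      -⟪m (k η), fderiv ℝ B c (B c (m (k ξ))) ζ⟫_ℝ := by
    rw [← inner_star_left, hB.star_fderiv hc, neg_apply, inner_neg_left, real_inner_comm]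
  rw [hJ1] at hJ
  have e1 : ⟪η, b (star (partialFDeriv (moserField P W B) (t, γ t)) ξ)⟫_ℝ =
      -⟪ξ, partialFDeriv (moserField P W B) (t, γ t) (b η)⟫_ℝ := by
    rw [hbs, inner_star_right, real_inner_comm]
  have e2 : L (-2 / t ^ 3, fderiv ℝ B c (t⁻¹ • T ζ)) (k ξ) =
      t⁻¹ • n (fderiv ℝ B c (T ζ) (m (k ξ))) + (2 / t ^ 3) • g (W (g (k ξ))) := by
    rw [hLv, ← hm, ← hn, ← hg, map_smul, neg_div, neg_smul, sub_neg_eq_add, mul_smul_comm,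
      smul_mul_assoc]
    rfl
  have e3 : ⟪ξ, b (W (b η))⟫_ℝ = -⟪η, b (W (b ξ))⟫_ℝ := by
    rw [hbs, ← inner_star_left, hWs, neg_apply, inner_neg_left, neg_neg, hbs, real_inner_comm]
  have e4 : ⟪ξ, P (b η)⟫_ℝ = -⟪η, b (P ξ)⟫_ℝ := by
    rw [hbs, neg_neg, ← inner_star_left, hPs, real_inner_comm]
  change ⟪η, (-(t ^ 2)⁻¹ • P (g (k ξ)) + k (L (-2 / t ^ 3, fderiv ℝ B c (t⁻¹ • T ζ)) (k ξ))) +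
      k (g (-(t ^ 2)⁻¹ • P ξ))⟫_ℝ =
    ⟪η, partialFDeriv (moserField P W B) (t, γ t) (b ξ) +
      b (star (partialFDeriv (moserField P W B) (t, γ t)) ξ)⟫_ℝ
  rw [inner_add_right (η) (partialFDeriv _ _ _), e1, hA, hA, f6, f6, e2]
  simp only [map_add, map_smul, f1, f2, f3, inner_add_right, inner_sub_right,
    inner_smul_right, f4, f5, e3, e4]
  have hJ' : ⟪m (k η), fderiv ℝ B c (T ζ) (m (k ξ))⟫_ℝ =
      ⟪m (k η), fderiv ℝ B c (T (m (k ξ))) ζ⟫_ℝ -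
      ⟪m (k ξ), fderiv ℝ B c (T (m (k η))) ζ⟫_ℝ := by
    simp only [hT]
    linarith
  rw [hJ']
  field_simp
  ring

end Moser

/-! ### The inverse of a skew operator on its range -/

section PseudoInverse

universe u

variable {E : Type u} [NormedAddCommGroup E] [InnerProductSpace ℝ E] [FiniteDimensional ℝ E]

/-- A skew operator `B₀` is invertible on its range. -/
theorem exists_isGaugePair {B₀ : E →L[ℝ] E} (hB : star B₀ = -B₀) :
    ∃ P W : E →L[ℝ] E, IsGaugePair P W ∧ P * B₀ = B₀ ∧ B₀ * P = B₀ ∧ B₀ * W = P ∧ W * B₀ = P := by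
  set S := LinearMap.range B₀.toLinearMap with hS
  set P : E →L[ℝ] E := S.starProjection with hP
  have hPP : P * P = P := S.isIdempotentElem_starProjection
  have hPs : star P = P := isSelfAdjoint_starProjection S
  have hPB : P * B₀ = B₀ := by
    ext x
    exact Submodule.starProjection_eq_self_iff.2 ⟨x, rfl⟩
  have hBP : B₀ * P = B₀ := by
    have := congrArg star hPB
    rw [star_mul, hB, hPs] at this
    simpa using this
  set C := B₀ + (1 - P) with hC
  have hinj : Function.Injective C := by
    rw [injective_iff_map_eq_zero]
    intro x hx
    have h1 : B₀ x = 0 := by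
      have h2 : (P * C) x = 0 := by rw [mul_apply_eq_comp, hx, map_zero]
      have h3 : P * C = B₀ := by rw [hC, mul_add, hPB, mul_sub, mul_one, hPP, sub_self, add_zero]
      rwa [h3] at h2
    have h2 : P x = x := by
      have h3 : B₀ x + (x - P x) = 0 := hx
      rw [h1, zero_add] at h3
      exact (sub_eq_zero.1 h3).symm
    obtain ⟨y, hy⟩ := Submodule.starProjection_eq_self_iff.1 h2
    have h3 : ⟪x, x⟫_ℝ = 0 := by
      conv_lhs => rw [← hy]
      change ⟪B₀ y, B₀ y⟫_ℝ = 0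
      have h4 : B₀ (B₀ y) = 0 := by
        have : B₀ y = x := hy
        rw [this, h1]
      rw [← inner_star_left, hB, neg_apply, h4, neg_zero, inner_zero_left]
    exact inner_self_eq_zero.1 h3
  have hU : IsUnit C := by
    rw [ContinuousLinearMap.isUnit_iff_bijective]
    exact ⟨hinj, (LinearMap.injective_iff_surjective (f := C.toLinearMap)).1 hinj⟩
  have hCP : C * P = B₀ := by rw [hC, add_mul, hBP, sub_mul, one_mul, hPP, sub_self, add_zero]
  have hPC : P * C = B₀ := by rw [hC, mul_add, hPB, mul_sub, mul_one, hPP, sub_self, add_zero]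
  have hiP : Ring.inverse C * P = P * Ring.inverse C := by
    refine hU.mul_left_cancel ?_
    rw [Ring.mul_inverse_cancel_left _ _ hU, ← mul_assoc, hCP, ← hPC, mul_assoc,
      Ring.mul_inverse_cancel _ hU, mul_one]
  set W := Ring.inverse C * P with hW
  have hBW : B₀ * W = P := by
    rw [← hPC, hW, mul_assoc, Ring.mul_inverse_cancel_left _ _ hU, hPP]
  have hWC : W * C = P := by rw [hiP, mul_assoc, Ring.inverse_mul_cancel _ hU, mul_one]
  have hPW : P * W = W := by rw [hiP, ← mul_assoc, hPP]
  have hWP : W * P = W := by rw [hW, mul_assoc, hPP]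
  have hWB : W * B₀ = P := by rw [← hPC, ← mul_assoc, hWP, hWC]
  refine ⟨P, W, ⟨hPs, ?_, hPP, hWP, hPW⟩, hPB, hBP, hBW, hWB⟩
  have hsC : star C = -B₀ + (1 - P) := by simp [hC, hB, hPs]
  refine hU.star.mul_left_cancel ?_
  rw [← star_mul, hWC, hPs, hsC, add_mul, mul_neg, neg_mul, neg_neg, hBW, sub_mul, mul_neg, one_mul,
    mul_neg, hPW]
  simp

/-- Since `B₀` is skew, the adjoint of `T` commutes with it too. Both operators preserve the range
of `B₀`, hence `T` preserves its orthogonal complement as well. -/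
theorem IsGaugePair.commute_proj {P W B₀ T : E →L[ℝ] E} (h : IsGaugePair P W)
    (hB : star B₀ = -B₀) (hPB : P * B₀ = B₀) (hBW : B₀ * W = P)
    (hT : T * B₀ = B₀ * T) : T * P = P * T := by
  have key : ∀ T : E →L[ℝ] E, T * B₀ = B₀ * T → P * T * P = T * P := fun T hT => by
    rw [← hBW, ← mul_assoc, ← mul_assoc, mul_assoc (B₀ * W) T B₀, hT, ← mul_assoc, hBW, hPB]
  have hT' : star T * B₀ = B₀ * star T := by
    have := congrArg star hT
    rw [star_mul, star_mul, hB] at this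
    simpa using this.symm
  have h1 := congrArg star (key _ hT')
  simp only [star_mul, star_star, h.star_P] at h1
  rw [← key T hT, mul_assoc, h1]

theorem IsGaugePair.commute_W {P W B₀ T : E →L[ℝ] E} (h : IsGaugePair P W)
    (hB : star B₀ = -B₀) (hPB : P * B₀ = B₀) (hBW : B₀ * W = P) (hWB : W * B₀ = P)
    (hT : T * B₀ = B₀ * T) : T * W = W * T := by
  have hTP := h.commute_proj hB hPB hBW hT
  calc T * W = T * P * W := by rw [mul_assoc, h.PW]
    _ = W * (B₀ * T) * W := by rw [hTP, ← hWB]; simp only [mul_assoc]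
    _ = W * T * P := by rw [← hT, ← hBW]; simp only [mul_assoc]
    _ = W * T := by rw [mul_assoc, hTP, ← mul_assoc, h.WP]

end PseudoInverse

/-! ### Uniqueness for linear differential equations on the open interval -/

section LinearODE

/-- Grönwall's inequality on `[ε, 1]`, then `ε → 0`. Only continuity is asked at `0`, since the
evolution equation of the rescaled gauge transforms is derived for `t > 0`. -/
theorem eq_zero_of_hasDerivAt_le {F : Type*} [NormedAddCommGroup F] [NormedSpace ℝ F]
    {d d' : ℝ → F} {K : ℝ} (hK : 0 ≤ K) (hd : Continuous d) (h0 : d 0 = 0)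
    (hd' : ∀ s ∈ Set.Ioo (0 : ℝ) 1, HasDerivAt d (d' s) s)
    (hle : ∀ s ∈ Set.Ioo (0 : ℝ) 1, ‖d' s‖ ≤ K * ‖d s‖) : d 1 = 0 := by
  have key : ∀ ε ∈ Set.Ioo (0 : ℝ) 1, ‖d 1‖ ≤ ‖d ε‖ * Real.exp K := by
    intro ε hε
    have hmem : ∀ s ∈ Set.Ico ε 1, s ∈ Set.Ioo (0 : ℝ) 1 := fun s hs => ⟨hε.1.trans_le hs.1, hs.2⟩
    have h := norm_le_gronwallBound_of_norm_deriv_right_le (f := d) (f' := d') (δ := ‖d ε‖)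
      (K := K) (ε := 0) (a := ε) (b := 1) hd.continuousOn
      (fun s hs => (hd' s (hmem s hs)).hasDerivWithinAt) le_rfl
      (fun s hs => by simpa using hle s (hmem s hs)) 1 ⟨hε.2.le, le_rfl⟩
    rw [gronwallBound_ε0] at h
    refine h.trans ?_
    gcongr
    nlinarith [hε.1]
  have hlim : Filter.Tendsto (fun ε => ‖d ε‖ * Real.exp K) (𝓝[>] 0) (𝓝 0) := by
    have h1 : Continuous fun ε => ‖d ε‖ * Real.exp K := by fun_prop
    have h2 := h1.tendsto 0
    rw [h0, norm_zero, zero_mul] at h2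
    exact h2.mono_left nhdsWithin_le_nhds
  have h := ge_of_tendsto hlim (Filter.eventually_of_mem (Ioo_mem_nhdsGT one_pos) key)
  exact norm_le_zero_iff.1 h

theorem hasDerivAt_of_eq_constPath_add {F : Type*} [NormedAddCommGroup F] [NormedSpace ℝ F]
    [CompleteSpace F] {η ψ : C(unitInterval, F)} {x : F}
    (h : η = constPath x + pathPrimitive ψ) {s : ℝ} (hs : s ∈ Set.Ioo (0 : ℝ) 1) :
    HasDerivAt (fun s => η (Set.projIcc 0 1 zero_le_one s)) (ψ (Set.projIcc 0 1 zero_le_one s)) s := by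
  have hc : Continuous fun s : ℝ => ψ (Set.projIcc 0 1 zero_le_one s) := by fun_prop
  have h1 := (intervalIntegral.integral_hasDerivAt_right (hc.intervalIntegrable 0 s)
    (hc.stronglyMeasurableAtFilter _ _) hc.continuousAt).const_add x
  refine h1.congr_of_eventuallyEq ?_
  filter_upwards [isOpen_Ioo.mem_nhds hs] with u hu
  rw [h, ContinuousMap.add_apply, constPath_apply, pathPrimitive_apply,
    Set.projIcc_of_mem zero_le_one (Set.Ioo_subset_Icc_self hu)]

/-- The path `J b J*` solves the same equation `X' = a X + X a*` as `M`, and the difference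
satisfies a Grönwall bound with constant `2 C`. -/
theorem eq_conj_of_hasDerivAt {A : Type*} [NormedRing A] [NormedAlgebra ℝ A] [StarRing A]
    [StarModule ℝ A] [NormedStarGroup A] {M J a : ℝ → A} {b : A} {C : ℝ}
    (hM : Continuous M) (hJ : Continuous J) (hM0 : M 0 = b) (hJ0 : J 0 = 1) (hC : ∀ s, ‖a s‖ ≤ C)
    (hM' : ∀ s ∈ Set.Ioo (0 : ℝ) 1, HasDerivAt M (a s * M s + M s * star (a s)) s)
    (hJ' : ∀ s ∈ Set.Ioo (0 : ℝ) 1, HasDerivAt J (a s * J s) s) :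
    M 1 = J 1 * b * star (J 1) := by
  have hC0 : 0 ≤ C := (norm_nonneg _).trans (hC 0)
  refine sub_eq_zero.1 (eq_zero_of_hasDerivAt_le (d := fun s => M s - J s * b * star (J s))
    (d' := fun s => a s * (M s - J s * b * star (J s)) + (M s - J s * b * star (J s)) * star (a s))
    (K := 2 * C) (by positivity) (by fun_prop) (by simp [hM0, hJ0]) (fun s hs => ?_)
    (fun s _ => ?_))
  · have h1 : HasDerivAt (fun s => star (J s)) (star (a s * J s)) s :=
      HasFDerivAt.comp_hasDerivAt s (starL' ℝ (A := A)).toContinuousLinearMap.hasFDerivAt (hJ' s hs)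
    refine ((hM' s hs).sub (((hJ' s hs).mul_const b).mul h1)).congr_deriv ?_
    rw [star_mul]
    noncomm_ring
  · refine (norm_add_le _ _).trans ((add_le_add (norm_mul_le _ _) (norm_mul_le _ _)).trans ?_)
    rw [norm_star, mul_comm _ ‖a s‖, ← two_mul, ← mul_assoc]
    gcongr
    exact hC s

end LinearODE

/-! ### Splitting a Poisson tensor by a time-one map -/

section Splitting

universe u

variable {E : Type u} [NormedAddCommGroup E] [InnerProductSpace ℝ E] [FiniteDimensional ℝ E]

/-- The transverse part of the split Poisson tensor. -/
def transversePart (P W : E →L[ℝ] E) (B : E → E →L[ℝ] E) (z : E) : E →L[ℝ] E :=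
  (1 - P) * (B z * Ring.inverse (gaugeDen P W (B z) 0)) * (1 - P)

/-- The domain of the transverse part. -/
def transverseDomain (P W : E →L[ℝ] E) (B : E → E →L[ℝ] E) (D : Set E) : Set E :=
  {z | z ∈ D ∧ IsUnit (gaugeDen P W (B z) 0)}

theorem contDiffAt_transversePart {P W : E →L[ℝ] E} {B : E → E →L[ℝ] E} {D : Set E}
    (hB : IsPoissonTensor B D) {z : E} (hz : z ∈ transverseDomain P W B D) :
    ContDiffAt ℝ ∞ (transversePart P W B) z := by
  exact ContDiffAt.comp z (contDiffAt_transverse hz.2)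
    (hB.smooth.contDiffAt (hB.isOpen.mem_nhds hz.1))

theorem scaleOp_zero (P : E →L[ℝ] E) : scaleOp P 0 = 1 - P := by simp [scaleOp]

theorem scaleOp_one (P : E →L[ℝ] E) : scaleOp P 1 = 1 := by simp [scaleOp]

/-- Conjugation by an isometry acts on the Moser vector field. -/
theorem moserField_equivariant {P W : E →L[ℝ] E} {B : E → E →L[ℝ] E} {D : Set E}
    (hPW : IsGaugePair P W) (hB : IsPoissonTensor B D)
    (g : E ≃ₗᵢ[ℝ] E) (hgP : ∀ v, g (P v) = P (g v)) (hgW : ∀ v, g (W v) = W (g v))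
    (hgB : ∀ v ∈ D, g v ∈ D ∧ ∀ w, B (g v) (g w) = g (B v w)) {a : ℝ × E}
    (ha : a ∈ moserDomain P W B D) :
    (a.1, g a.2) ∈ moserDomain P W B D ∧
      moserField P W B (a.1, g a.2) = g (moserField P W B a) := by
  obtain ⟨t, v⟩ := a
  have hK : scaleOp P t (g v) = g (scaleOp P t v) := by
    simp [scaleOp, hgP]
  obtain ⟨hD, hQ⟩ := ha
  simp only at hD hQ ⊢
  have hQ' := isUnit_gaugeDen' hPW (hB.skew _ hD) hQ
  set c := scaleOp P t v
  obtain ⟨hgc, hgBc⟩ := hgB c hD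
  -- Conjugation by `g` is multiplicative, hence compatible with inverses; every other ingredient of
  -- the coefficient commutes with `g` directly.
  let φ : (E →L[ℝ] E) ≃* (E →L[ℝ] E) :=
    g.toContinuousLinearEquiv.conjContinuousAlgEquiv.toAlgEquiv.toMulEquiv
  have hφ : ∀ T w, φ T (g w) = g (T w) := fun T w => by
    change g (T (g.symm (g w))) = _
    simp
  have hext : ∀ S T : E →L[ℝ] E, (∀ w, S (g w) = T (g w)) → S = T := fun S T h => by
    ext w
    simpa using h (g.symm w)
  have h1 : gaugeDen P W (B (g c)) t = φ (gaugeDen P W (B c) t) := by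
    refine hext _ _ fun w => ?_
    rw [hφ]
    simp [gaugeDen, hgP, hgW, hgBc]
  have h2 : gaugeDen' P W (B (g c)) t = φ (gaugeDen' P W (B c) t) := by
    refine hext _ _ fun w => ?_
    rw [hφ]
    simp [gaugeDen', hgP, ← hgW, hgBc]
  have h3 : Ring.inverse (φ (gaugeDen' P W (B c) t)) = φ (Ring.inverse (gaugeDen' P W (B c) t)) := by
    have hU := hQ'.map φ
    refine hU.mul_left_cancel ?_
    rw [Ring.mul_inverse_cancel _ hU, ← map_mul, Ring.mul_inverse_cancel _ hQ', map_one]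
  refine ⟨⟨by simpa only [hK] using hgc, ?_⟩, ?_⟩
  · simp only [hK]
    rw [h1]
    exact hQ.map φ
  · have h4 : ∀ w, moserCoeff P W (B (g c)) t (g w) = g (moserCoeff P W (B c) t w) := by
      intro w
      rw [moserCoeff, h2, h3]
      simp [moserCoeff, hφ, ← hgP, ← hgW, hgBc]
    simp only [moserField, hK]
    exact h4 v

/-- Transport of the rescaled gauge transforms by the linearised Moser flow. -/
theorem moserTensor_transport {P W : E →L[ℝ] E} {B : E → E →L[ℝ] E} {D : Set E}
    (hPW : IsGaugePair P W) (hB : IsPoissonTensor B D) {x : E} {γ : C(unitInterval, E)}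
    (hγO : γ ∈ superposeDomain unitIncl (moserDomain P W B D))
    (hγ : γ = constPath x + pathPrimitive (superpose unitIncl (moserField P W B) γ))
    {J : C(unitInterval, E →L[ℝ] E)} (hJ : J = constPath 1 + pathPrimitive
      (superpose unitIncl (partialFDeriv (moserField P W B)) γ * J)) :
    moserTensor P W B (1, γ 1) = J 1 * moserTensor P W B (0, x) * star (J 1) := by
  have hY := contDiffOn_moserField hPW hB
  have hY' : ContinuousOn (partialFDeriv (moserField P W B)) (moserDomain P W B D) :=
    (ContMDiffOn.partialFDeriv (isOpen_moserDomain hB) (contMDiffOn_prod_self_iff.2 hY)).continuousOn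
  set A := superpose unitIncl (partialFDeriv (moserField P W B)) γ with hA
  let pr : ℝ → unitInterval := Set.projIcc 0 1 zero_le_one
  have hpr : Continuous pr := continuous_projIcc
  have h0 : pr 0 = 0 := Set.projIcc_left zero_le_one
  have h1 : pr 1 = 1 := Set.projIcc_right zero_le_one
  have hps : ∀ s ∈ Set.Ioo (0 : ℝ) 1, ((pr s : unitInterval) : ℝ) = s := fun s hs =>
    congrArg Subtype.val (Set.projIcc_of_mem zero_le_one (Set.Ioo_subset_Icc_self hs))
  have hM : Continuous fun s => moserTensor P W B (pr s, γ (pr s)) :=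
    (continuousOn_moserTensor hB).comp_continuous (by fun_prop) fun s => hγO (pr s)
  have key := eq_conj_of_hasDerivAt (M := fun s => moserTensor P W B (pr s, γ (pr s)))
    (J := fun s => J (pr s)) (a := fun s => A (pr s)) (b := moserTensor P W B (0, x)) (C := ‖A‖)
    hM (by fun_prop) ?_ ?_ (fun s => A.norm_coe_le_norm _) ?_ ?_
  · simpa only [h1, Set.Icc.coe_one] using key
  · have h2 : γ 0 = x := by
      rw [hγ, ContinuousMap.add_apply, pathPrimitive_apply]
      simp
    simp only [h0, h2, Set.Icc.coe_zero]
  · simp only [h0]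
    rw [hJ, ContinuousMap.add_apply, pathPrimitive_apply]
    simp
  · intro s hs
    have hmem := hγO (pr s)
    rw [unitIncl_apply, hps s hs] at hmem
    have hsup : superpose unitIncl (moserField P W B) γ (pr s) =
        moserField P W B (s, γ (pr s)) := by
      rw [superpose_apply hY.continuousOn hγO, unitIncl_apply, hps s hs]
    have hγ' : HasDerivAt (fun s => γ (pr s)) (moserField P W B (s, γ (pr s))) s :=
      (hasDerivAt_of_eq_constPath_add hγ hs).congr_deriv hsup
    have h3 := hasDerivAt_moserTensor hPW hB hs.1 hγ' hmem
    have h4 : A (pr s) = partialFDeriv (moserField P W B) (s, γ (pr s)) := by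
      rw [hA, superpose_apply hY' hγO, unitIncl_apply, hps s hs]
    simp only [h4, hps s hs]
    refine h3.congr_of_eventuallyEq ?_
    filter_upwards [isOpen_Ioo.mem_nhds hs] with u hu
    rw [hps u hu]
  · exact fun s hs => hasDerivAt_of_eq_constPath_add hJ hs

set_option maxHeartbeats 1000000 in
/-- **Equivariant splitting in a Euclidean space.** Near the origin, a Poisson tensor is the image
of a split one under a diffeomorphism commuting with all linear isometries that preserve it. -/
theorem IsPoissonTensor.exists_splitting {B : E → E →L[ℝ] E} {D : Set E}
    (hB : IsPoissonTensor B D) (h0 : (0 : E) ∈ D) {P W : E →L[ℝ] E} (hPW : IsGaugePair P W)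
    (hPB : P * B 0 = B 0) (hBP : B 0 * P = B 0) (hBW : B 0 * W = P) (hWB : W * B 0 = P) :
    ∃ (Ψ : OpenPartialHomeomorph E E) (r : ℝ), 0 < r ∧ Ψ.source = Metric.ball 0 r ∧
      Ψ.target ⊆ D ∧ Ψ 0 = 0 ∧ ContDiffOn ℝ ∞ Ψ Ψ.source ∧ ContDiffOn ℝ ∞ Ψ.symm Ψ.target ∧
      (∀ x ∈ Metric.ball (0 : E) r, x - P x ∈ transverseDomain P W B D ∧
        B (Ψ x) = fderiv ℝ Ψ x * (B 0 + transversePart P W B (x - P x)) * star (fderiv ℝ Ψ x)) ∧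
      (∀ g : E ≃ₗᵢ[ℝ] E, (∀ v ∈ D, g v ∈ D ∧ ∀ w, B (g v) (g w) = g (B v w)) →
        ∀ x ∈ Metric.ball (0 : E) r, Ψ (g x) = g (Ψ x)) := by
  set O := moserDomain P W B D with hO
  have hOo : IsOpen O := isOpen_moserDomain hB
  have hY : ContDiffOn ℝ ∞ (moserField P W B) O := contDiffOn_moserField hPW hB
  have hO0 : ∀ t : unitInterval, ((t : ℝ), (0 : E)) ∈ O := fun t => by
    refine ⟨by simpa using h0, ?_⟩
    simp [gaugeDen_eq_one hWB]
  have hY0 : ∀ t : unitInterval, moserField P W B (t, 0) = 0 := fun t => by simp [moserField]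
  -- The field is a coefficient applied to `v`. At `v = 0` the product rule leaves only the
  -- coefficient itself, which is zero there because `B 0 * W = P`.
  have hY1 : ∀ t : unitInterval, partialFDeriv (moserField P W B) ((t : ℝ), 0) = 0 := fun t => by
    have h1 := ((contDiffOn_moserCoeff hPW hB).contDiffAt (hOo.mem_nhds (hO0 t))).comp (0 : E)
      (f := fun v : E => ((t : ℝ), v)) (contDiff_prodMk_right _).contDiffAt
    have h2 := (h1.differentiableAt (by simp)).hasFDerivAt.clm_apply (hasFDerivAt_id (0 : E))
    refine HasFDerivAt.fderiv (h2.congr_fderiv ?_)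
    ext v
    simp [moserCoeff_eq_zero hPW.PP hBW]
  obtain ⟨Γ, r, hr, hΓs, hΓ0, hΓO, hΓeq, hΓd, hΓg⟩ := exists_smooth_flow hOo hY hO0 hY0 hY1
  -- the time-one map
  let ev (t : unitInterval) : C(unitInterval, E) →L[ℝ] E := ContinuousMap.evalCLM ℝ t
  let φ : E → E := fun x => Γ x 1
  have hφs : ContDiffOn ℝ ∞ φ (Metric.ball 0 r) := (ev 1).contDiff.comp_contDiffOn hΓs
  have hΓdiff : ∀ x ∈ Metric.ball (0 : E) r, HasFDerivAt Γ (fderiv ℝ Γ x) x := fun x hx =>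
    ((hΓs.contDiffAt (Metric.isOpen_ball.mem_nhds hx)).differentiableAt (by simp)).hasFDerivAt
  have hφd : ∀ x ∈ Metric.ball (0 : E) r, HasFDerivAt φ ((ev 1).comp (fderiv ℝ Γ x)) x :=
    fun x hx => (ev 1).hasFDerivAt.comp x (hΓdiff x hx)
  have h0r : (0 : E) ∈ Metric.ball (0 : E) r := Metric.mem_ball_self hr
  have hY' : ContinuousOn (partialFDeriv (moserField P W B)) O :=
    (ContMDiffOn.partialFDeriv hOo (contMDiffOn_prod_self_iff.2 hY)).continuousOn
  have hφ1 : HasFDerivAt φ ((ContinuousLinearEquiv.refl ℝ E : E ≃L[ℝ] E) : E →L[ℝ] E) 0 := by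
    refine (hφd 0 h0r).congr_fderiv ?_
    ext h
    have h1 : superpose (K := unitInterval) unitIncl (partialFDeriv (moserField P W B)) (Γ 0) = 0 := by
      have hm : Γ 0 ∈ superposeDomain unitIncl O := hΓO 0 h0r
      ext1 t
      rw [superpose_apply hY' hm, hΓ0]
      exact hY1 t
    have h2 := congrArg (fun γ : C(unitInterval, E) => γ 1) (hΓd 0 h0r h)
    rw [h1] at h2
    simp only [map_zero, zero_apply, add_zero, constPath_apply] at h2
    exact h2
  obtain ⟨Ψ, h0Ψ, hΨr, hΨφ, hΨs⟩ :=
    exists_openPartialHomeomorph_of_contDiffOn Metric.isOpen_ball hφs h0r _ hφ1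
  obtain ⟨ρ, hρ, hρΨ⟩ := Metric.isOpen_iff.1 Ψ.open_source 0 h0Ψ
  have hρr : Metric.ball (0 : E) ρ ⊆ Metric.ball 0 r := hρΨ.trans hΨr
  have hΨf : (Ψ : E → E) = φ := funext hΨφ
  have hsrc : (Ψ.restrOpen _ (Metric.isOpen_ball (x := (0 : E)) (ε := ρ))).source =
      Metric.ball 0 ρ := Set.inter_eq_right.2 hρΨ
  refine ⟨Ψ.restrOpen _ (Metric.isOpen_ball (x := (0 : E)) (ε := ρ)), ρ, hρ, hsrc, ?_, ?_, ?_,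
    ?_, ?_, ?_⟩
  · intro y hy
    set Ψ' := Ψ.restrOpen _ (Metric.isOpen_ball (x := (0 : E)) (ε := ρ)) with hΨ'
    have h1 : Ψ'.symm y ∈ Metric.ball (0 : E) r := hρr (hsrc ▸ Ψ'.map_target hy)
    have h2 := (hΓO _ h1 1).1
    have h3 : Γ (Ψ'.symm y) 1 = y := by
      have := Ψ'.right_inv hy
      rwa [show Ψ' (Ψ'.symm y) = φ (Ψ'.symm y) from hΨφ _] at this
    rw [h3] at h2
    simpa [scaleOp_one] using h2
  · change Ψ 0 = 0
    rw [hΨφ]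
    simp [φ, hΓ0]
  · rw [hsrc]
    change ContDiffOn ℝ ∞ Ψ _
    rw [hΨf]
    exact hφs.mono hρr
  · exact hΨs.mono fun y hy => hy.1
  · intro x hx
    have hxr := hρr hx
    change _ ∧ B (Ψ x) = fderiv ℝ Ψ x * _ * star (fderiv ℝ Ψ x)
    rw [hΨf, (hφd x hxr).fderiv]
    set γ := Γ x with hγ
    have hγ0 : γ 0 = x := by
      rw [hγ, hΓeq x hxr, ContinuousMap.add_apply, pathPrimitive_apply]
      simp
    have hx0 := hΓO x hxr 0
    rw [← hγ, hγ0] at hx0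
    have hxD : x - P x ∈ transverseDomain P W B D := by
      obtain ⟨h1, h2⟩ := hx0
      simp only [Set.Icc.coe_zero, scaleOp_zero, sub_apply, one_apply_eq_self] at h1 h2
      exact ⟨h1, h2⟩
    refine ⟨hxD, ?_⟩
    -- At time zero the scaling is `1 - P`, so the tensor depends on `x` only through `x - P x`; the
    -- coefficients `f i j` are functions of `z` alone for this reason.
    have hM0 : moserTensor P W B (0, x) = B 0 + transversePart P W B (x - P x) := by
      have := gaugeBlock_zero (P := P) (W := W) (B := B (x - P x)) hBP hBW hxD.2
      simpa [moserTensor, scaleOp_zero, transversePart] using this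
    have hM1 : moserTensor P W B (1, φ x) = B (φ x) := by
      have h1 := (hΓO x hxr 1).1
      simp only [Set.Icc.coe_one, scaleOp_one] at h1
      simpa [moserTensor, scaleOp_one] using gaugeBlock_one hPW.star_P (hB.skew _ h1)
    rw [← hM0, ← hM1]
    set b₀ := moserTensor P W B (0, x)
    -- The linearised flow as a path of operators. In finite dimension, continuity on each vector
    -- gives continuity in operator norm.
    let J : C(unitInterval, E →L[ℝ] E) := ⟨fun t => (ev t).comp (fderiv ℝ Γ x), by
      rw [continuous_clm_apply]
      intro h
      exact (fderiv ℝ Γ x h).continuous⟩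
    have hJeq : J = constPath 1 + pathPrimitive
        (superpose unitIncl (partialFDeriv (moserField P W B)) γ * J) := by
      ext t h
      have h1 := congrArg (fun η : C(unitInterval, E) => η t) (hΓd x hxr h)
      have hc : Continuous fun s : ℝ =>
          (superpose unitIncl (partialFDeriv (moserField P W B)) γ * J)
            (Set.projIcc 0 1 zero_le_one s) := by fun_prop
      simp only [ContinuousMap.add_apply, pathPrimitive_apply, constPath_apply] at h1 ⊢
      rw [add_apply, ContinuousLinearMap.intervalIntegral_apply (hc.intervalIntegrable _ _)]
      exact h1
    exact moserTensor_transport hPW hB (hΓO x hxr) (hΓeq x hxr) hJeq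
  · intro g hg x hx
    have hgB : (g.toContinuousLinearEquiv : E →L[ℝ] E) * B 0 =
        B 0 * (g.toContinuousLinearEquiv : E →L[ℝ] E) := by
      ext w
      have := (hg 0 h0).2 w
      rw [map_zero] at this
      exact this.symm
    have hB0 := hB.skew 0 h0
    have hgP : ∀ v, g (P v) = P (g v) := fun v =>
      congrArg (fun T : E →L[ℝ] E => T v) (hPW.commute_proj hB0 hPB hBW hgB)
    have hgW : ∀ v, g (W v) = W (g v) := fun v =>
      congrArg (fun T : E →L[ℝ] E => T v) (hPW.commute_W hB0 hPB hBW hWB hgB)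
    change Ψ (g x) = g (Ψ x)
    rw [hΨφ, hΨφ]
    exact hΓg g (fun a ha => moserField_equivariant hPW hB g hgP hgW hg ha) x (hρr hx) 1

end Splitting

/-! ### Linear Darboux coordinates -/

section LinearNormalForm

universe u

variable {E : Type u} [NormedAddCommGroup E] [InnerProductSpace ℝ E] [FiniteDimensional ℝ E]

theorem inner_eq_neg_of_skew {B : E →L[ℝ] E} (hB : star B = -B) (x y : E) :
    ⟪x, B y⟫_ℝ = -⟪y, B x⟫_ℝ := by
  rw [← inner_star_left, hB, neg_apply, inner_neg_left, real_inner_comm]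

/-- A skew operator is a sum of decomposable ones, as few as its rank allows. -/
theorem exists_skew_decomposition (N : ℕ) : ∀ B : E →L[ℝ] E, star B = -B →
    Module.finrank ℝ (LinearMap.range B.toLinearMap) ≤ N →
    ∃ (k : ℕ) (u v : Fin k → E), 2 * k ≤ Module.finrank ℝ (LinearMap.range B.toLinearMap) ∧
      ∀ ξ, B ξ = ∑ i, (⟪ξ, u i⟫_ℝ • v i - ⟪ξ, v i⟫_ℝ • u i) := by
  induction N using Nat.strong_induction_on with
  | _ N ih =>
  intro B hB hN
  by_cases h0 : B = 0
  · exact ⟨0, Fin.elim0, Fin.elim0, by simp, fun ξ => by simp [h0]⟩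
  obtain ⟨ξ₀, hξ₀⟩ : ∃ ξ, B ξ ≠ 0 := by
    by_contra! h
    exact h0 (ContinuousLinearMap.ext h)
  -- Normalised so that `ξ` and `η = B ξ₀` pair to one under `B`.
  set ξ := (‖B ξ₀‖ ^ 2)⁻¹ • ξ₀ with hξ
  set η := B ξ₀ with hη
  have h1 : ⟪η, B ξ⟫_ℝ = 1 := by
    rw [hξ, map_smul, inner_smul_right, real_inner_self_eq_norm_sq]
    exact inv_mul_cancel₀ (pow_ne_zero 2 (norm_ne_zero_iff.2 hξ₀))
  have hskew : ∀ x y, ⟪x, B y⟫_ℝ = -⟪y, B x⟫_ℝ := inner_eq_neg_of_skew hB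
  have hself : ∀ x, ⟪x, B x⟫_ℝ = 0 := fun x => by linarith [hskew x x]
  set u := -B η with hu
  set v := B ξ with hv
  -- The remainder kills `ξ` and `η`, so by skewness its range is orthogonal to both; the range of
  -- `B` is not, and the rank drops by at least two.
  let B₁ : E →L[ℝ] E := B - ((innerSL ℝ u).smulRight v - (innerSL ℝ v).smulRight u)
  have hB₁ : ∀ x, B₁ x = B x - (⟪x, u⟫_ℝ • v - ⟪x, v⟫_ℝ • u) := fun x => by
    simp [B₁, real_inner_comm]
  have hskew₁ : ∀ x y, ⟪x, B₁ y⟫_ℝ = -⟪y, B₁ x⟫_ℝ := fun x y => by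
    simp only [hB₁, inner_sub_right, inner_smul_right, hskew x y]
    ring
  have hB₁s : star B₁ = -B₁ := by
    ext x
    refine ext_inner_left ℝ fun y => ?_
    rw [inner_star_right, neg_apply, inner_neg_right, real_inner_comm, hskew₁]
  have huξ : ⟪ξ, u⟫_ℝ = 1 := by rw [hu, inner_neg_right, hskew, neg_neg, h1]
  have huη : ⟪η, u⟫_ℝ = 0 := by rw [hu, inner_neg_right, hself, neg_zero]
  have hvξ : ⟪ξ, v⟫_ℝ = 0 := hself ξ
  have hvη : ⟪η, v⟫_ℝ = 1 := h1
  have hB₁ξ : B₁ ξ = 0 := by simp [hB₁, huξ, hvξ, ← hv]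
  have hB₁η : B₁ η = 0 := by simp [hB₁, hvη, hu, hself]
  set S := LinearMap.range B.toLinearMap with hS
  have huS : u ∈ S := ⟨-η, by simp [hu]⟩
  have hvS : v ∈ S := ⟨ξ, rfl⟩
  have hle : LinearMap.range B₁.toLinearMap ≤
      (S ⊓ LinearMap.ker (innerSL ℝ ξ).toLinearMap) ⊓ LinearMap.ker (innerSL ℝ η).toLinearMap := by
    rintro _ ⟨x, rfl⟩
    refine ⟨⟨?_, ?_⟩, ?_⟩
    · change B₁ x ∈ S
      rw [hB₁]
      exact S.sub_mem ⟨x, rfl⟩ (S.sub_mem (S.smul_mem _ hvS) (S.smul_mem _ huS))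
    · change ⟪ξ, B₁ x⟫_ℝ = 0
      rw [hskew₁, hB₁ξ, inner_zero_right, neg_zero]
    · change ⟪η, B₁ x⟫_ℝ = 0
      rw [hskew₁, hB₁η, inner_zero_right, neg_zero]
  have hlt1 : S ⊓ LinearMap.ker (innerSL ℝ ξ).toLinearMap < S := by
    refine lt_of_le_of_ne inf_le_left fun h => ?_
    have h2 : u ∈ S ⊓ LinearMap.ker (innerSL ℝ ξ).toLinearMap := by rw [h]; exact huS
    have h3 : ⟪ξ, u⟫_ℝ = 0 := h2.2
    linarith
  have hlt2 : (S ⊓ LinearMap.ker (innerSL ℝ ξ).toLinearMap) ⊓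
      LinearMap.ker (innerSL ℝ η).toLinearMap < S ⊓ LinearMap.ker (innerSL ℝ ξ).toLinearMap := by
    refine lt_of_le_of_ne inf_le_left fun h => ?_
    have h2 : v ∈ (S ⊓ LinearMap.ker (innerSL ℝ ξ).toLinearMap) ⊓
      LinearMap.ker (innerSL ℝ η).toLinearMap := by rw [h]; exact ⟨hvS, hvξ⟩
    have h3 : ⟪η, v⟫_ℝ = 0 := h2.2
    linarith
  have d1 := Submodule.finrank_mono hle
  have d2 := Submodule.finrank_lt_finrank_of_lt hlt1
  have d3 := Submodule.finrank_lt_finrank_of_lt hlt2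
  obtain ⟨k, u', v', hk, hsum⟩ := ih (N - 1) (by omega) B₁ hB₁s (by omega)
  refine ⟨k + 1, Fin.cons u u', Fin.cons v v', by omega, fun x => ?_⟩
  rw [Fin.sum_univ_succ]
  simp only [Fin.cons_zero, Fin.cons_succ]
  rw [← hsum, hB₁]
  abel

/-- Linear Darboux coordinates for a skew operator of rank `2k`, in which the orthogonal projection
`P` onto its range is the projection onto the first `2k` coordinates. -/
theorem exists_darboux_coordinates {B P : E →L[ℝ] E} (hB : star B = -B) (hPs : star P = P)
    (hPP : P * P = P) (hPB : P * B = B) {W : E →L[ℝ] E} (hBW : B * W = P) {n k : ℕ}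
    (hn : Module.finrank ℝ E = n) (hk : 2 * k = Module.finrank ℝ (LinearMap.range B.toLinearMap)) :
    ∃ Λ : CoordSpace k (n - 2 * k) ≃L[ℝ] E,
      (∀ ξ η, ⟪η, B ξ⟫_ℝ = ∑ i, (⟪ξ, Λ (basisX _ i)⟫_ℝ * ⟪η, Λ (basisY _ i)⟫_ℝ
        - ⟪ξ, Λ (basisY _ i)⟫_ℝ * ⟪η, Λ (basisX _ i)⟫_ℝ)) ∧
      (∀ c, P (Λ c) = Λ (c.1, c.2.1, 0)) ∧
      (∀ x, x - P x = ∑ j, ⟪x, Λ (basisZ k j)⟫_ℝ • Λ (basisZ k j)) := by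
  set S := LinearMap.range B.toLinearMap with hS
  obtain ⟨k', u, v, hk', hsum⟩ := exists_skew_decomposition _ B hB le_rfl
  have hSspan : S ≤ Submodule.span ℝ (Set.range (Sum.elim u v)) := by
    rintro _ ⟨x, rfl⟩
    change B x ∈ _
    rw [hsum]
    refine Submodule.sum_mem _ fun i _ => Submodule.sub_mem _ (Submodule.smul_mem _ _ ?_)
      (Submodule.smul_mem _ _ ?_)
    · exact Submodule.subset_span ⟨Sum.inr i, rfl⟩
    · exact Submodule.subset_span ⟨Sum.inl i, rfl⟩
  have hcard : Module.finrank ℝ (Submodule.span ℝ (Set.range (Sum.elim u v))) ≤ k' + k' := by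
    have := finrank_range_le_card (R := ℝ) (Sum.elim u v)
    simp only [Fintype.card_sum, Fintype.card_fin] at this
    exact this
  have hle := Submodule.finrank_mono hSspan
  rw [← hS] at hk'
  -- The rank bounds the number of terms by `k`, and the `2 k'` vectors span a range of dimension `2
  -- k`.
  obtain rfl : k = k' := by omega
  have hSeq : S = Submodule.span ℝ (Set.range (Sum.elim u v)) :=
    Submodule.eq_of_le_of_finrank_le hSspan (by omega)
  have hli : LinearIndependent ℝ (Sum.elim u v) := by
    rw [linearIndependent_iff_card_eq_finrank_span]
    simp only [Fintype.card_sum, Fintype.card_fin, Set.finrank]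
    omega
  have hPS : ∀ x ∈ S, P x = x := by
    rintro _ ⟨y, rfl⟩
    exact congrArg (fun T : E →L[ℝ] E => T y) hPB
  have huS : ∀ i, P (u i) = u i := fun i =>
    hPS _ (hSeq ▸ Submodule.subset_span ⟨Sum.inl i, rfl⟩)
  have hvS : ∀ i, P (v i) = v i := fun i =>
    hPS _ (hSeq ▸ Submodule.subset_span ⟨Sum.inr i, rfl⟩)
  have hPmem : ∀ x, P x ∈ S := fun x => ⟨W x, congrArg (fun T : E →L[ℝ] E => T x) hBW⟩
  set N := LinearMap.ker P.toLinearMap with hN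
  have hrange : LinearMap.range P.toLinearMap = S :=
    le_antisymm (by rintro _ ⟨x, rfl⟩; exact hPmem x) fun x hx => ⟨x, hPS x hx⟩
  have hNdim : Module.finrank ℝ N = n - 2 * k := by
    have := LinearMap.finrank_range_add_finrank_ker P.toLinearMap
    rw [hrange, hn, ← hk, ← hN] at this
    omega
  -- Orthonormality makes the coefficients of `x - P x` inner products with `x`, which is what
  -- evaluates the transverse block.
  let e : OrthonormalBasis (Fin (n - 2 * k)) ℝ N :=
    (stdOrthonormalBasis ℝ N).reindex (finCongr hNdim)
  have hPe : ∀ j, P (e j) = 0 := fun j => (e j).2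
  let Λ₀ : CoordSpace k (n - 2 * k) →ₗ[ℝ] E :=
    (Fintype.linearCombination ℝ u).comp (LinearMap.fst ℝ _ _) +
      ((Fintype.linearCombination ℝ v).comp ((LinearMap.fst ℝ _ _).comp (LinearMap.snd ℝ _ _)) +
      (Fintype.linearCombination ℝ (fun j => (e j : E))).comp
        ((LinearMap.snd ℝ _ _).comp (LinearMap.snd ℝ _ _)))
  have hΛ₀ : ∀ c, Λ₀ c = ∑ i, c.1 i • u i + (∑ i, c.2.1 i • v i + ∑ j, c.2.2 j • (e j : E)) :=
    fun c => rfl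
  have hPΛ : ∀ c, P (Λ₀ c) = Λ₀ (c.1, c.2.1, 0) := fun c => by
    simp [hΛ₀, huS, hvS, hPe]
  have hinj : Function.Injective Λ₀ := by
    rw [injective_iff_map_eq_zero]
    intro c hc
    have h1 : Λ₀ (c.1, c.2.1, 0) = 0 := by rw [← hPΛ, hc, map_zero]
    have h2 : ∑ i, Sum.elim c.1 c.2.1 i • Sum.elim u v i = 0 := by
      simpa [hΛ₀, Fintype.sum_sum_type] using h1
    have h3 := Fintype.linearIndependent_iff.1 hli _ h2
    have h4 : c.1 = 0 := funext fun i => h3 (Sum.inl i)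
    have h5 : c.2.1 = 0 := funext fun i => h3 (Sum.inr i)
    have h6 : ∑ j, c.2.2 j • e j = 0 := by
      have : ∑ j, c.2.2 j • (e j : E) = 0 := by simpa [hΛ₀, h4, h5] using hc
      exact Subtype.ext (by simpa using this)
    have h7 : c.2.2 = 0 := funext (Fintype.linearIndependent_iff.1 e.toBasis.linearIndependent _
      (by simpa using h6))
    exact Prod.ext h4 (Prod.ext h5 h7)
  have hdim : Module.finrank ℝ (CoordSpace k (n - 2 * k)) = Module.finrank ℝ E := by
    have : 2 * k ≤ n := by
      rw [hk, ← hn]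
      exact Submodule.finrank_le S
    simp only [Module.finrank_prod, Module.finrank_fin_fun, hn]
    omega
  let Λ : CoordSpace k (n - 2 * k) ≃L[ℝ] E :=
    (LinearEquiv.ofInjectiveOfFinrankEq Λ₀ hinj hdim).toContinuousLinearEquiv
  have hΛ : ∀ c, Λ c = Λ₀ c := fun c => rfl
  have hX : ∀ i, Λ (basisX _ i) = u i := fun i => by
    simp [hΛ, hΛ₀, basisX, Pi.single_apply]
  have hY : ∀ i, Λ (basisY _ i) = v i := fun i => by
    simp [hΛ, hΛ₀, basisY, Pi.single_apply]
  have hZ : ∀ j, Λ (basisZ k j) = e j := fun j => by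
    simp [hΛ, hΛ₀, basisZ, Pi.single_apply]
  refine ⟨Λ, fun ξ η => ?_, fun c => by rw [hΛ, hΛ, hPΛ], fun x => ?_⟩
  · rw [hsum]
    simp only [inner_sum, inner_sub_right, inner_smul_right, hX, hY]
  · have hxN : P (x - P x) = 0 := by
      have : P (P x) = P x := congrArg (fun T : E →L[ℝ] E => T x) hPP
      rw [map_sub, this, sub_self]
    have h1 := congrArg Subtype.val (e.sum_repr' ⟨x - P x, hxN⟩)
    have h2 : ∀ j, ⟪(e j : E), x - P x⟫_ℝ = ⟪x, e j⟫_ℝ := fun j => by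
      rw [inner_sub_right, ← inner_star_left, hPs, hPe, inner_zero_left, sub_zero,
        real_inner_comm]
    simp only [hZ]
    have h3 : x - P x = ((∑ j, ⟪e j, ⟨x - P x, hxN⟩⟫_ℝ • e j : N) : E) := h1.symm
    rw [h3]
    simp only [AddSubmonoidClass.coe_finsetSum, Submodule.coe_smul, Submodule.coe_inner, h2]

end LinearNormalForm

/-! ### Linearisation of compact group actions at a fixed point -/

section Average

universe u v w

variable {G : Type u} [TopologicalSpace G] [CompactSpace G] [Group G] [IsTopologicalGroup G]
  {X : Type v} [NormedAddCommGroup X] [NormedSpace ℝ X] [FiniteDimensional ℝ X]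
  {Y : Type w}
  [NormedAddCommGroup Y] [NormedSpace ℝ Y] [FiniteDimensional ℝ Y]

open MeasureTheory in
/-- The mean of a continuous function on a compact group. -/
def groupMean (γ : C(G, X)) : X :=
  letI : MeasurableSpace G := borel G
  haveI : BorelSpace G := ⟨rfl⟩
  ∫ g, γ g ∂(Measure.haarMeasure (⊤ : TopologicalSpace.PositiveCompacts G))

open MeasureTheory in
theorem exists_measure_groupMean : ∃ (_ : MeasurableSpace G) (_ : BorelSpace G) (μ : Measure G)
    (_ : IsProbabilityMeasure μ) (_ : μ.IsMulLeftInvariant) (_ : μ.IsOpenPosMeasure),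
    ∀ (Z : Type v) [NormedAddCommGroup Z] [NormedSpace ℝ Z] (γ : C(G, Z)),
      groupMean γ = ∫ g, γ g ∂μ := by
  let _ : MeasurableSpace G := borel G
  have : BorelSpace G := ⟨rfl⟩
  refine ⟨inferInstance, inferInstance,
    Measure.haarMeasure (⊤ : TopologicalSpace.PositiveCompacts G), ⟨?_⟩, inferInstance,
    inferInstance, fun Z _ _ γ => rfl⟩
  exact Measure.haarMeasure_self

theorem groupMean_const (x : X) : groupMean (ContinuousMap.const G x) = x := by
  obtain ⟨_, _, μ, _, _, _, h⟩ := exists_measure_groupMean.{u, v} (G := G)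
  rw [h]
  simp

theorem groupMean_add (γ η : C(G, X)) : groupMean (γ + η) = groupMean γ + groupMean η := by
  obtain ⟨_, _, μ, _, _, _, h⟩ := exists_measure_groupMean.{u, v} (G := G)
  rw [h, h, h]
  exact MeasureTheory.integral_add
    (γ.continuous.integrable_of_hasCompactSupport (HasCompactSupport.of_compactSpace _))
    (η.continuous.integrable_of_hasCompactSupport (HasCompactSupport.of_compactSpace _))

theorem map_groupMean (T : X →L[ℝ] Y) (γ : C(G, X)) :
    T (groupMean γ) = groupMean ((⟨T, T.continuous⟩ : C(X, Y)).comp γ) := by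
  let _ : MeasurableSpace G := borel G
  have : BorelSpace G := ⟨rfl⟩
  exact (T.integral_comp_comm
    (γ.continuous.integrable_of_hasCompactSupport (HasCompactSupport.of_compactSpace _))).symm

theorem groupMean_mul_left (γ : C(G, X)) (a : G) :
    groupMean (γ.comp (ContinuousMap.mulLeft a)) = groupMean γ := by
  obtain ⟨_, _, μ, _, _, _, h⟩ := exists_measure_groupMean.{u, v} (G := G)
  rw [h, h]
  exact MeasureTheory.integral_mul_left_eq_self (fun g => γ g) a

theorem norm_groupMean_le (γ : C(G, X)) : ‖groupMean γ‖ ≤ ‖γ‖ := by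
  obtain ⟨_, _, μ, _, _, _, h⟩ := exists_measure_groupMean.{u, v} (G := G)
  rw [h]
  refine (MeasureTheory.norm_integral_le_of_norm_le_const
    (Filter.Eventually.of_forall γ.norm_coe_le_norm)).trans ?_
  simp

theorem groupMean_pos (γ : C(G, ℝ)) (hγ : ∀ g, 0 < γ g) : 0 < groupMean γ := by
  obtain ⟨_, _, μ, _, _, _, h⟩ := exists_measure_groupMean.{u, 0} (G := G)
  rw [h]
  exact γ.continuous.integral_pos_of_hasCompactSupport_nonneg_nonzero
    (HasCompactSupport.of_compactSpace _) (fun g => (hγ g).le) (hγ 1).ne'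

variable (G X) in
/-- The mean as a continuous linear functional. -/
def groupMeanL : C(G, X) →L[ℝ] X :=
  LinearMap.mkContinuous
    { toFun := groupMean
      map_add' := groupMean_add
      map_smul' := fun c γ => (map_groupMean (c • ContinuousLinearMap.id ℝ X) γ).symm } 1
    (fun γ => (norm_groupMean_le γ).trans_eq (one_mul _).symm)

end Average

/-! ### Invariant inner products -/

section Isometry

variable {E : Type*} [NormedAddCommGroup E] [InnerProductSpace ℝ E] [FiniteDimensional ℝ E]

/-- The positive square root in an eigenbasis; it carries an invariant inner product to the given
one. -/
theorem exists_sqrt_of_posDef {S : E →L[ℝ] E} (hS : ∀ u v, ⟪S u, v⟫_ℝ = ⟪u, S v⟫_ℝ)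
    (hpos : ∀ u, u ≠ 0 → 0 < ⟪u, S u⟫_ℝ) :
    ∃ T : E ≃L[ℝ] E, ∀ u, ‖T u‖ ^ 2 = ⟪u, S u⟫_ℝ := by
  have hsym : S.toLinearMap.IsSymmetric := hS
  let b := hsym.eigenvectorBasis rfl
  let l := hsym.eigenvalues rfl
  have hSb : ∀ i, S (b i) = l i • b i := fun i => hsym.apply_eigenvectorBasis rfl i
  have hl : ∀ i, 0 < l i := fun i => by
    have h1 := hpos (b i) (b.orthonormal.ne_zero i)
    rw [hSb, inner_smul_right, real_inner_self_eq_norm_sq, b.orthonormal.1 i] at h1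
    simpa using h1
  let T₀ : E →ₗ[ℝ] E := ∑ i, (√(l i) • ((innerSL ℝ (b i)).smulRight (b i)).toLinearMap)
  have hT₀ : ∀ u, T₀ u = ∑ i, (√(l i) * ⟪b i, u⟫_ℝ) • b i := fun u => by
    simp [T₀, LinearMap.sum_apply, smul_smul]
  have hnorm : ∀ u, ‖T₀ u‖ ^ 2 = ⟪u, S u⟫_ℝ := fun u => by
    rw [← b.sum_sq_norm_inner_right, ← b.sum_inner_mul_inner]
    refine Finset.sum_congr rfl fun i _ => ?_
    have h1 : ⟪b i, T₀ u⟫_ℝ = √(l i) * ⟪b i, u⟫_ℝ := by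
      rw [hT₀, b.orthonormal.inner_right_fintype]
    have h2 : ⟪b i, S u⟫_ℝ = l i * ⟪b i, u⟫_ℝ := by
      rw [← hS, hSb, inner_smul_left]
      rfl
    rw [h1, h2, Real.norm_eq_abs, sq_abs, mul_pow, Real.sq_sqrt (hl i).le, real_inner_comm]
    ring
  have hinj : Function.Injective T₀ := by
    rw [injective_iff_map_eq_zero]
    intro u hu
    by_contra h
    have := hpos u h
    rw [← hnorm, hu] at this
    simp at this
  exact ⟨(LinearEquiv.ofInjectiveEndo T₀ hinj).toContinuousLinearEquiv, hnorm⟩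

variable {G : Type*} [TopologicalSpace G] [CompactSpace G] [Group G] [IsTopologicalGroup G]

/-- Weyl's unitary trick. -/
theorem exists_isometric_representation (A : C(G, E →L[ℝ] E)) (h1 : A 1 = 1)
    (hmul : ∀ g h, A (g * h) = A g * A h) :
    ∃ (T : E ≃L[ℝ] E) (ρ : G →* (E ≃ₗᵢ[ℝ] E)), ∀ g x, ρ g (T x) = T (A g x) := by
  -- The mean of these operators represents the averaged inner product. The inverses make its
  -- invariance a consequence of left invariance of the mean.
  let γ : C(G, E →L[ℝ] E) := ⟨fun g => star (A g⁻¹) * A g⁻¹, by fun_prop⟩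
  let S := groupMean γ
  let q (u v : E) : C(G, ℝ) := ⟨fun g => ⟪A g⁻¹ u, A g⁻¹ v⟫_ℝ, by fun_prop⟩
  have hq : ∀ u v, ⟪u, S v⟫_ℝ = groupMean (q u v) := fun u v => by
    have := map_groupMean ((innerSL ℝ u).comp (ContinuousLinearMap.apply ℝ E v)) γ
    refine this.trans (congrArg _ ?_)
    ext g
    change ⟪u, star (A g⁻¹) (A g⁻¹ v)⟫_ℝ = ⟪A g⁻¹ u, A g⁻¹ v⟫_ℝ
    rw [inner_star_right]
  have hqc : ∀ u v, q u v = q v u := fun u v => by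
    ext g
    exact real_inner_comm _ _
  have hSs : ∀ u v, ⟪S u, v⟫_ℝ = ⟪u, S v⟫_ℝ := fun u v => by
    rw [real_inner_comm, hq, hq, hqc]
  have hinv : ∀ g h x, A g⁻¹ (A h x) = A (g⁻¹ * h) x := fun g h x => by
    rw [hmul]
    rfl
  have hpos : ∀ u, u ≠ 0 → 0 < ⟪u, S u⟫_ℝ := fun u hu => by
    rw [hq]
    refine groupMean_pos _ fun g => ?_
    change 0 < ⟪A g⁻¹ u, A g⁻¹ u⟫_ℝ
    rw [real_inner_self_pos]
    intro h
    have h2 := hinv g⁻¹ g⁻¹ u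
    rw [h, inv_inv, mul_inv_cancel, h1, map_zero] at h2
    exact hu h2.symm
  obtain ⟨T, hT⟩ := exists_sqrt_of_posDef hSs hpos
  have hiso : ∀ h x, ‖T (A h x)‖ = ‖T x‖ := fun h x => by
    rw [← sq_eq_sq₀ (norm_nonneg _) (norm_nonneg _), hT, hT, hq, hq,
      ← groupMean_mul_left (q (A h x) (A h x)) h]
    congr 1
    ext g
    change ⟪A (h * g)⁻¹ (A h x), A (h * g)⁻¹ (A h x)⟫_ℝ = ⟪A g⁻¹ x, A g⁻¹ x⟫_ℝ
    rw [hinv, mul_inv_rev, inv_mul_cancel_right]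
  have hAA : ∀ g h x, A g (A h x) = A (g * h) x := fun g h x => by
    rw [hmul]
    rfl
  let ρ₀ (g : G) : E ≃ₗᵢ[ℝ] E :=
    { toFun := fun x => T (A g (T.symm x))
      invFun := fun x => T (A g⁻¹ (T.symm x))
      map_add' := fun x y => by simp
      map_smul' := fun c x => by simp
      left_inv := fun x => by simp [hAA, h1]
      right_inv := fun x => by simp [hAA, h1]
      norm_map' := fun x => by
        change ‖T (A g (T.symm x))‖ = ‖x‖
        rw [hiso, T.apply_symm_apply] }
  have hρ₀ : ∀ g x, ρ₀ g x = T (A g (T.symm x)) := fun g x => rfl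
  refine ⟨T, ⟨⟨ρ₀, ?_⟩, ?_⟩, fun g x => ?_⟩
  · ext1 x
    simp [hρ₀, h1]
  · intro g h
    ext1 x
    simp [hρ₀, ← hAA]
  · change ρ₀ g (T x) = _
    rw [hρ₀, T.symm_apply_apply]

end Isometry

section LocalAction

variable {EG : Type*} [NormedAddCommGroup EG] [NormedSpace ℝ EG]
  {HG : Type*} [TopologicalSpace HG] {I : ModelWithCorners ℝ EG HG}
  {G : Type*} [TopologicalSpace G] [CompactSpace G] [ChartedSpace HG G] [IsManifold I ∞ G]
  [Group G] [IsTopologicalGroup G]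
  {E : Type*} [NormedAddCommGroup E] [InnerProductSpace ℝ E] [FiniteDimensional ℝ E]

/-- Bochner's linearisation theorem for a local action of a compact group near a fixed point. -/
theorem exists_local_linearization {F : G × E → E} {O : Set (G × E)} (hO : IsOpen O)
    (hF : ContMDiffOn (I.prod 𝓘(ℝ, E)) 𝓘(ℝ, E) ∞ F O) {x₀ : E} (hO0 : ∀ g, (g, x₀) ∈ O)
    (hF0 : ∀ g, F (g, x₀) = x₀) (hF1 : ∀ x, (1, x) ∈ O → F (1, x) = x)
    (hFmul : ∀ g h x, (h, x) ∈ O → (g * h, x) ∈ O →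
      (g, F (h, x)) ∈ O ∧ F (g * h, x) = F (g, F (h, x))) :
    ∃ (Θ : OpenPartialHomeomorph E E) (ρ : G →* (E ≃ₗᵢ[ℝ] E)), x₀ ∈ Θ.source ∧ Θ x₀ = 0 ∧
      ContDiffOn ℝ ∞ Θ Θ.source ∧ ContDiffOn ℝ ∞ Θ.symm Θ.target ∧
      ∀ g, ∀ x ∈ Θ.source, F (g, x) ∈ Θ.source → Θ (F (g, x)) = ρ g (Θ x) := by
  have hF' := (ContMDiffOn.partialFDeriv hO hF).continuousOn
  have hd : ∀ g, HasFDerivAt (fun x => F (g, x)) (partialFDeriv F (g, x₀)) x₀ := fun g =>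
    (ContMDiffAt.differentiableAt_right (a := (g, x₀))
      (hF.contMDiffAt (hO.mem_nhds (hO0 g)))).hasFDerivAt
  have hev : ∀ g, ∀ᶠ x in 𝓝 x₀, (g, x) ∈ O := fun g =>
    (Continuous.prodMk_right g).continuousAt.preimage_mem_nhds (hO.mem_nhds (hO0 g))
  let A : C(G, E →L[ℝ] E) :=
    ⟨fun g => partialFDeriv F (g, x₀), hF'.comp_continuous (by fun_prop) hO0⟩
  have hA : ∀ g, A g = partialFDeriv F (g, x₀) := fun g => rfl
  have hA1 : A 1 = 1 := by
    refine (hd 1).unique ((hasFDerivAt_id x₀).congr_of_eventuallyEq ?_)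
    filter_upwards [hev 1] with x hx using hF1 x hx
  have hAmul : ∀ g h, A (g * h) = A g * A h := fun g h => by
    have h1 : HasFDerivAt (fun x => F (g, x)) (A g) (F (h, x₀)) := by
      rw [hF0]
      exact hd g
    refine (hd (g * h)).unique ((h1.comp x₀ (hd h)).congr_of_eventuallyEq ?_)
    filter_upwards [hev h, hev (g * h)] with x hx hx' using (hFmul g h x hx hx').2
  have hAA : ∀ g h x, A (g * h) x = A g (A h x) := fun g h x => by
    rw [hAmul]
    rfl
  let ι : C(G, G) := ⟨fun g => g⁻¹, continuous_inv⟩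
  have hx₀ : constFamily G x₀ ∈ superposeDomain ι O := fun g => hO0 _
  let U : Set E := constFamily G ⁻¹' superposeDomain ι O
  have hU : IsOpen U := (isOpen_superposeDomain ι hO).preimage (constFamily G).continuous
  -- The mean over `g` of `A g (F (g⁻¹, x) - x₀)`. It is smooth as a superposition operator followed
  -- by bounded linear maps, and its derivative at `x₀` is the mean of `A g * A g⁻¹ = 1`.
  let f : E → E := fun x =>
    groupMeanL G E (applyFamily A (superpose ι F (constFamily G x) - constFamily G x₀))
  have hf : ContDiffOn ℝ ∞ f U := by
    refine (groupMeanL G E).contDiff.comp_contDiffOn ((applyFamily A).contDiff.comp_contDiffOn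
      (ContDiffOn.sub ?_ contDiffOn_const))
    exact (contDiffOn_superpose hO hF).comp (constFamily (E := E) G).contDiff.contDiffOn fun x hx => hx
  have hfd : HasFDerivAt f (ContinuousLinearEquiv.refl ℝ E : E →L[ℝ] E) x₀ := by
    have h1 := ((groupMeanL G E).hasFDerivAt.comp x₀ ((applyFamily A).hasFDerivAt.comp x₀
      (((hasFDerivAt_superpose hO hF hx₀).comp x₀ (constFamily (E := E) G).hasFDerivAt).sub_const
        (constFamily G x₀))))
    refine h1.congr_fderiv ?_
    ext1 x
    have h2 : applyFamily A (applyFamily (superpose ι (partialFDeriv F) (constFamily G x₀))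
        (constFamily G x)) = ContinuousMap.const G x := by
      ext1 g
      rw [applyFamily_apply, applyFamily_apply, superpose_apply hF' hx₀]
      change A g (A g⁻¹ x) = x
      rw [← hAA, mul_inv_cancel, hA1]
      rfl
    change groupMean (applyFamily A (applyFamily (superpose ι (partialFDeriv F)
      (constFamily G x₀)) (constFamily G x))) = x
    rw [h2, groupMean_const]
  have hf0 : f x₀ = 0 := by
    have : superpose ι F (constFamily G x₀) = constFamily G x₀ := by
      ext1 g
      rw [superpose_apply hF.continuousOn hx₀]
      exact hF0 _
    simp only [f, this, sub_self, map_zero]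
  -- Substituting `h * g` for `g` pulls the factor `A h` out of the mean.
  have hfF : ∀ h x, x ∈ U → F (h, x) ∈ U → f (F (h, x)) = A h (f x) := fun h x hx hFx => by
    change groupMean _ = A h (groupMean _)
    rw [map_groupMean, ← groupMean_mul_left _ h]
    congr 1
    ext1 g
    have hx' : constFamily G x ∈ superposeDomain ι O := hx
    have hFx' : constFamily G (F (h, x)) ∈ superposeDomain ι O := hFx
    have e1 : superpose ι F (constFamily G (F (h, x))) (h * g) = F (g⁻¹, x) := by
      rw [superpose_apply hF.continuousOn hFx']
      have hh : (h, x) ∈ O := by simpa [ι] using hx h⁻¹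
      have hg : ((h * g)⁻¹ * h, x) ∈ O := by simpa [ι] using hx g
      have := (hFmul (h * g)⁻¹ h x hh hg).2
      rw [mul_inv_rev, inv_mul_cancel_right] at this
      change F ((h * g)⁻¹, F (h, x)) = _
      rw [mul_inv_rev, this]
    have e2 : superpose ι F (constFamily G x) g = F (g⁻¹, x) := by
      rw [superpose_apply hF.continuousOn hx']
      rfl
    change A (h * g) (superpose ι F (constFamily G (F (h, x))) (h * g) - x₀) =
      A h (A g (superpose ι F (constFamily G x) g - x₀))
    rw [e1, e2, hAA]
  obtain ⟨φ, h0φ, hφU, hφf, hφs⟩ := exists_openPartialHomeomorph_of_contDiffOn hU hf hx₀ _ hfd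
  obtain ⟨T, ρ, hρ⟩ := exists_isometric_representation A hA1 hAmul
  have hΘ : ∀ x, φ.transHomeomorph T.toHomeomorph x = T (f x) := fun x => by
    rw [← hφf]
    rfl
  refine ⟨φ.transHomeomorph T.toHomeomorph, ρ, h0φ, ?_, ?_, ?_, ?_⟩
  · rw [hΘ, hf0, map_zero]
  · exact ContDiffOn.congr (T.contDiff.comp_contDiffOn (hf.mono hφU)) fun x _ => hΘ x
  · exact hφs.comp T.symm.contDiff.contDiffOn fun x hx => hx
  · intro g x hx hFx
    rw [hΘ, hΘ, hρ, hfF g x (hφU hx) (hφU hFx)]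

end LocalAction

section Action

/-- A smooth action of a compact Lie group is orthogonal in suitable coordinates around a fixed
point. -/
theorem exists_linearizing_chart {n d : ℕ} {P : Type*} [TopologicalSpace P]
    [ChartedSpace (EuclideanSpace ℝ (Fin n)) P] [IsManifold (𝓡 n) ∞ P]
    {G : Type*} [TopologicalSpace G] [CompactSpace G]
    [ChartedSpace (EuclideanSpace ℝ (Fin d)) G] [Group G] [LieGroup (𝓡 d) ∞ G]
    [MulAction G P] [ContMDiffSMul (𝓡 d) (𝓡 n) ∞ G P] {p : P} (hfix : ∀ g : G, g • p = p) :
    ∃ (Φ : OpenPartialHomeomorph P (EuclideanSpace ℝ (Fin n)))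
      (ρ : G →* (EuclideanSpace ℝ (Fin n) ≃ₗᵢ[ℝ] EuclideanSpace ℝ (Fin n))),
      p ∈ Φ.source ∧ Φ p = 0 ∧ ContMDiffOn (𝓡 n) (𝓡 n) ∞ Φ Φ.source ∧
      ContMDiffOn (𝓡 n) (𝓡 n) ∞ Φ.symm Φ.target ∧
      ∀ g : G, ∀ q ∈ Φ.source, g • q ∈ Φ.source ∧ Φ (g • q) = ρ g (Φ q) := by
  have : IsTopologicalGroup G := topologicalGroup_of_lieGroup (𝓡 d) ∞
  have hsmul : ContMDiff ((𝓡 d).prod (𝓡 n)) (𝓡 n) ∞ (fun a : G × P => a.1 • a.2) :=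
    ContMDiffSMul.contMDiff_smul
  let ψ := chartAt (EuclideanSpace ℝ (Fin n)) p
  have hpψ : p ∈ ψ.source := mem_chart_source _ p
  let O₁ : Set (G × EuclideanSpace ℝ (Fin n)) := Set.univ ×ˢ ψ.target
  have hO₁ : IsOpen O₁ := isOpen_univ.prod ψ.open_target
  let a : G × EuclideanSpace ℝ (Fin n) → P := fun z => z.1 • ψ.symm z.2
  have ha : ContMDiffOn ((𝓡 d).prod (𝓡 n)) (𝓡 n) ∞ a O₁ :=
    hsmul.comp_contMDiffOn (contMDiffOn_fst.prodMk
      ((contMDiffOn_chart_symm (I := 𝓡 n) (x := p)).comp contMDiffOn_snd fun z hz => hz.2))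
  let O : Set (G × EuclideanSpace ℝ (Fin n)) := O₁ ∩ a ⁻¹' ψ.source
  have hO : IsOpen O := ha.continuousOn.isOpen_inter_preimage hO₁ ψ.open_source
  have hF : ContMDiffOn ((𝓡 d).prod (𝓡 n)) (𝓡 n) ∞ (ψ ∘ a) O :=
    (contMDiffOn_chart (I := 𝓡 n) (x := p)).comp (ha.mono Set.inter_subset_left)
      fun z hz => hz.2
  have ha0 : ∀ g, a (g, ψ p) = p := fun g => by
    simp only [a, ψ.left_inv hpψ, hfix]
  obtain ⟨Θ, ρ, h0, hΘ0, hΘ, hΘs, hequi⟩ := exists_local_linearization (I := 𝓡 d) hO hF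
    (x₀ := ψ p) (fun g => ⟨⟨trivial, ψ.map_source hpψ⟩, by
      change a (g, ψ p) ∈ ψ.source
      rwa [ha0]⟩)
    (fun g => congrArg ψ (ha0 g))
    (fun x hx => by
      change ψ ((1 : G) • ψ.symm x) = x
      rw [one_smul, ψ.right_inv hx.1.2])
    (fun g h x hx hx' => by
      have h1 : a (g, ψ (a (h, x))) = a (g * h, x) := by
        change g • ψ.symm (ψ (a (h, x))) = (g * h) • ψ.symm x
        rw [ψ.left_inv hx.2, mul_smul]
      refine ⟨⟨⟨trivial, ψ.map_source hx.2⟩, ?_⟩, congrArg ψ h1.symm⟩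
      change a (g, ψ (a (h, x))) ∈ ψ.source
      rw [h1]
      exact hx'.2)
  let Φ₀ := ψ.trans Θ
  have hpΦ₀ : p ∈ Φ₀.source := by
    rw [OpenPartialHomeomorph.trans_source]
    exact ⟨hpψ, h0⟩
  -- The largest invariant subset of the chart domain; it is open because the group is compact.
  let core : Set P := {q | ∀ g : G, g • q ∈ Φ₀.source}
  have hcore : IsOpen core := by
    rw [isOpen_iff_mem_nhds]
    intro q hq
    have h := isCompact_univ.eventually_forall_of_forall_eventually (x₀ := q)
      (K := Set.univ (α := G)) (P := fun (q : P) (g : G) => g • q ∈ Φ₀.source) (fun g _ => by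
        have hc : Continuous (fun z : P × G => z.2 • z.1) :=
          hsmul.continuous.comp (continuous_snd.prodMk continuous_fst)
        exact hc.continuousAt.preimage_mem_nhds (Φ₀.open_source.mem_nhds (hq g)))
    filter_upwards [h] with q' hq' g using hq' g trivial
  have hcore1 : ∀ q ∈ core, q ∈ Φ₀.source := fun q hq => by simpa using hq 1
  have hsrc : ∀ q ∈ Φ₀.source, q ∈ ψ.source ∧ ψ q ∈ Θ.source := fun q hq => by
    rwa [OpenPartialHomeomorph.trans_source] at hq
  refine ⟨Φ₀.restrOpen core hcore, ρ, ⟨hpΦ₀, fun g => by rwa [hfix]⟩, hΘ0, ?_, ?_, ?_⟩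
  · refine ContMDiffOn.mono ?_ (Set.inter_subset_left (s := Φ₀.source) (t := core))
    exact hΘ.contMDiffOn.comp ((contMDiffOn_chart (I := 𝓡 n) (x := p)).mono fun q hq =>
      (hsrc q hq).1) fun q hq => (hsrc q hq).2
  · have h1 : ContMDiffOn (𝓡 n) (𝓡 n) ∞ Φ₀.symm Φ₀.target := by
      refine (contMDiffOn_chart_symm (I := 𝓡 n) (x := p)).comp (hΘs.contMDiffOn.mono ?_) ?_
      · intro x hx
        rw [OpenPartialHomeomorph.trans_target] at hx
        exact hx.1
      · intro x hx
        rw [OpenPartialHomeomorph.trans_target] at hx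
        exact hx.2
    exact h1.mono Set.inter_subset_left
  · intro g q hq
    have hgq : g • q ∈ core := fun h => by
      rw [← mul_smul]
      exact hq.2 (h * g)
    refine ⟨⟨hcore1 _ hgq, hgq⟩, ?_⟩
    have h1 := hsrc q hq.1
    have h2 := hsrc _ (hcore1 _ hgq)
    have h3 : ψ (g • q) = (ψ ∘ a) (g, ψ q) := by
      change _ = ψ (g • ψ.symm (ψ q))
      rw [ψ.left_inv h1.1]
    change Θ (ψ (g • q)) = ρ g (Θ (ψ q))
    rw [h3]
    exact hequi g (ψ q) h1.2 (h3 ▸ h2.2)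

end Action

/-! ### The coordinate expression of a Poisson structure -/

section ChartTensor

variable {n : ℕ} {P : Type*} [TopologicalSpace P] [ChartedSpace (EuclideanSpace ℝ (Fin n)) P]

theorem differential_congr {f g : P → ℝ} {q : P} (h : f =ᶠ[𝓝 q] g) :
    differential n f q = differential n g q :=
  h.mfderiv_eq

theorem bracket_congr {π : ∀ q : P, Cot n q →ₗ[ℝ] Cot n q →ₗ[ℝ] ℝ} {f f' g g' : P → ℝ} {q : P}
    (hf : f =ᶠ[𝓝 q] f') (hg : g =ᶠ[𝓝 q] g') : bracket π f g =ᶠ[𝓝 q] bracket π f' g' := by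
  filter_upwards [hf.eventuallyEq_nhds, hg.eventuallyEq_nhds] with q' h1 h2
  rw [bracket, bracket, differential_congr h1, differential_congr h2]

variable [IsManifold (𝓡 n) ∞ P]

/-- A smooth function on a neighbourhood of a point agrees near this point with a globally smooth
function. -/
theorem exists_contMDiff_eventuallyEq [T2Space P] {f : P → ℝ} {U : Set P} (hU : IsOpen U)
    (hf : ContMDiffOn (𝓡 n) 𝓘(ℝ, ℝ) ∞ f U) {q : P} (hq : q ∈ U) :
    ∃ F : P → ℝ, ContMDiff (𝓡 n) 𝓘(ℝ, ℝ) ∞ F ∧ F =ᶠ[𝓝 q] f := by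
  obtain ⟨b, -, hb⟩ :=
    (SmoothBumpFunction.nhds_basis_tsupport (I := 𝓡 n) q).mem_iff.1 (hU.mem_nhds hq)
  refine ⟨fun x => b x * f x, contMDiff_of_tsupport fun x hx => ?_, ?_⟩
  · have hxU : x ∈ U := hb (closure_mono (Function.support_mul_subset_left _ _) hx)
    exact b.contMDiffAt.mul (hf.contMDiffAt (hU.mem_nhds hxU))
  · filter_upwards [b.eventuallyEq_one] with x hx
    simp [hx]

variable (Φ : OpenPartialHomeomorph P (EuclideanSpace ℝ (Fin n)))

/-- The differential of the linear coordinate function `⟪ξ, Φ⟫`. -/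
def coordCovector (q : P) (ξ : EuclideanSpace ℝ (Fin n)) : Cot n q :=
  differential n (fun q' => ⟪ξ, Φ q'⟫_ℝ) q

/-- The derivative of a chart, as a map to the model space. -/
def chartDeriv (q : P) : TangentSpace (𝓡 n) q →L[ℝ] EuclideanSpace ℝ (Fin n) :=
  mfderiv (𝓡 n) (𝓡 n) Φ q

variable {Φ} (hΦ : ContMDiffOn (𝓡 n) (𝓡 n) ∞ Φ Φ.source)
  (hΦs : ContMDiffOn (𝓡 n) (𝓡 n) ∞ Φ.symm Φ.target)
include hΦ

theorem mdifferentiableAt_chart {q : P} (hq : q ∈ Φ.source) :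
    MDifferentiableAt (𝓡 n) (𝓡 n) Φ q :=
  (hΦ.contMDiffAt (Φ.open_source.mem_nhds hq)).mdifferentiableAt (by simp)

theorem differential_comp_chart {h : EuclideanSpace ℝ (Fin n) → ℝ} {q : P} (hq : q ∈ Φ.source)
    (hh : DifferentiableAt ℝ h (Φ q)) (w : TangentSpace (𝓡 n) q) :
    differential n (fun q' => h (Φ q')) q w = fderiv ℝ h (Φ q) (chartDeriv Φ q w) := by
  have h1 : MDifferentiableAt (𝓡 n) 𝓘(ℝ, ℝ) h (Φ q) := hh.mdifferentiableAt
  have h2 := mfderiv_comp_apply q h1 (mdifferentiableAt_chart hΦ hq) w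
  rw [mfderiv_eq_fderiv] at h2
  exact h2

theorem coordCovector_apply {q : P} (hq : q ∈ Φ.source) (ξ : EuclideanSpace ℝ (Fin n))
    (w : TangentSpace (𝓡 n) q) :
    coordCovector Φ q ξ w = ⟪ξ, chartDeriv Φ q w⟫_ℝ := by
  have h1 : HasFDerivAt (fun x => ⟪ξ, x⟫_ℝ) (innerSL ℝ ξ) (Φ q) := (innerSL ℝ ξ).hasFDerivAt
  rw [coordCovector, differential_comp_chart hΦ hq h1.differentiableAt, h1.fderiv]
  rfl

theorem coordCovector_add {q : P} (hq : q ∈ Φ.source) (ξ η : EuclideanSpace ℝ (Fin n)) :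
    coordCovector Φ q (ξ + η) = coordCovector Φ q ξ + coordCovector Φ q η := by
  ext w
  simp only [add_apply, coordCovector_apply hΦ hq, inner_add_left]

theorem coordCovector_smul {q : P} (hq : q ∈ Φ.source) (c : ℝ) (ξ : EuclideanSpace ℝ (Fin n)) :
    coordCovector Φ q (c • ξ) = c • coordCovector Φ q ξ := by
  ext w
  simp only [smul_apply, coordCovector_apply hΦ hq, inner_smul_left, smul_eq_mul,
    conj_trivial]

theorem differential_comp_chart_eq {h : EuclideanSpace ℝ (Fin n) → ℝ} {q : P} (hq : q ∈ Φ.source)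
    (hh : DifferentiableAt ℝ h (Φ q)) {θ : EuclideanSpace ℝ (Fin n)}
    (hθ : ∀ w, fderiv ℝ h (Φ q) w = ⟪θ, w⟫_ℝ) :
    differential n (fun q' => h (Φ q')) q = coordCovector Φ q θ := by
  ext w
  rw [differential_comp_chart hΦ hq hh, hθ, coordCovector_apply hΦ hq]

theorem contMDiffOn_coord (ξ : EuclideanSpace ℝ (Fin n)) :
    ContMDiffOn (𝓡 n) 𝓘(ℝ, ℝ) ∞ (fun q => ⟪ξ, Φ q⟫_ℝ) Φ.source :=
  (innerSL ℝ ξ).contDiff.contMDiff.comp_contMDiffOn hΦ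

include hΦs in
theorem exists_eq_coordCovector {q : P} (hq : q ∈ Φ.source) (α : Cot n q) :
    ∃ ξ, α = coordCovector Φ q ξ := by
  have hd : Φ.MDifferentiable (𝓡 n) (𝓡 n) :=
    ⟨hΦ.mdifferentiableOn (by simp), hΦs.mdifferentiableOn (by simp)⟩
  let β : EuclideanSpace ℝ (Fin n) →L[ℝ] ℝ := α.comp (mfderiv (𝓡 n) (𝓡 n) Φ.symm (Φ q))
  refine ⟨(InnerProductSpace.toDual ℝ _).symm β, ?_⟩
  ext w
  rw [coordCovector_apply hΦ hq, InnerProductSpace.toDual_symm_apply]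
  have h1 := congrArg (fun T => T w) (hd.symm_comp_deriv hq)
  exact (congrArg α h1).symm

include hΦs in
theorem eq_of_coordCovector_eq {q : P} (hq : q ∈ Φ.source) {ξ : EuclideanSpace ℝ (Fin n)}
    (h : coordCovector Φ q ξ = 0) : ξ = 0 := by
  have hd : Φ.MDifferentiable (𝓡 n) (𝓡 n) :=
    ⟨hΦ.mdifferentiableOn (by simp), hΦs.mdifferentiableOn (by simp)⟩
  refine ext_inner_right ℝ fun w => ?_
  have h1 := congrArg (fun T => T w) (hd.comp_symm_deriv (Φ.map_source hq))
  rw [inner_zero_left]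
  have h2 : ⟪ξ, chartDeriv Φ (Φ.symm (Φ q))
    (mfderiv (𝓡 n) (𝓡 n) Φ.symm (Φ q) w)⟫_ℝ = ⟪ξ, w⟫_ℝ :=
      congrArg (fun u : EuclideanSpace ℝ (Fin n) => ⟪ξ, u⟫_ℝ) h1
  rw [Φ.left_inv hq] at h2
  rw [← h2]
  have h3 := coordCovector_apply hΦ hq ξ (mfderiv (𝓡 n) (𝓡 n) Φ.symm (Φ q) w)
  rw [h] at h3
  exact h3.symm

omit hΦ
variable (Po : PoissonStructure n P) (Φ)

/-- The anchor map of `Po` in the coordinates `Φ`. -/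
def chartTensor (v : EuclideanSpace ℝ (Fin n)) :
    EuclideanSpace ℝ (Fin n) →L[ℝ] EuclideanSpace ℝ (Fin n) :=
  ∑ i, ∑ j, Po.bivector (Φ.symm v) (coordCovector Φ _ (EuclideanSpace.basisFun _ ℝ i))
    (coordCovector Φ _ (EuclideanSpace.basisFun _ ℝ j)) •
      (innerSL ℝ (EuclideanSpace.basisFun _ ℝ i)).smulRight (EuclideanSpace.basisFun _ ℝ j)

variable {Φ}

include hΦ

theorem bivector_coordCovector {q : P} (hq : q ∈ Φ.source) (ξ η : EuclideanSpace ℝ (Fin n)) :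
    Po.bivector q (coordCovector Φ q ξ) (coordCovector Φ q η) =
      ⟪η, chartTensor Φ Po (Φ q) ξ⟫_ℝ := by
  let C : EuclideanSpace ℝ (Fin n) →ₗ[ℝ] Cot n q :=
    ⟨⟨coordCovector Φ q, coordCovector_add hΦ hq⟩, coordCovector_smul hΦ hq⟩
  have hC : ∀ ξ, C ξ = coordCovector Φ q ξ := fun ξ => rfl
  have hbasis : ∀ ξ, coordCovector Φ q ξ = ∑ i, ⟪EuclideanSpace.basisFun (Fin n) ℝ i, ξ⟫_ℝ •
      coordCovector Φ q (EuclideanSpace.basisFun (Fin n) ℝ i) := fun ξ => by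
    conv_lhs => rw [← hC, ← (EuclideanSpace.basisFun (Fin n) ℝ).sum_repr' ξ, map_sum]
    simp only [map_smul, ← hC]
  rw [chartTensor, Φ.left_inv hq]
  conv_lhs => rw [hbasis ξ, hbasis η]
  simp only [map_sum, LinearMap.sum_apply, map_smul, LinearMap.smul_apply,
    sum_apply, inner_sum, smul_apply, smul_eq_mul,
    ContinuousLinearMap.smulRight_apply, inner_smul_right, innerSL_apply_apply]
  simp only [Finset.mul_sum]
  rw [Finset.sum_comm]
  refine Finset.sum_congr rfl fun i _ => Finset.sum_congr rfl fun j _ => ?_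
  rw [real_inner_comm η]
  ring

omit hΦ

end ChartTensor

section ChartTensor

variable {n : ℕ} {P : Type*} [TopologicalSpace P] [ChartedSpace (EuclideanSpace ℝ (Fin n)) P]
  [IsManifold (𝓡 n) ∞ P]
  {Φ : OpenPartialHomeomorph P (EuclideanSpace ℝ (Fin n))}
  (hΦ : ContMDiffOn (𝓡 n) (𝓡 n) ∞ Φ Φ.source)
  (hΦs : ContMDiffOn (𝓡 n) (𝓡 n) ∞ Φ.symm Φ.target)
  (Po : PoissonStructure n P)

include hΦ

theorem bracket_coord {q : P} (hq : q ∈ Φ.source) (ξ η : EuclideanSpace ℝ (Fin n)) :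
    bracket Po.bivector (fun q => ⟪ξ, Φ q⟫_ℝ) (fun q => ⟪η, Φ q⟫_ℝ) q =
      ⟪η, chartTensor Φ Po (Φ q) ξ⟫_ℝ :=
  bivector_coordCovector hΦ Po hq ξ η

theorem contMDiffOn_bracket_coord [T2Space P] (ξ η : EuclideanSpace ℝ (Fin n)) :
    ContMDiffOn (𝓡 n) 𝓘(ℝ, ℝ) ∞
      (bracket Po.bivector (fun q => ⟪ξ, Φ q⟫_ℝ) (fun q => ⟪η, Φ q⟫_ℝ)) Φ.source := by
  intro q hq
  obtain ⟨F, hF, hFξ⟩ :=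
    exists_contMDiff_eventuallyEq Φ.open_source (contMDiffOn_coord hΦ ξ) hq
  obtain ⟨H, hH, hHη⟩ :=
    exists_contMDiff_eventuallyEq Φ.open_source (contMDiffOn_coord hΦ η) hq
  exact ((Po.smooth F H hF hH).contMDiffAt.congr_of_eventuallyEq
    (bracket_congr hFξ hHη).symm).contMDiffWithinAt

include hΦs in
theorem contDiffOn_chartTensor [T2Space P] : ContDiffOn ℝ ∞ (chartTensor Φ Po) Φ.target := by
  refine ContDiffOn.sum fun i _ => ContDiffOn.sum fun j _ => ?_
  have h := (contMDiffOn_bracket_coord hΦ Po (EuclideanSpace.basisFun (Fin n) ℝ i)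
    (EuclideanSpace.basisFun (Fin n) ℝ j)).comp hΦs fun v hv => Φ.map_target hv
  exact h.contDiffOn.smul contDiffOn_const

theorem chartTensor_antisymm {v : EuclideanSpace ℝ (Fin n)} (hv : v ∈ Φ.target)
    (ξ η : EuclideanSpace ℝ (Fin n)) :
    ⟪η, chartTensor Φ Po v ξ⟫_ℝ = -⟪ξ, chartTensor Φ Po v η⟫_ℝ := by
  have h := bivector_coordCovector hΦ Po (Φ.map_target hv)
  simp only [Φ.right_inv hv] at h
  rw [← h, ← h]
  exact Po.bivector_antisymm _ _ _

include hΦs in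
/-- A Poisson structure is expressed by a Poisson tensor in every chart. -/
theorem isPoissonTensor_chartTensor [T2Space P] :
    IsPoissonTensor (chartTensor Φ Po) Φ.target where
  isOpen := Φ.open_target
  smooth := contDiffOn_chartTensor hΦ hΦs Po
  skew := fun v hv => by
    ext1 ξ
    refine ext_inner_left ℝ fun η => ?_
    rw [inner_star_right, neg_apply, inner_neg_right, real_inner_comm]
    exact chartTensor_antisymm hΦ Po hv η ξ
  jacobi := fun v hv ξ η ζ => by
    set B := chartTensor Φ Po with hB
    set q := Φ.symm v with hq
    have hqs : q ∈ Φ.source := Φ.map_target hv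
    have hqv : Φ q = v := Φ.right_inv hv
    have hBd : HasFDerivAt B (fderiv ℝ B v) v :=
      (((contDiffOn_chartTensor hΦ hΦs Po).contDiffAt
        (Φ.open_target.mem_nhds hv)).differentiableAt (by simp)).hasFDerivAt
    have hnear : ∀ η ζ, bracket Po.bivector (fun q => ⟪η, Φ q⟫_ℝ) (fun q => ⟪ζ, Φ q⟫_ℝ) =ᶠ[𝓝 q]
        fun q' => ⟪ζ, B (Φ q') η⟫_ℝ := fun η ζ => by
      filter_upwards [Φ.open_source.mem_nhds hqs] with q' hq'
      exact bracket_coord hΦ Po hq' η ζ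
    have hdiff : ∀ η ζ θ : EuclideanSpace ℝ (Fin n), (∀ w, ⟪ζ, fderiv ℝ B v w η⟫_ℝ = ⟪θ, w⟫_ℝ) →
        differential n (fun q' => ⟪ζ, B (Φ q') η⟫_ℝ) q = coordCovector Φ q θ := fun η ζ θ hθ => by
      have hd : HasFDerivAt (fun x => ⟪ζ, B x η⟫_ℝ)
          (((innerSL ℝ ζ).comp (ContinuousLinearMap.apply ℝ _ η)).comp (fderiv ℝ B v)) (Φ q) := by
        rw [hqv]
        exact ((innerSL ℝ ζ).comp (ContinuousLinearMap.apply ℝ _ η)).hasFDerivAt.comp v hBd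
      refine differential_comp_chart_eq hΦ (h := fun x => ⟪ζ, B x η⟫_ℝ) hqs hd.differentiableAt
        fun w => ?_
      rw [hd.fderiv]
      exact hθ w
    -- A bracket of linear coordinates is a matrix entry of `B`, and bracketing once more with `ξ`
    -- differentiates it along the Hamiltonian direction `B v ξ`.
    have hdouble : ∀ ξ η ζ, bracket Po.bivector (fun q => ⟪ξ, Φ q⟫_ℝ)
        (bracket Po.bivector (fun q => ⟪η, Φ q⟫_ℝ) (fun q => ⟪ζ, Φ q⟫_ℝ)) q =
        ⟪ζ, fderiv ℝ B v (B v ξ) η⟫_ℝ := fun ξ η ζ => by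
      let β : EuclideanSpace ℝ (Fin n) →L[ℝ] ℝ :=
        ((innerSL ℝ ζ).comp (ContinuousLinearMap.apply ℝ _ η)).comp (fderiv ℝ B v)
      have hβ : ∀ w, ⟪ζ, fderiv ℝ B v w η⟫_ℝ = ⟪(InnerProductSpace.toDual ℝ _).symm β, w⟫_ℝ :=
        fun w => by
          rw [InnerProductSpace.toDual_symm_apply]
          rfl
      rw [(bracket_congr Filter.EventuallyEq.rfl (hnear η ζ)).eq_of_nhds, bracket,
        hdiff η ζ _ hβ, hβ]
      have h := bivector_coordCovector hΦ Po hqs ξ ((InnerProductSpace.toDual ℝ _).symm β)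
      rw [hqv] at h
      exact h
    -- Coordinates are smooth only on the chart domain, while the Jacobi identity concerns global
    -- functions. Brackets depend on germs, so global extensions of the germs suffice.
    obtain ⟨f, hf, hfξ⟩ :=
      exists_contMDiff_eventuallyEq Φ.open_source (contMDiffOn_coord hΦ ξ) hqs
    obtain ⟨g, hg, hgη⟩ :=
      exists_contMDiff_eventuallyEq Φ.open_source (contMDiffOn_coord hΦ η) hqs
    obtain ⟨h, hh, hhζ⟩ :=
      exists_contMDiff_eventuallyEq Φ.open_source (contMDiffOn_coord hΦ ζ) hqs
    have hJ := Po.jacobi f g h hf hg hh q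
    rwa [(bracket_congr hfξ (bracket_congr hgη hhζ)).eq_of_nhds,
      (bracket_congr hgη (bracket_congr hhζ hfξ)).eq_of_nhds,
      (bracket_congr hhζ (bracket_congr hfξ hgη)).eq_of_nhds, hdouble, hdouble, hdouble] at hJ

include hΦs in
-- The bivector and the coordinate tensor correspond under the isomorphism `C` of covectors and the
-- injective evaluation map `J`, neither of which changes the rank.
theorem rankAt_eq_finrank_chartTensor {q : P} (hq : q ∈ Φ.source) :
    Po.rankAt q = Module.finrank ℝ (LinearMap.range (chartTensor Φ Po (Φ q)).toLinearMap) := by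
  let C₀ : EuclideanSpace ℝ (Fin n) →ₗ[ℝ] Cot n q :=
    ⟨⟨coordCovector Φ q, coordCovector_add hΦ hq⟩, coordCovector_smul hΦ hq⟩
  let C : EuclideanSpace ℝ (Fin n) ≃ₗ[ℝ] Cot n q := LinearEquiv.ofBijective C₀
    ⟨(injective_iff_map_eq_zero C₀).2 fun ξ hξ => eq_of_coordCovector_eq hΦ hΦs hq hξ,
      fun α => by
        obtain ⟨ξ, hξ⟩ := exists_eq_coordCovector hΦ hΦs hq α
        exact ⟨ξ, hξ.symm⟩⟩
  let J : EuclideanSpace ℝ (Fin n) →ₗ[ℝ] Cot n q →ₗ[ℝ] ℝ :=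
    LinearMap.mk₂ ℝ (fun w α => ⟪C.symm α, w⟫_ℝ) (fun _ _ _ => inner_add_right _ _ _)
      (fun _ _ _ => inner_smul_right _ _ _)
      (fun _ _ _ => by rw [map_add, inner_add_left])
      (fun _ _ _ => by rw [map_smul, inner_smul_left]; rfl)
  have hJ : Function.Injective J := by
    rw [injective_iff_map_eq_zero]
    intro w hw
    refine ext_inner_left ℝ fun u => ?_
    have h1 : J w (C u) = 0 := by rw [hw]; rfl
    have h2 : J w (C u) = ⟪u, w⟫_ℝ := by
      change ⟪C.symm (C u), w⟫_ℝ = _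
      rw [C.symm_apply_apply]
    rw [← h2, h1, inner_zero_right]
  have h : (Po.bivector q).comp C.toLinearMap = J.comp (chartTensor Φ Po (Φ q)).toLinearMap := by
    ext1 ξ
    refine LinearMap.ext fun α => ?_
    obtain ⟨η, rfl⟩ := C.surjective α
    change Po.bivector q (coordCovector Φ q ξ) (coordCovector Φ q η) =
      ⟪C.symm (C η), chartTensor Φ Po (Φ q) ξ⟫_ℝ
    rw [C.symm_apply_apply, bivector_coordCovector hΦ Po hq]
  rw [PoissonStructure.rankAt, ← LinearEquiv.range_comp C, h, LinearMap.range_comp]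
  exact (Submodule.equivMapOfInjective J hJ _).finrank_eq.symm

/-- The coordinate expression of a Poisson structure is equivariant under the isometries that
represent its symmetries. -/
theorem chartTensor_map {u : P → P} (hu : ContMDiff (𝓡 n) (𝓡 n) ∞ u) (hPo : Po.PreservedBy u)
    (g : EuclideanSpace ℝ (Fin n) ≃ₗᵢ[ℝ] EuclideanSpace ℝ (Fin n))
    (hg : ∀ q ∈ Φ.source, u q ∈ Φ.source ∧ Φ (u q) = g (Φ q)) {v : EuclideanSpace ℝ (Fin n)}
    (hv : v ∈ Φ.target) (w : EuclideanSpace ℝ (Fin n)) :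
    chartTensor Φ Po (g v) (g w) = g (chartTensor Φ Po v w) := by
  set q := Φ.symm v with hq
  have hqs : q ∈ Φ.source := Φ.map_target hv
  have hqv : Φ q = v := Φ.right_inv hv
  have huq := hg q hqs
  -- In the chart `u` is the isometry `g`, so the pullback of the linear coordinate of `g ξ` is that
  -- of `ξ`.
  have hcov : ∀ ξ, (coordCovector Φ (u q) (g ξ)).comp (mfderiv (𝓡 n) (𝓡 n) u q) =
      coordCovector Φ q ξ := fun ξ => by
    have h1 : MDifferentiableAt (𝓡 n) 𝓘(ℝ, ℝ) (fun q => ⟪g ξ, Φ q⟫_ℝ) (u q) :=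
      ((contMDiffOn_coord hΦ (g ξ)).contMDiffAt
        (Φ.open_source.mem_nhds huq.1)).mdifferentiableAt (by simp)
    have h2 := mfderiv_comp q h1 (hu.contMDiffAt.mdifferentiableAt (by simp))
    refine h2.symm.trans (Filter.EventuallyEq.mfderiv_eq ?_)
    filter_upwards [Φ.open_source.mem_nhds hqs] with q' hq'
    change ⟪g ξ, Φ (u q')⟫_ℝ = ⟪ξ, Φ q'⟫_ℝ
    rw [(hg q' hq').2, g.inner_map_map]
  refine ext_inner_left ℝ fun η => ?_
  obtain ⟨η, rfl⟩ := g.surjective η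
  have h1 := bivector_coordCovector hΦ Po huq.1 (g w) (g η)
  rw [huq.2, hqv] at h1
  have h2 := bivector_coordCovector hΦ Po hqs w η
  rw [hqv] at h2
  rw [← h1, g.inner_map_map, ← h2, hPo, hcov, hcov]

end ChartTensor

/-! ### The equivariant splitting

The coordinates are a linearising chart of the action, followed by the inverse of the time-one map
of an equivariant Moser flow and by linear Darboux coordinates. Averaging over the group and the
Moser flow use explicit smooth data only, so tameness of the Poisson structure is not needed. -/

section Splitting

theorem inner_compression_eq_sum {E : Type*} [NormedAddCommGroup E] [InnerProductSpace ℝ E]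
    [FiniteDimensional ℝ E] {ι : Type*} [Fintype ι] {Q M : E →L[ℝ] E} (hQ : star Q = Q) {z : ι → E}
    (hz : ∀ x, Q x = ∑ j, ⟪x, z j⟫_ℝ • z j) (hQz : ∀ j, Q (z j) = z j) (a b : E) :
    ⟪b, (Q * M * Q) a⟫_ℝ =
      ∑ i, ∑ j, ⟪z j, (Q * M * Q) (z i)⟫_ℝ * (⟪a, z i⟫_ℝ * ⟪b, z j⟫_ℝ) := by
  have h : ∀ x y, ⟪y, (Q * M * Q) x⟫_ℝ = ⟪Q y, M (Q x)⟫_ℝ := fun x y => by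
    conv_rhs => rw [← hQ, inner_star_left, hQ]
    rfl
  simp only [h, hQz]
  rw [hz a, hz b]
  simp only [map_sum, map_smul, inner_sum, sum_inner, inner_smul_left, inner_smul_right,
    conj_trivial, Finset.mul_sum]
  refine Finset.sum_congr rfl fun i _ => Finset.sum_congr rfl fun j _ => ?_
  ring

variable {n : ℕ} {P : Type*} [TopologicalSpace P] [ChartedSpace (EuclideanSpace ℝ (Fin n)) P]

theorem wedge_apply {q : P} (v w : TangentSpace (𝓡 n) q) (α β : Cot n q) :
    wedge v w α β = α v * β w - α w * β v := rfl

variable {k m : ℕ} (Φ : OpenPartialHomeomorph P (EuclideanSpace ℝ (Fin n)))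
  (Ψ : OpenPartialHomeomorph (EuclideanSpace ℝ (Fin n)) (EuclideanSpace ℝ (Fin n)))
  (Λ : CoordSpace k m ≃L[ℝ] EuclideanSpace ℝ (Fin n))

/-- The chart `Φ` in the curvilinear coordinates given by the inverse of `Ψ ∘ Λ`. -/
def splitChart : OpenPartialHomeomorph P (CoordSpace k m) :=
  (Φ.trans Ψ.symm).transHomeomorph Λ.symm.toHomeomorph

theorem mem_splitChart_source {q : P} :
    q ∈ (splitChart Φ Ψ Λ).source ↔ q ∈ Φ.source ∧ Φ q ∈ Ψ.target := by
  change q ∈ (Φ.trans Ψ.symm).source ↔ _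
  rw [OpenPartialHomeomorph.trans_source]
  rfl

theorem mem_splitChart_target {c : CoordSpace k m} :
    c ∈ (splitChart Φ Ψ Λ).target ↔ Λ c ∈ Ψ.source ∧ Ψ (Λ c) ∈ Φ.target := by
  change Λ c ∈ (Φ.trans Ψ.symm).target ↔ _
  rw [OpenPartialHomeomorph.trans_target]
  rfl

variable [IsManifold (𝓡 n) ∞ P] {Φ Ψ}
  (hΦ : ContMDiffOn (𝓡 n) (𝓡 n) ∞ Φ Φ.source)
  (hΦs : ContMDiffOn (𝓡 n) (𝓡 n) ∞ Φ.symm Φ.target) (hΨ : ContDiffOn ℝ ∞ Ψ Ψ.source)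

include hΦ hΦs hΨ in
theorem isSmoothChart_splitChart (hΨs : ContDiffOn ℝ ∞ Ψ.symm Ψ.target) :
    IsSmoothChart (n := n) (splitChart Φ Ψ Λ) := by
  constructor
  · have h1 : ContMDiffOn (𝓡 n) (𝓡 n) ∞ (fun q => Ψ.symm (Φ q)) (splitChart Φ Ψ Λ).source :=
      hΨs.contMDiffOn.comp (hΦ.mono fun q hq => ((mem_splitChart_source Φ Ψ Λ).1 hq).1)
        fun q hq => ((mem_splitChart_source Φ Ψ Λ).1 hq).2
    exact Λ.symm.contDiff.contMDiff.comp_contMDiffOn h1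
  · have h1 : ContMDiffOn 𝓘(ℝ, CoordSpace k m) (𝓡 n) ∞ (fun c => Ψ (Λ c))
        (splitChart Φ Ψ Λ).target :=
      hΨ.contMDiffOn.comp Λ.contDiff.contMDiff.contMDiffOn
        fun c hc => ((mem_splitChart_target Φ Ψ Λ).1 hc).1
    exact hΦs.comp h1 fun c hc => ((mem_splitChart_target Φ Ψ Λ).1 hc).2

include hΦ hΦs hΨ in
-- Near the image of `q` one has `Φ ∘ φ⁻¹ = Ψ ∘ Λ` for the split chart `φ`; the chain rule does the
-- rest.
theorem chartDeriv_coordVec {q : P} (hq : q ∈ (splitChart Φ Ψ Λ).source) (e : CoordSpace k m) :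
    chartDeriv Φ q (coordVec (splitChart Φ Ψ Λ) e q) =
      fderiv ℝ Ψ (Ψ.symm (Φ q)) (Λ e) := by
  set φ := splitChart Φ Ψ Λ with hφ
  set c := φ q with hc
  have hct : c ∈ φ.target := φ.map_source hq
  have hcq : φ.symm c = q := φ.left_inv hq
  have hct' := (mem_splitChart_target Φ Ψ Λ).1 hct
  have hqs := (mem_splitChart_source Φ Ψ Λ).1 hq
  have hΛc : Λ c = Ψ.symm (Φ q) := Λ.apply_symm_apply _
  have hΨd : HasFDerivAt Ψ (fderiv ℝ Ψ (Ψ.symm (Φ q))) (Λ c) := by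
    rw [← hΛc]
    exact ((hΨ.contDiffAt (Ψ.open_source.mem_nhds hct'.1)).differentiableAt (by simp)).hasFDerivAt
  have hcomp : HasFDerivAt (fun c => Ψ (Λ c)) ((fderiv ℝ Ψ (Ψ.symm (Φ q))).comp
      (Λ : CoordSpace k m →L[ℝ] EuclideanSpace ℝ (Fin n))) c := hΨd.comp c Λ.hasFDerivAt
  have hev : (Φ ∘ φ.symm) =ᶠ[𝓝 c] fun c => Ψ (Λ c) := by
    filter_upwards [φ.open_target.mem_nhds hct] with c' hc'
    exact Φ.right_inv ((mem_splitChart_target Φ Ψ Λ).1 hc').2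
  have h1 : HasMFDerivAt 𝓘(ℝ, CoordSpace k m) (𝓡 n) (Φ ∘ φ.symm) c
      ((fderiv ℝ Ψ (Ψ.symm (Φ q))).comp
        (Λ : CoordSpace k m →L[ℝ] EuclideanSpace ℝ (Fin n))) :=
    (hcomp.congr_of_eventuallyEq hev).hasMFDerivAt
  have h2 : MDifferentiableAt 𝓘(ℝ, CoordSpace k m) (𝓡 n) φ.symm c := by
    have h3 : ContMDiffOn 𝓘(ℝ, CoordSpace k m) (𝓡 n) ∞ (fun c => Ψ (Λ c)) φ.target :=
      hΨ.contMDiffOn.comp Λ.contDiff.contMDiff.contMDiffOn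
        fun c hc => ((mem_splitChart_target Φ Ψ Λ).1 hc).1
    have h4 : ContMDiffOn 𝓘(ℝ, CoordSpace k m) (𝓡 n) ∞ φ.symm φ.target :=
      hΦs.comp h3 fun c hc => ((mem_splitChart_target Φ Ψ Λ).1 hc).2
    exact (h4.contMDiffAt (φ.open_target.mem_nhds hct)).mdifferentiableAt (by simp)
  have h3 := mfderiv_comp_apply_of_eq c (mdifferentiableAt_chart hΦ hqs.1) h2 hcq e
  rw [h1.mfderiv] at h3
  exact h3.symm

end Splitting

end PoissonSplitting

end

/-! ### Assembly of the equivariant splitting coordinates -/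

open PoissonSplitting in
theorem theorem1p1 {n d : ℕ}
    {P : Type*} [TopologicalSpace P] [T2Space P] [ChartedSpace (EuclideanSpace ℝ (Fin n)) P]
    [IsManifold (𝓡 n) ∞ P]
    {G : Type*} [TopologicalSpace G] [T2Space G] [CompactSpace G]
    [ChartedSpace (EuclideanSpace ℝ (Fin d)) G] [Group G] [LieGroup (𝓡 d) ∞ G]
    [MulAction G P] [ContMDiffSMul (𝓡 d) (𝓡 n) ∞ G P]
    (Po : PoissonStructure n P) (p : P) (k : ℕ) (hk : 2 * k = Po.rankAt p)
    (hpres : ∀ g : G, Po.PreservedBy (fun q => g • q)) (hfix : ∀ g : G, g • p = p)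
    (htame : Po.TameAt p) :
    ∃ (φ : OpenPartialHomeomorph P (CoordSpace k (n - 2 * k)))
      (f : Fin (n - 2 * k) → Fin (n - 2 * k) → (Fin (n - 2 * k) → ℝ) → ℝ)
      (ρ : G →* (CoordSpace k (n - 2 * k) →ₗ[ℝ] CoordSpace k (n - 2 * k))),
      IsSmoothChart (n := n) φ ∧ p ∈ φ.source ∧ φ p = 0 ∧
      -- the coefficients are smooth functions of `z`, vanishing at the origin
      (∀ i j, ContDiffOn ℝ ∞ (f i j) ((fun q => (φ q).2.2) '' φ.source) ∧ f i j 0 = 0) ∧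
      -- the splitting of the Poisson structure
      (∀ q ∈ φ.source, Po.bivector q =
        ∑ i : Fin k, wedge (coordVec φ (basisX _ i) q) (coordVec φ (basisY _ i) q)
        + ∑ i, ∑ j, f i j (φ q).2.2 •
            wedge (coordVec φ (basisZ k i) q) (coordVec φ (basisZ k j) q)) ∧
      -- the action is linear in the coordinates and preserves both subspaces
      (∀ g : G, ∀ q ∈ φ.source, g • q ∈ φ.source ∧ φ (g • q) = ρ g (φ q)) ∧
      (∀ g : G, (subspaceXYZero k (n - 2 * k)).map (ρ g) = subspaceXYZero k (n - 2 * k) ∧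
        (subspaceZZero k (n - 2 * k)).map (ρ g) = subspaceZZero k (n - 2 * k)) := by
  let E := EuclideanSpace ℝ (Fin n)
  have hsmul : ContMDiff ((𝓡 d).prod (𝓡 n)) (𝓡 n) ∞ (fun a : G × P => a.1 • a.2) :=
    ContMDiffSMul.contMDiff_smul
  have hu : ∀ g : G, ContMDiff (𝓡 n) (𝓡 n) ∞ (fun q : P => g • q) := fun g =>
    hsmul.comp (contMDiff_const.prodMk contMDiff_id)
  obtain ⟨Φ, ρ, hpΦ, hΦp, hΦ, hΦs, hequi⟩ := exists_linearizing_chart (n := n) (d := d) hfix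
  set B := chartTensor Φ Po with hBdef
  have hB : IsPoissonTensor B Φ.target := isPoissonTensor_chartTensor hΦ hΦs Po
  have h0 : (0 : E) ∈ Φ.target := hΦp ▸ Φ.map_source hpΦ
  have hskew0 : star (B 0) = -B 0 := hB.skew 0 h0
  have hBρ : ∀ g : G, ∀ v ∈ Φ.target, ρ g v ∈ Φ.target ∧ ∀ w, B (ρ g v) (ρ g w) = ρ g (B v w) :=
    fun g v hv => by
      refine ⟨?_, chartTensor_map hΦ Po (hu g) (hpres g) (ρ g) (hequi g) hv⟩
      have h1 := hequi g _ (Φ.map_target hv)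
      rw [Φ.right_inv hv] at h1
      exact h1.2 ▸ Φ.map_source h1.1
  obtain ⟨Pr, W, hPW, hPB, hBP, hBW, hWB⟩ := exists_isGaugePair hskew0
  have hrank : 2 * k = Module.finrank ℝ (LinearMap.range (B 0).toLinearMap) := by
    rw [hk, rankAt_eq_finrank_chartTensor hΦ hΦs Po hpΦ, hΦp]
  obtain ⟨Λ, hΛB, hΛP, hΛz⟩ := exists_darboux_coordinates hskew0 hPW.star_P hPW.PP hPB hBW
    (n := n) finrank_euclideanSpace_fin hrank
  obtain ⟨Ψ, r, hr, hΨr, hΨD, hΨ0, hΨ, hΨs, hsplit, hΨρ⟩ :=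
    hB.exists_splitting h0 hPW hPB hBP hBW hWB
  have hΨsrc : ∀ y ∈ Ψ.target, Ψ.symm y ∈ Metric.ball (0 : E) r := fun y hy =>
    hΨr ▸ Ψ.map_target hy
  have hρΨ : ∀ g : G, ∀ y ∈ Ψ.target, ρ g y ∈ Ψ.target ∧ Ψ.symm (ρ g y) = ρ g (Ψ.symm y) :=
    fun g y hy => by
      have hx := hΨsrc y hy
      have hgx : ρ g (Ψ.symm y) ∈ Ψ.source := by
        rw [hΨr]
        simpa using hx
      have h1 : ρ g y = Ψ (ρ g (Ψ.symm y)) := by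
        rw [hΨρ (ρ g) (hBρ g) _ hx, Ψ.right_inv hy]
      rw [h1]
      exact ⟨Ψ.map_source hgx, Ψ.left_inv hgx⟩
  have hPρ : ∀ g : G, ∀ x, ρ g (Pr x) = Pr (ρ g x) := fun g x => by
    have hcomm : ((ρ g).toContinuousLinearEquiv : E →L[ℝ] E) * B 0 =
        B 0 * ((ρ g).toContinuousLinearEquiv : E →L[ℝ] E) := by
      ext1 w
      have := (hBρ g 0 h0).2 w
      rw [map_zero] at this
      exact this.symm
    exact congrArg (fun T : E →L[ℝ] E => T x) (hPW.commute_proj hskew0 hPB hBW hcomm)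
  let φ : OpenPartialHomeomorph P (CoordSpace k (n - 2 * k)) := splitChart Φ Ψ Λ
  let incl : (Fin (n - 2 * k) → ℝ) →L[ℝ] E :=
    (Λ : CoordSpace k (n - 2 * k) →L[ℝ] E).comp
      ((ContinuousLinearMap.inr ℝ _ _).comp (ContinuousLinearMap.inr ℝ _ _))
  have hincl : ∀ z, incl z = Λ (0, 0, z) := fun z => rfl
  have hinclφ : ∀ q, incl (φ q).2.2 = Ψ.symm (Φ q) - Pr (Ψ.symm (Φ q)) := fun q => by
    have h1 : Λ (φ q) = Ψ.symm (Φ q) := Λ.apply_symm_apply _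
    rw [← h1, hΛP, ← map_sub, hincl]
    congr 1
    ext <;> simp
  -- The factor `2⁻¹` accounts for the sum over all ordered pairs, in which every wedge occurs
  -- twice.
  let f (i j : Fin (n - 2 * k)) (z : Fin (n - 2 * k) → ℝ) : ℝ :=
    2⁻¹ * inner ℝ (Λ (basisZ k j)) (transversePart Pr W B (incl z) (Λ (basisZ k i)))
  let ρ' : G →* (CoordSpace k (n - 2 * k) →ₗ[ℝ] CoordSpace k (n - 2 * k)) :=
    { toFun := fun g => Λ.symm.toLinearMap ∘ₗ (ρ g).toLinearEquiv.toLinearMap ∘ₗ Λ.toLinearMap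
      map_one' := LinearMap.ext fun c => by simp
      map_mul' := fun g h => LinearMap.ext fun c => by simp }
  have hρ' : ∀ g c, ρ' g c = Λ.symm (ρ g (Λ c)) := fun g c => rfl
  -- Inclusion for all group elements gives equality, since `ρ' g⁻¹` inverts `ρ' g`.
  have hmap : ∀ (S : Submodule ℝ (CoordSpace k (n - 2 * k))), (∀ g c, c ∈ S → ρ' g c ∈ S) →
      ∀ g, S.map (ρ' g) = S := fun S hS g => by
    refine le_antisymm ?_ fun c hc => ⟨ρ' g⁻¹ c, hS _ _ hc, ?_⟩
    · rintro _ ⟨c, hc, rfl⟩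
      exact hS g c hc
    · rw [← Module.End.mul_apply, ← map_mul, mul_inv_cancel, map_one, Module.End.one_apply]
  -- In these coordinates `{x = y = 0}` is the kernel of `Pr` and `{z = 0}` its image; both are
  -- invariant because `ρ g` commutes with `Pr`.
  have hPΛ : ∀ c : CoordSpace k (n - 2 * k), (Λ.symm (Pr (Λ c))) = (c.1, c.2.1, 0) := fun c => by
    rw [hΛP, Λ.symm_apply_apply]
  have hPρ' : ∀ g c, Pr (Λ (ρ' g c)) = ρ g (Pr (Λ c)) := fun g c => by
    rw [hρ', Λ.apply_symm_apply, hPρ]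
  refine ⟨φ, f, ρ', isSmoothChart_splitChart Λ hΦ hΦs hΨ hΨs, ?_, ?_, fun i j => ⟨?_, ?_⟩, ?_, ?_,
    fun g => ⟨hmap _ ?_ g, hmap _ ?_ g⟩⟩
  · have h1 : Ψ 0 ∈ Ψ.target := Ψ.map_source (by rw [hΨr]; exact Metric.mem_ball_self hr)
    exact (mem_splitChart_source Φ Ψ Λ).2 ⟨hpΦ, by rwa [hΦp, ← hΨ0]⟩
  · have h1 : Ψ.symm 0 = 0 := by
      have := Ψ.left_inv (x := 0) (by rw [hΨr]; exact Metric.mem_ball_self hr)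
      rwa [hΨ0] at this
    change Λ.symm (Ψ.symm (Φ p)) = 0
    rw [hΦp, h1, map_zero]
  · rintro _ ⟨q, hq, rfl⟩
    have hx := hΨsrc _ ((mem_splitChart_source Φ Ψ Λ).1 hq).2
    have h1 : ContDiffAt ℝ ∞ (transversePart Pr W B) (incl (φ q).2.2) :=
      contDiffAt_transversePart hB (by rw [hinclφ]; exact (hsplit _ hx).1)
    have h2 : ContDiffAt ℝ ∞ (fun z => transversePart Pr W B (incl z)) (φ q).2.2 :=
      ContDiffAt.comp _ h1 incl.contDiff.contDiffAt
    exact (contDiffAt_const.mul (contDiffAt_const.inner ℝ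
      (h2.clm_apply contDiffAt_const))).contDiffWithinAt
  · have h1 : transversePart Pr W B 0 = 0 := by
      rw [transversePart, ← mul_assoc, sub_mul, hPB, one_mul, sub_self, zero_mul, zero_mul]
    simp [f, h1]
  · intro q hq
    have hqs := (mem_splitChart_source Φ Ψ Λ).1 hq
    set x := Ψ.symm (Φ q) with hx
    have hxr := hΨsrc _ hqs.2
    set J := fderiv ℝ Ψ x with hJ
    have hΨx : Ψ x = Φ q := Ψ.right_inv hqs.2
    set T := transversePart Pr W B (x - Pr x) with hT
    have hBq : B (Φ q) = J * (B 0 + T) * star J := by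
      rw [← hΨx]
      exact (hsplit x hxr).2
    have hcoord : ∀ ξ e, coordCovector Φ q ξ (coordVec φ e q) = inner ℝ (star J ξ) (Λ e) :=
      fun ξ e => by
        rw [coordCovector_apply hΦ hqs.1, chartDeriv_coordVec Λ hΦ hΦs hΨ hq, inner_star_left]
    have hBinner : ∀ ξ η, Po.bivector q (coordCovector Φ q ξ) (coordCovector Φ q η) =
        inner ℝ (star J η) (B 0 (star J ξ)) + inner ℝ (star J η) (T (star J ξ)) := fun ξ η => by
      rw [bivector_coordCovector hΦ Po hqs.1, ← inner_add_right, inner_star_left]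
      change inner ℝ η (B (Φ q) ξ) = _
      rw [hBq]
      rfl
    have hQ : star (1 - Pr) = 1 - Pr := by rw [star_sub, star_one, hPW.star_P]
    have hQz : ∀ j, (1 - Pr) (Λ (basisZ k j)) = Λ (basisZ k j) := fun j => by
      change Λ (basisZ k j) - Pr (Λ (basisZ k j)) = _
      rw [hΛP]
      simp [basisZ]
    have hTsum : ∀ a b : E, inner ℝ b (T a) = ∑ i, ∑ j, inner ℝ (Λ (basisZ k j))
        (T (Λ (basisZ k i))) * (inner ℝ a (Λ (basisZ k i)) * inner ℝ b (Λ (basisZ k j))) :=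
      inner_compression_eq_sum hQ hΛz hQz
    -- Skewness of the transverse block is read off from the antisymmetry of the bivector and of `B
    -- 0`.
    have hTskew : ∀ ξ η, inner ℝ (star J η) (T (star J ξ)) =
        -inner ℝ (star J ξ) (T (star J η)) := fun ξ η => by
      have h1 := Po.bivector_antisymm q (coordCovector Φ q ξ) (coordCovector Φ q η)
      rw [hBinner, hBinner, inner_eq_neg_of_skew hskew0] at h1
      linarith
    have hf : ∀ i j, f i j (φ q).2.2 =
        2⁻¹ * inner ℝ (Λ (basisZ k j)) (T (Λ (basisZ k i))) := fun i j => by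
      simp only [f, hinclφ]
      rfl
    refine LinearMap.ext fun α => LinearMap.ext fun β => ?_
    obtain ⟨ξ, rfl⟩ := exists_eq_coordCovector hΦ hΦs hqs.1 α
    obtain ⟨η, rfl⟩ := exists_eq_coordCovector hΦ hΦs hqs.1 β
    simp only [LinearMap.add_apply, LinearMap.sum_apply, LinearMap.smul_apply, wedge_apply, hcoord,
      hf, smul_eq_mul]
    rw [hBinner, hΛB]
    congr 1
    have h1 : inner ℝ (star J η) (T (star J ξ)) = 2⁻¹ * inner ℝ (star J η) (T (star J ξ)) -
        2⁻¹ * inner ℝ (star J ξ) (T (star J η)) := by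
      have := hTskew ξ η
      linarith
    rw [h1, hTsum, hTsum, Finset.mul_sum, Finset.mul_sum, ← Finset.sum_sub_distrib]
    refine Finset.sum_congr rfl fun i _ => ?_
    rw [Finset.mul_sum, Finset.mul_sum, ← Finset.sum_sub_distrib]
    refine Finset.sum_congr rfl fun j _ => ?_
    ring
  · intro g q hq
    have hqs := (mem_splitChart_source Φ Ψ Λ).1 hq
    have h1 := hequi g q hqs.1
    have h2 := hρΨ g _ hqs.2
    refine ⟨(mem_splitChart_source Φ Ψ Λ).2 ⟨h1.1, h1.2 ▸ h2.1⟩, ?_⟩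
    rw [hρ']
    change Λ.symm (Ψ.symm (Φ (g • q))) = Λ.symm (ρ g (Λ (Λ.symm (Ψ.symm (Φ q)))))
    rw [h1.2, h2.2, Λ.apply_symm_apply]
  · rintro g c ⟨hc1, hc2⟩
    have h1 := hPΛ (ρ' g c)
    have h2 : Pr (Λ c) = 0 := by
      rw [hΛP, hc1, hc2]
      exact map_zero Λ
    rw [hPρ', h2, map_zero, map_zero] at h1
    exact ⟨(congrArg Prod.fst h1).symm, (congrArg (fun c => c.2.1) h1).symm⟩
  · intro g c hc
    have h1 := hPΛ (ρ' g c)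
    have hc' : c.2.2 = 0 := hc
    have h2 : Pr (Λ c) = Λ c := by rw [hΛP, ← hc']
    rw [hPρ', h2] at h1
    exact congrArg (fun c => c.2.2) h1
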